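/- **Setting.** Let $W(x)=\sum_{k=1}^d W_k(x_k)$, where each $W_k:\mathbb R\to\mathbb R$ is strictly increasing, right-continuous, and satisfies $W_k(u+1)-W_k(u)=W_k(1)-W_k(0)$ for all $u$. Identify $\mathbb T=\mathbb R/\mathbb Z$ with $(0,1]$, let $dW_k$ be the measure with $dW_k((a,b])=W_k(b)-W_k(a)$, and let $x^k\otimes W_k$ be the measure $dx_1\cdots dx_{k-1}\,dW_k\,dx_{k+1}\cdots dx_d$ on $\mathbb T^d$. *Sobolev space.* Let $\mathbb D_W$ be the span of the products $f(x)=\prod_j f_j(x_j)$ of eigenvectors $f_j$ of $\frac{d}{dx}\frac{d}{dW_j}$ on $\mathbb T$. $H_{1,W}(\mathbb T^d)$ is the space of $g\in L^2(\mathbb T^d)$ such that for each $k$ there is $\partial_{W_k}g:=G_k\in L^2_{x^k\otimes W_k}(\mathbb T^d)$ with $\int G_k\,dW_k(x_k)=0$ for a.e. value of the other variables and $\int(\partial_{x_k}\partial_{W_k}f)\,g\,dx=-\int(\partial_{W_k}f)\,G_k\,d(x^k\otimes W_k)$ for all $f\in\mathbb D_W$. Its inner product is $\int fg\,dx+\sum_k\int\partial_{W_k}f\,\partial_{W_k}g\,d(x^k\otimes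 W_k)$; its dual is $H_W^{-1}$. *Discrete objects.* For $N\ge1$ and a mesh function $u:\frac1N\mathbb T_N^d\to\mathbb R$ put $\Delta W_k(x)=W_k(x_k+\frac1N)-W_k(x_k)$ and $\partial^N_{W_k}u(x)=\big(u(x+\frac{e_k}N)-u(x)\big)/\Delta W_k(x)$. Let $Q_N(x)=\{y: x_i<y_i\le x_i+\frac1N\ \forall i\}$. Let $\tilde u$ be the function equal to $u(x)$ on each $Q_N(x)$, and $u^*$ the $W$-interpolation, i.e. on each $Q_N(x)$ the function that is affine in each $W_i(y_i)$ separately and interpolates the values of $u$ at the vertices of the cell. Write $\langle u,v\rangle_N=N^{-d}\sum_x u(x)v(x)$ and $\langle u,v\rangle_{W_k,N}=N^{-(d-1)}\sum_x u(x)v(x)\Delta W_k(x)$. *Right-hand sides.* Linear functionals $f^N$ on mesh functions *converge strongly* to $f\in H_W^{-1}$ if there are representations $f^N(v)=\langle f^N_0,v\rangle_N+\sum_k\langle f^N_k,\partial^N_{W_k}v\rangle_{W_k,N}$ and $f(v)=\int f_0v\,dx+\sum_k\int f_k\,\partial_{W_k}v\,d(x^k\otimes W_k)$ with $\tilde f^N_0\to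 f_0$ in $L^2(\mathbb T^d)$ and $\tilde f^N_k\to f_k$ in $L^2_{x^k\otimes W_k}(\mathbb T^d)$ for each $k$. *Homogenization.* A diagonal matrix function $A=(a_{kk})$ is a *homogenization* of a sequence $A^N=(a^N_{kk})$ of diagonal matrices of mesh functions if, for some $\theta'>0$, $\theta'^{-1}\le a^N_{kk}\le\theta'$ for all $N,k$ and $\theta'^{-1}\le a_{kk}\le\theta'$ a.e., and if for every $\lambda\ge0$ and all $f^N\to f$ strongly (with $f^N$ and $f$ vanishing on constants when $\lambda=0$) the following holds. For each $N$ there is a unique mesh function $u_N$ with $\lambda\langle u_N,v\rangle_N+\sum_k\langle a^N_{kk}\partial^N_{W_k}u_N,\partial^N_{W_k}v\rangle_{W_k,N}=f^N(v)$ for all $v$; there is a unique $u_0\in H_{1,W}$ with $\lambda\int u_0v\,dx+\sum_k\int a_{kk}\,\partial_{W_k}u_0\,\partial_{W_k}v\,d(x^k\otimes W_k)=f(v)$ for all $v\in H_{1,W}$ (in both cases among functions of zero mean when $\lambda=0$); and, as $N\to\infty$, $u_N^*\to u_0$ weakly in $H_{1,W}$ (in particular $u_N^*\in H_{1,W}$)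 and $\widetilde{a^N_{kk}\partial^N_{W_k}u_N}\to a_{kk}\,\partial_{W_k}u_0$ weakly in $L^2_{x^k\otimes W_k}(\mathbb T^d)$ for each $k$. *Coefficients.* $C_W(\mathbb T^d)$ is the span of the products $f_1\otimes\cdots\otimes f_d$ of càdlàg functions $f_k:\mathbb T\to\mathbb R$ whose discontinuities are all discontinuities of $W_k$. $\mathbb M_W$ is the set of diagonal matrix functions $A=(a_{kk})$ such that each $a_{kk}$ belongs to $C_W(\mathbb T^d)$ and has a partial derivative in the $k$-th direction everywhere. **Proposition 5.9.** Let $A=(a_{kk})\in\mathbb M_W$ with $a_{kk}\ge\theta^{-1}$ on $\mathbb T^d$ for all $k$, for some $\theta>0$, and let $$a^N_{kk}(x)=\frac{N^{d-1}}{W_k(x_k+1/N)-W_k(x_k)}\int_{Q_N(x)}a_{kk}\,d(x^k\otimes W_k),\qquad x\in\tfrac1N\mathbb T_N^d .$$ Then, for each $k$, $\widetilde{a^N_{kk}}\to a_{kk}$ and $1/\widetilde{a^N_{kk}}\to 1/a_{kk}$ strongly in $L^2_{x^k\otimes W_k}(\mathbb T^d)$, and the sequence $(A^N)$ admits a homogenization;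 indeed $A$ is a homogenization of $(A^N)$. -/

import Mathlib

open MeasureTheory Filter Topology Set

noncomputable section

/-! ### The torus and its measures

The torus `𝕋 = ℝ/ℤ` is identified with the fundamental domain `(0,1]`. A function on `𝕋^d` is a
function on `ℝ^d` that only matters on `(0,1]^d`, or a function on `ℝ^d` that is `1`-periodic in
every variable where pointwise regularity is involved. The measure `dW` of an increasing
right-continuous `W` is its Stieltjes measure, `dW((a,b]) = W b - W a`. -/

/-- Lebesgue measure on `𝕋^d = (0,1]^d`. -/
def torusVol (d : ℕ) : Measure (Fin d → ℝ) :=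
  Measure.pi fun _ => volume.restrict (Ioc (0 : ℝ) 1)

/-- The `j`-th factor of `d(x^k ⊗ W_k)`: `dW_k` if `j = k`, and `dx_j` otherwise. -/
def mixedFactor {d : ℕ} (W : Fin d → StieltjesFunction ℝ) (k j : Fin d) : Measure ℝ :=
  if j = k then (W k).measure.restrict (Ioc 0 1) else volume.restrict (Ioc 0 1)

/-- `d(x^k ⊗ W_k) = dx_1 ⋯ dx_{k-1} dW_k dx_{k+1} ⋯ dx_d` on `𝕋^d = (0,1]^d`. -/
def mixedVol {d : ℕ} (W : Fin d → StieltjesFunction ℝ) (k : Fin d) : Measure (Fin d → ℝ) :=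
  Measure.pi (mixedFactor W k)

instance instFiniteTorusVol (d : ℕ) : IsFiniteMeasure (torusVol d) := by
  unfold torusVol; infer_instance

instance instFiniteMixedFactor {d : ℕ} (W : Fin d → StieltjesFunction ℝ) (k j : Fin d) :
    IsFiniteMeasure (mixedFactor W k j) := by
  unfold mixedFactor
  split_ifs
  · refine ⟨?_⟩
    rw [Measure.restrict_apply_univ, StieltjesFunction.measure_Ioc]
    exact ENNReal.ofReal_lt_top
  · infer_instance

instance instFiniteMixedVol {d : ℕ} (W : Fin d → StieltjesFunction ℝ) (k : Fin d) :
    IsFiniteMeasure (mixedVol W k) := by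
  unfold mixedVol; infer_instance

/-! ### Test functions -/

/-- An eigenvector of `(d/dx)(d/dw)` on `𝕋`: a bounded Borel function `f` with
`f(x) = f(0) + ∫_{(0,x]} h dw`, `h(x) = h(0) + ∫_0^x ev · f dz` on `[0,1]`, `f(1) = f(0)` and
`h(1) = h(0)`. Thus `h = df/dw` and `(d/dx)(df/dw) = ev · f`. (The zero function is allowed; this
does not change the linear span.) -/
structure WEigenfunction (w : StieltjesFunction ℝ) where
  /-- the eigenfunction `f` -/
  toFun : ℝ → ℝ
  /-- its derivative `h = df/dw` -/
  der : ℝ → ℝ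
  /-- the eigenvalue -/
  ev : ℝ
  measurable_toFun : Measurable toFun
  measurable_der : Measurable der
  bounded_toFun : ∃ C, ∀ x, |toFun x| ≤ C
  bounded_der : ∃ C, ∀ x, |der x| ≤ C
  eq_toFun : ∀ x ∈ Icc (0 : ℝ) 1, toFun x = toFun 0 + ∫ y in Ioc 0 x, der y ∂w.measure
  eq_der : ∀ x ∈ Icc (0 : ℝ) 1, der x = der 0 + ∫ z in Ioc 0 x, ev * toFun z
  periodic_toFun : toFun 1 = toFun 0
  periodic_der : der 1 = der 0

/-- The product `f(x) = ∏_j f_j(x_j)` of eigenfunctions. The span of these products is the space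
of test functions in the definition of the weak derivative. -/
def prodTest {d : ℕ} {W : Fin d → StieltjesFunction ℝ} (e : ∀ j, WEigenfunction (W j))
    (x : Fin d → ℝ) : ℝ :=
  ∏ j, (e j).toFun (x j)

/-- `∂_{W_k} f` for `f(x) = ∏_j f_j(x_j)`. -/
def prodTestDer {d : ℕ} {W : Fin d → StieltjesFunction ℝ} (e : ∀ j, WEigenfunction (W j))
    (k : Fin d) (x : Fin d → ℝ) : ℝ :=
  (e k).der (x k) * ∏ j ∈ Finset.univ.erase k, (e j).toFun (x j)

/-- `∂_{x_k} ∂_{W_k} f` for `f(x) = ∏_j f_j(x_j)`. -/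
def prodTestDer2 {d : ℕ} {W : Fin d → StieltjesFunction ℝ} (e : ∀ j, WEigenfunction (W j))
    (k : Fin d) (x : Fin d → ℝ) : ℝ :=
  (e k).ev * prodTest e x

/-! ### The `W`-Sobolev space -/

/-- `G` is the `k`-th weak derivative `∂_{W_k} g`: the integration by parts identity holds for all
products of eigenfunctions (equivalently, by linearity, for their span), and `G` has zero mean in
direction `k`, i.e. it is orthogonal to all bounded Borel functions of the other variables. -/
def IsWeakWDeriv {d : ℕ} (W : Fin d → StieltjesFunction ℝ) (k : Fin d)
    (g G : (Fin d → ℝ) → ℝ) : Prop :=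
  (∀ e : ∀ j, WEigenfunction (W j),
    ∫ x, prodTestDer2 e k x * g x ∂torusVol d = -∫ x, prodTestDer e k x * G x ∂mixedVol W k) ∧
  ∀ c : (Fin d → ℝ) → ℝ, Measurable c → (∃ C, ∀ x, |c x| ≤ C) →
    (∀ x t, c (Function.update x k t) = c x) → ∫ x, c x * G x ∂mixedVol W k = 0

/-- The Hilbert space `L²(𝕋^d) × ∏_k L²_{x^k ⊗ W_k}(𝕋^d)`. -/
abbrev L2Prod {d : ℕ} (W : Fin d → StieltjesFunction ℝ) : Type :=
  WithLp 2 (Lp ℝ 2 (torusVol d) × PiLp 2 fun k : Fin d => Lp ℝ 2 (mixedVol W k))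

theorem measurable_prodTest {d : ℕ} {W : Fin d → StieltjesFunction ℝ}
    (e : ∀ j, WEigenfunction (W j)) : Measurable (prodTest e) := by
  unfold prodTest
  exact Finset.measurable_prod _ fun j _ => (e j).measurable_toFun.comp (measurable_pi_apply j)

theorem measurable_prodTestDer2 {d : ℕ} {W : Fin d → StieltjesFunction ℝ}
    (e : ∀ j, WEigenfunction (W j)) (k : Fin d) : Measurable (prodTestDer2 e k) :=
  (measurable_prodTest e).const_mul _

theorem measurable_prodTestDer {d : ℕ} {W : Fin d → StieltjesFunction ℝ}
    (e : ∀ j, WEigenfunction (W j)) (k : Fin d) : Measurable (prodTestDer e k) := by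
  unfold prodTestDer
  exact ((e k).measurable_der.comp (measurable_pi_apply k)).mul
    (Finset.measurable_prod _ fun j _ => (e j).measurable_toFun.comp (measurable_pi_apply j))

theorem bounded_prod_toFun {d : ℕ} {W : Fin d → StieltjesFunction ℝ}
    (e : ∀ j, WEigenfunction (W j)) (s : Finset (Fin d)) :
    ∃ C, ∀ x : Fin d → ℝ, |∏ j ∈ s, (e j).toFun (x j)| ≤ C := by
  choose C hC using fun j => (e j).bounded_toFun
  refine ⟨∏ j ∈ s, C j, fun x => ?_⟩
  rw [Finset.abs_prod]
  exact Finset.prod_le_prod (fun _ _ => abs_nonneg _) fun j _ => hC j _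

theorem bounded_prodTestDer2 {d : ℕ} {W : Fin d → StieltjesFunction ℝ}
    (e : ∀ j, WEigenfunction (W j)) (k : Fin d) : ∃ C, ∀ x, |prodTestDer2 e k x| ≤ C := by
  obtain ⟨C, hC⟩ := bounded_prod_toFun e Finset.univ
  refine ⟨|(e k).ev| * C, fun x => ?_⟩
  rw [prodTestDer2, prodTest, abs_mul]
  exact mul_le_mul_of_nonneg_left (hC x) (abs_nonneg _)

theorem bounded_prodTestDer {d : ℕ} {W : Fin d → StieltjesFunction ℝ}
    (e : ∀ j, WEigenfunction (W j)) (k : Fin d) : ∃ C, ∀ x, |prodTestDer e k x| ≤ C := by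
  obtain ⟨C, hC⟩ := bounded_prod_toFun e (Finset.univ.erase k)
  obtain ⟨D, hD⟩ := (e k).bounded_der
  refine ⟨D * C, fun x => ?_⟩
  rw [prodTestDer, abs_mul]
  exact mul_le_mul (hD _) (hC x) (abs_nonneg _) ((abs_nonneg _).trans (hD 0))

theorem integrable_bdd_mul_L2 {d : ℕ} {μ : Measure (Fin d → ℝ)} [IsFiniteMeasure μ]
    {c : (Fin d → ℝ) → ℝ} (hm : Measurable c) (hb : ∃ C, ∀ x, |c x| ≤ C) (g : Lp ℝ 2 μ) :
    Integrable (fun x => c x * g x) μ := by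
  obtain ⟨C, hC⟩ := hb
  exact ((Lp.memLp g).integrable (by norm_num)).bdd_mul (c := C) hm.aestronglyMeasurable
    (Eventually.of_forall fun x => by simpa using hC x)

theorem integral_mul_add_L2 {d : ℕ} {μ : Measure (Fin d → ℝ)} [IsFiniteMeasure μ]
    {c : (Fin d → ℝ) → ℝ} (hm : Measurable c) (hb : ∃ C, ∀ x, |c x| ≤ C) (g h : Lp ℝ 2 μ) :
    ∫ x, c x * (g + h : Lp ℝ 2 μ) x ∂μ = ∫ x, c x * g x ∂μ + ∫ x, c x * h x ∂μ := by
  rw [← integral_add (integrable_bdd_mul_L2 hm hb g) (integrable_bdd_mul_L2 hm hb h)]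
  refine integral_congr_ae ?_
  filter_upwards [Lp.coeFn_add g h] with x hx
  rw [hx, Pi.add_apply, mul_add]

theorem integral_mul_smul_L2 {d : ℕ} {μ : Measure (Fin d → ℝ)}
    (c : (Fin d → ℝ) → ℝ) (r : ℝ) (g : Lp ℝ 2 μ) :
    ∫ x, c x * (r • g : Lp ℝ 2 μ) x ∂μ = r * ∫ x, c x * g x ∂μ := by
  rw [← integral_const_mul]
  refine integral_congr_ae ?_
  filter_upwards [Lp.coeFn_smul r g] with x hx
  rw [hx, Pi.smul_apply, smul_eq_mul]; ring

theorem integral_mul_zero_L2 {d : ℕ} {μ : Measure (Fin d → ℝ)} (c : (Fin d → ℝ) → ℝ) :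
    ∫ x, c x * (0 : Lp ℝ 2 μ) x ∂μ = 0 := by
  have h : ∫ x, c x * (0 : Lp ℝ 2 μ) x ∂μ = ∫ _, (0 : ℝ) ∂μ := by
    refine integral_congr_ae ?_
    filter_upwards [Lp.coeFn_zero ℝ 2 μ] with x hx
    rw [hx, Pi.zero_apply, mul_zero]
  rw [h, integral_zero]

/-- The `W`-Sobolev space `H_{1,W}(𝕋^d)`, realized as the set of pairs `(g, ∇_W g)`, with the inner
product `⟨f, g⟩ + ∑_k ∫ (∂_{W_k} f) (∂_{W_k} g) d(x^k ⊗ W_k)`. -/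
def H1W {d : ℕ} (W : Fin d → StieltjesFunction ℝ) : Submodule ℝ (L2Prod W) where
  carrier := {p | ∀ k, IsWeakWDeriv W k p.fst (p.snd k)}
  zero_mem' := fun k => by
    have h1 : (0 : L2Prod W).fst = 0 := rfl
    have h2 : (0 : L2Prod W).snd k = 0 := rfl
    rw [h1, h2]
    refine ⟨fun e => ?_, fun c _ _ _ => integral_mul_zero_L2 c⟩
    rw [integral_mul_zero_L2, integral_mul_zero_L2, neg_zero]
  add_mem' := fun {p q} hp hq k => by
    have h1 : (p + q).fst = p.fst + q.fst := rfl
    have h2 : (p + q).snd k = p.snd k + q.snd k := rfl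
    rw [h1, h2]
    refine ⟨fun e => ?_, fun c hm hb hc => ?_⟩
    · rw [integral_mul_add_L2 (measurable_prodTestDer2 e k) (bounded_prodTestDer2 e k),
        integral_mul_add_L2 (measurable_prodTestDer e k) (bounded_prodTestDer e k),
        (hp k).1 e, (hq k).1 e]
      ring
    · rw [integral_mul_add_L2 hm hb, (hp k).2 c hm hb hc, (hq k).2 c hm hb hc, add_zero]
  smul_mem' := fun r p hp k => by
    have h1 : (r • p).fst = r • p.fst := rfl
    have h2 : (r • p).snd k = r • p.snd k := rfl
    rw [h1, h2]
    refine ⟨fun e => ?_, fun c hm hb hc => ?_⟩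
    · rw [integral_mul_smul_L2, integral_mul_smul_L2, (hp k).1 e]
      ring
    · rw [integral_mul_smul_L2, (hp k).2 c hm hb hc, mul_zero]

/-- The underlying function of an element of `H_{1,W}`. -/
def h1Fn {d : ℕ} {W : Fin d → StieltjesFunction ℝ} (u : H1W W) : (Fin d → ℝ) → ℝ :=
  (u : L2Prod W).fst

/-- The weak derivative `∂_{W_k} u` of an element of `H_{1,W}`. -/
def h1Deriv {d : ℕ} {W : Fin d → StieltjesFunction ℝ} (u : H1W W) (k : Fin d) :
    (Fin d → ℝ) → ℝ :=
  (u : L2Prod W).snd k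

/-- Weak convergence of a sequence in the Hilbert space `H_{1,W}`. -/
def WeakConvH1W {d : ℕ} {W : Fin d → StieltjesFunction ℝ} (v : ℕ+ → H1W W) (u : H1W W) : Prop :=
  ∀ φ : H1W W, Tendsto (fun N => inner ℝ (v N) φ) atTop (𝓝 (inner ℝ u φ))

/-- Weak convergence in `L²(μ)` of a sequence of functions. -/
def WeakConvL2 {d : ℕ} (μ : Measure (Fin d → ℝ)) (v : ℕ+ → (Fin d → ℝ) → ℝ)
    (u : (Fin d → ℝ) → ℝ) : Prop :=
  (∀ N, MemLp (v N) 2 μ) ∧ MemLp u 2 μ ∧ ∀ φ, MemLp φ 2 μ →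
    Tendsto (fun N => ∫ y, v N y * φ y ∂μ) atTop (𝓝 (∫ y, u y * φ y ∂μ))

/-- Strong convergence in `L²(μ)` of a sequence of functions. -/
def StrongConvL2 {d : ℕ} (μ : Measure (Fin d → ℝ)) (v : ℕ+ → (Fin d → ℝ) → ℝ)
    (u : (Fin d → ℝ) → ℝ) : Prop :=
  (∀ N, MemLp (v N) 2 μ) ∧ MemLp u 2 μ ∧
    Tendsto (fun N => eLpNorm (fun y => v N y - u y) 2 μ) atTop (𝓝 0)

/-! ### The discrete torus -/

/-- Functions on the mesh `N⁻¹ 𝕋_N^d`; the index `x` stands for the mesh point `x / N`. -/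
abbrev Mesh (d : ℕ) (N : ℕ+) : Type := (Fin d → ZMod N) → ℝ

/-- The `W_k`-length of the mesh interval at `x`: `W_k((x_k + 1)/N) - W_k(x_k/N)`. -/
def meshDW {d : ℕ} (W : Fin d → StieltjesFunction ℝ) (N : ℕ+) (k : Fin d)
    (x : Fin d → ZMod N) : ℝ :=
  W k ((((x k).val : ℝ) + 1) / (N : ℕ)) - W k (((x k).val : ℝ) / (N : ℕ))

/-- The difference operator `∂_{W_k}^N`. -/
def meshDer {d : ℕ} (W : Fin d → StieltjesFunction ℝ) (N : ℕ+) (k : Fin d) (u : Mesh d N) :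
    Mesh d N :=
  fun x => (u (x + Pi.single k 1) - u x) / meshDW W N k x

/-- The cell at `x`. It is taken half-open on the left, `x_i/N < y_i ≤ (x_i+1)/N`, so that
`dW_k` gives its `k`-th side the mass `W_k((x_k + 1)/N) - W_k(x_k/N)`. -/
def meshCell {d : ℕ} (N : ℕ+) (x : Fin d → ZMod N) : Set (Fin d → ℝ) :=
  {y | ∀ i, ((x i).val : ℝ) / (N : ℕ) < y i ∧ y i ≤ (((x i).val : ℝ) + 1) / (N : ℕ)}

/-- The piecewise-constant interpolation `ũ` of a mesh function. -/
def pcInterp {d : ℕ} (N : ℕ+) (u : Mesh d N) (y : Fin d → ℝ) : ℝ :=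
  ∑ x : Fin d → ZMod N, (meshCell N x).indicator (fun _ => u x) y

/-- The `W`-interpolation `u^*`: on each cell, the function which is affine in each `W_i(y_i)` and
takes the values of `u` at the vertices `x + e_S`, `S ⊆ {1, …, d}`, of the cell. -/
def wInterp {d : ℕ} (W : Fin d → StieltjesFunction ℝ) (N : ℕ+) (u : Mesh d N)
    (y : Fin d → ℝ) : ℝ :=
  ∑ x : Fin d → ZMod N, (meshCell N x).indicator (fun y =>
    ∑ S : Finset (Fin d), u (fun i => if i ∈ S then x i + 1 else x i) *
      ∏ i, if i ∈ S then (W i (y i) - W i (((x i).val : ℝ) / (N : ℕ))) / meshDW W N i x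
        else 1 - (W i (y i) - W i (((x i).val : ℝ) / (N : ℕ))) / meshDW W N i x) y

/-- The cell averages of a diagonal matrix function: `a_kk` is averaged over every cell with
respect to `d(x^k ⊗ W_k)`. -/
def cellAverage {d : ℕ} (W : Fin d → StieltjesFunction ℝ) (a : Fin d → (Fin d → ℝ) → ℝ)
    (N : ℕ+) (k : Fin d) : Mesh d N :=
  fun x => ((N : ℕ) : ℝ) ^ (d - 1) / meshDW W N k x * ∫ y in meshCell N x, a k y ∂mixedVol W k

/-- The pairing `N^{-d} ∑_x f(x/N) g(x/N)`. -/
def meshInner {d : ℕ} (N : ℕ+) (f g : Mesh d N) : ℝ :=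
  (((N : ℕ) : ℝ) ^ d)⁻¹ * ∑ x, f x * g x

/-- The pairing `N^{-(d-1)} ∑_x f(x/N) g(x/N) [W_k((x_k + 1)/N) - W_k(x_k/N)]`. -/
def meshInnerW {d : ℕ} (W : Fin d → StieltjesFunction ℝ) (N : ℕ+) (k : Fin d)
    (f g : Mesh d N) : ℝ :=
  (((N : ℕ) : ℝ) ^ (d - 1))⁻¹ * ∑ x, f x * g x * meshDW W N k x

/-! ### Elliptic problems and homogenization -/

/-- `u` is the weak solution of `lam u - ∇^N A^N ∇_W^N u = f` for a functional `f` on mesh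
functions; for `lam = 0` the solution is normalized to have zero mean. -/
def IsMeshSolution {d : ℕ} (W : Fin d → StieltjesFunction ℝ) (N : ℕ+) (lam : ℝ)
    (a : Fin d → Mesh d N) (f : Mesh d N →ₗ[ℝ] ℝ) (u : Mesh d N) : Prop :=
  (∀ v : Mesh d N, lam * meshInner N u v +
      ∑ k, meshInnerW W N k (a k * meshDer W N k u) (meshDer W N k v) = f v) ∧
  (lam = 0 → ∑ x, u x = 0)

/-- `u` is the weak solution in `H_{1,W}` of `lam u - ∇ A ∇_W u = f`, where `f` belongs to the dual
of `H_{1,W}`; for `lam = 0` the solution is normalized to have zero mean. -/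
def IsWeakSolution {d : ℕ} (W : Fin d → StieltjesFunction ℝ) (lam : ℝ)
    (a : Fin d → (Fin d → ℝ) → ℝ) (f : StrongDual ℝ (H1W W)) (u : H1W W) : Prop :=
  (∀ v : H1W W, lam * (∫ y, h1Fn u y * h1Fn v y ∂torusVol d) +
      ∑ k, ∫ y, a k y * h1Deriv u k y * h1Deriv v k y ∂mixedVol W k = f v) ∧
  (lam = 0 → ∫ y, h1Fn u y ∂torusVol d = 0)

/-- Strong convergence of functionals on mesh functions to `f` in the dual of `H_{1,W}`: there are
representations `f^N = f_0^N - ∑_k ∂_{x_k}^N f_k^N` and `f = f_0 - ∑_k ∂_{x_k} f_k` whose components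
converge, `f_0^N → f_0` in `L²` and `f_k^N → f_k` in `L²_{x^k ⊗ W_k}`. -/
def StrongConvDual {d : ℕ} (W : Fin d → StieltjesFunction ℝ)
    (fN : ∀ N : ℕ+, Mesh d N →ₗ[ℝ] ℝ) (f : StrongDual ℝ (H1W W)) : Prop :=
  ∃ (gN : ∀ N : ℕ+, Mesh d N) (GN : ∀ N : ℕ+, Fin d → Mesh d N)
    (g : (Fin d → ℝ) → ℝ) (G : Fin d → (Fin d → ℝ) → ℝ),
    (∀ N v, fN N v = meshInner N (gN N) v +
      ∑ k, meshInnerW W N k (GN N k) (meshDer W N k v)) ∧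
    (∀ v : H1W W, f v = (∫ y, g y * h1Fn v y ∂torusVol d) +
      ∑ k, ∫ y, G k y * h1Deriv v k y ∂mixedVol W k) ∧
    StrongConvL2 (torusVol d) (fun N => pcInterp N (gN N)) g ∧
    ∀ k, StrongConvL2 (mixedVol W k) (fun N => pcInterp N (GN N k)) (G k)

/-- The diagonal matrix function `a` is a homogenization of the sequence `aN` of diagonal matrices
of mesh functions (`aN` `H`-converges to `a`). Both are elliptic; for all `lam ≥ 0` and all strongly
convergent right-hand sides (annihilating the constants if `lam = 0`), the discrete and continuous
problems are uniquely solvable, the discrete solutions converge weakly in `H_{1,W}` (through their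
`W`-interpolations), and the fluxes converge weakly in `L²_{x^k ⊗ W_k}`. -/
def IsHomogenization {d : ℕ} (W : Fin d → StieltjesFunction ℝ)
    (aN : ∀ N : ℕ+, Fin d → Mesh d N) (a : Fin d → (Fin d → ℝ) → ℝ) : Prop :=
  (∃ θ : ℝ, 0 < θ ∧ (∀ N k x, θ⁻¹ ≤ aN N k x ∧ aN N k x ≤ θ) ∧
    ∀ k, AEStronglyMeasurable (a k) (mixedVol W k) ∧
      ∀ᵐ y ∂mixedVol W k, θ⁻¹ ≤ a k y ∧ a k y ≤ θ) ∧
  ∀ (lam : ℝ), 0 ≤ lam →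
    ∀ (fN : ∀ N : ℕ+, Mesh d N →ₗ[ℝ] ℝ) (f : StrongDual ℝ (H1W W)),
    StrongConvDual W fN f →
    (lam = 0 → (∀ N, fN N (fun _ => 1) = 0) ∧
      ∀ (v : H1W W) (c : ℝ), h1Fn v =ᵐ[torusVol d] (fun _ => c) → f v = 0) →
    (∀ N, ∃! u, IsMeshSolution W N lam (aN N) (fN N) u) ∧
    (∃! u, IsWeakSolution W lam a f u) ∧
    ∀ (uN : ∀ N : ℕ+, Mesh d N) (u : H1W W),
      (∀ N, IsMeshSolution W N lam (aN N) (fN N) (uN N)) → IsWeakSolution W lam a f u →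
      (∃ v : ℕ+ → H1W W, (∀ N, h1Fn (v N) =ᵐ[torusVol d] wInterp W N (uN N)) ∧ WeakConvH1W v u) ∧
      ∀ k, WeakConvL2 (mixedVol W k) (fun N => pcInterp N (aN N k * meshDer W N k (uN N)))
        (fun y => a k y * h1Deriv u k y)

/-! ### The coefficients -/

/-- `C_w(𝕋)`: the càdlàg functions on `𝕋` (`1`-periodic functions on `ℝ`) all of whose
discontinuities are discontinuities of `w`. -/
def CW1 (w : StieltjesFunction ℝ) : Set (ℝ → ℝ) :=
  {f | Function.Periodic f 1 ∧ (∀ x, ContinuousWithinAt f (Ici x) x) ∧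
    (∀ x, ∃ l, Tendsto f (𝓝[<] x) (𝓝 l)) ∧ ∀ x, ContinuousAt w x → ContinuousAt f x}

/-- `C_W(𝕋^d)`: the linear span of the products `f_1 ⊗ ⋯ ⊗ f_d` with `f_k ∈ C_{W_k}(𝕋)`. -/
def CW {d : ℕ} (W : Fin d → StieltjesFunction ℝ) : Submodule ℝ ((Fin d → ℝ) → ℝ) :=
  Submodule.span ℝ {f | ∃ g : Fin d → ℝ → ℝ, (∀ k, g k ∈ CW1 (W k)) ∧
    f = fun x => ∏ k, g k (x k)}

/-- `𝕄_W`: the diagonal matrix functions with entries in `C_W(𝕋^d)` such that the `k`-th entry has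
a partial derivative in direction `k` at every point. -/
def MW {d : ℕ} (W : Fin d → StieltjesFunction ℝ) : Set (Fin d → (Fin d → ℝ) → ℝ) :=
  {a | ∀ k, a k ∈ CW W ∧
    ∀ x, DifferentiableAt ℝ (fun t => a k (Function.update x k t)) (x k)}

end

/-! The entries of `A` are sums of products of càdlàg functions, so their cell averages converge
boundedly and almost everywhere: at a continuity point because the cell shrinks to it, and at a jump
of `W_k` because the atom of `dW_k` there keeps a fixed mass while the rest of its cell loses all
mass (`tendsto_pcInterp_cellAverage`). Dominated convergence gives the two `L²` statements. Since
the coefficients converge strongly, homogenization becomes a compactness argument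
(`isHomogenization_of_ae_tendsto`).

A discrete solution is recorded by the pair `pcGrad` of its piecewise constant interpolation and
those of its difference quotients. Coercivity, helped by the discrete Poincaré inequality
`exists_poincare` when `lam = 0`, bounds these pairs, so they have a weak limit along every
ultrafilter below `atTop`. Three facts identify this limit.

The limit lies in `H_{1,W}` (`mem_H1W_of_weakTendsto`). The interpolation that is `W`-affine in
direction `k` only has as its `k`-th weak derivative exactly the piecewise constant interpolation of
the difference quotient, and its `L²` distance to the piecewise constant function is of order
`N^{-1/2}`.

The limit solves the equation (`isWeakSolution_of_weakTendsto`). The form is symmetric, so the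
coefficient can be put on the test function. A product of eigenfunctions, restricted to the mesh,
converges strongly together with its difference quotients, also after multiplication by `a^N`; weak
times strong passes to the limit. These products are total in `H_{1,W}`.

The solution is unique (`IsWeakSolution.unique`). Hence all ultrafilters give the same limit, the
whole sequence converges, and existence in `H_{1,W}` is obtained on the way. The `W`-interpolations
are bounded in `H_{1,W}` and have the same `L²` limit, and an element of `H_{1,W}` is determined by
its function (`fst_injOn_H1W`).

What remains is that there are enough eigenfunctions. The operator `invDerOp`, called `J`, inverts
`d/dx` modulo constants and is compact as a centred Volterra operator from `L²(dx)` to `L²(dw)`. By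
the spectral theorem the eigenvectors of `J*J` are total; those for `m ≠ 0` are eigenfunctions of
`(d/dx)(d/dw)` with eigenvalue `-1/m`, and the kernel consists of constants. It follows that the
derivatives of eigenfunctions, together with `1`, are total in `L²(dw)`, and
`ae_eq_zero_of_forall_prod` carries both statements to products of several variables. -/

noncomputable section

/-! ### Primitives on the unit interval and integration by parts -/

/-- An integrable function whose integral vanishes on a generating `π`-system and on the whole
space is zero almost everywhere. -/
theorem ae_eq_zero_of_isPiSystem {α : Type*} [m : MeasurableSpace α] {μ : Measure α}
    {C : Set (Set α)} (hgen : m = MeasurableSpace.generateFrom C) (hpi : IsPiSystem C)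
    {u : α → ℝ} (hu : Integrable u μ) (hC : ∀ s ∈ C, ∫ x in s, u x ∂μ = 0)
    (huniv : ∫ x, u x ∂μ = 0) : u =ᵐ[μ] 0 := by
  have key : ∀ s, MeasurableSet s → ∫ x in s, u x ∂μ = 0 := by
    intro s hs
    induction s, hs using MeasurableSpace.induction_on_inter hgen hpi with
    | empty => simp
    | basic t ht => exact hC t ht
    | compl t ht iht =>
      have := integral_add_compl ht hu
      linarith
    | iUnion f hd hm ih =>
      rw [integral_iUnion hm hd hu.integrableOn]
      simp [ih]
  exact hu.ae_eq_zero_of_forall_setIntegral_eq_zero fun s hs _ => key s hs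

theorem ae_eq_zero_of_setIntegral_Ioc {μ : Measure ℝ} (hμ : ∀ᵐ x ∂μ, x ∈ Ioc (0 : ℝ) 1)
    {u : ℝ → ℝ} (hu : Integrable u μ)
    (h : ∀ x ∈ Ioc (0 : ℝ) 1, ∫ y in Ioc 0 x, u y ∂μ = 0) : u =ᵐ[μ] 0 := by
  have hres : ∀ s : Set ℝ, s =ᵐ[μ] (s ∩ Ioc 0 1 : Set ℝ) := by
    intro s
    filter_upwards [hμ] with x hx
    exact propext ⟨fun h => ⟨h, hx⟩, fun h => h.1⟩
  have huniv : ∫ x, u x ∂μ = 0 := by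
    rw [← setIntegral_univ, setIntegral_congr_set (hres univ), univ_inter]
    exact h 1 ⟨one_pos, le_rfl⟩
  refine ae_eq_zero_of_isPiSystem (C := range Iic)
    (BorelSpace.measurable_eq.trans (borel_eq_generateFrom_Iic ℝ)) isPiSystem_Iic hu ?_ huniv
  rintro _ ⟨x, rfl⟩
  rw [setIntegral_congr_set (hres _)]
  rcases le_total x 0 with hx | hx
  · have : Iic x ∩ Ioc 0 1 = (∅ : Set ℝ) := by
      ext y; simp; intro h1 h2; linarith
    simp [this]
  rcases eq_or_lt_of_le hx with rfl | hx
  · have : Iic 0 ∩ Ioc 0 1 = (∅ : Set ℝ) := by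
      ext y; simp; intro h1 h2; linarith
    simp [this]
  have : Iic x ∩ Ioc 0 1 = Ioc 0 (min x 1) := by
    ext y; simp; tauto
  rw [this]
  exact h _ ⟨lt_min hx one_pos, min_le_right _ _⟩

/-- The primitive `x ↦ ∫_{(0,x]} u dμ`. -/
def primitive (μ : Measure ℝ) (u : ℝ → ℝ) (x : ℝ) : ℝ := ∫ y in Ioc 0 x, u y ∂μ

/-- The integrand is, as a function of both variables, the indicator of a measurable set times a
measurable version of `u`, so measurability of parametric integrals applies. -/
theorem measurable_primitive (μ : Measure ℝ) [SFinite μ] {u : ℝ → ℝ}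
    (hu : AEStronglyMeasurable u μ) : Measurable (primitive μ u) := by
  have h1 : primitive μ u = fun x => ∫ y, (Ioc 0 x).indicator (hu.mk u) y ∂μ := by
    funext x
    rw [primitive, ← integral_indicator measurableSet_Ioc]
    refine integral_congr_ae ?_
    filter_upwards [hu.ae_eq_mk] with y hy
    by_cases h : y ∈ Ioc 0 x <;> simp [h, hy]
  rw [h1]
  refine (StronglyMeasurable.integral_prod_right (f := fun x y =>
    (Ioc 0 x).indicator (hu.mk u) y) ?_).measurable
  have : (Function.uncurry fun x y => (Ioc 0 x).indicator (hu.mk u) y)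
      = {p : ℝ × ℝ | 0 < p.2 ∧ p.2 ≤ p.1}.indicator (fun p => hu.mk u p.2) := by
    funext p
    simp [Function.uncurry, indicator]
  rw [this]
  refine StronglyMeasurable.indicator (hu.stronglyMeasurable_mk.comp_measurable measurable_snd) ?_
  exact (measurableSet_lt measurable_const measurable_snd).inter
    (measurableSet_le measurable_snd measurable_fst)

theorem abs_primitive_le (μ : Measure ℝ) {u : ℝ → ℝ} (hu : Integrable u μ) (x : ℝ) :
    |primitive μ u x| ≤ ∫ y, |u y| ∂μ := by
  refine (abs_integral_le_integral_abs).trans ?_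
  exact setIntegral_le_integral hu.abs (Eventually.of_forall fun _ => abs_nonneg _)

theorem primitive_zero (μ : Measure ℝ) (u : ℝ → ℝ) : primitive μ u 0 = 0 := by
  simp [primitive]

theorem primitive_congr_ae {μ : Measure ℝ} {u v : ℝ → ℝ} (h : u =ᵐ[μ] v) :
    primitive μ u = primitive μ v := by
  funext x
  exact integral_congr_ae (ae_restrict_of_ae h)

theorem primitive_restrict (μ : Measure ℝ) (u : ℝ → ℝ) {x : ℝ} (hx : x ≤ 1) :
    primitive (μ.restrict (Ioc 0 1)) u x = ∫ y in Ioc 0 x, u y ∂μ := by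
  rw [primitive, Measure.restrict_restrict measurableSet_Ioc,
    inter_eq_left.2 (Ioc_subset_Ioc_right hx)]

theorem primitive_restrict_one (μ : Measure ℝ) (u : ℝ → ℝ) :
    primitive (μ.restrict (Ioc 0 1)) u 1 = ∫ y, u y ∂(μ.restrict (Ioc 0 1)) := by
  rw [primitive_restrict _ _ le_rfl]

theorem setIntegral_Ioc_one_eq {μ : Measure ℝ} {u : ℝ → ℝ}
    (hu : Integrable u (μ.restrict (Ioc 0 1))) {z : ℝ} (hz : z ∈ Ioc (0 : ℝ) 1) :
    ∫ y in Ioc z 1, u y ∂μ.restrict (Ioc 0 1)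
      = ∫ y, u y ∂(μ.restrict (Ioc 0 1)) - primitive (μ.restrict (Ioc 0 1)) u z := by
  rw [← primitive_restrict_one, primitive, primitive, eq_sub_iff_add_eq, add_comm,
    ← setIntegral_union (Ioc_disjoint_Ioc_of_le le_rfl) measurableSet_Ioc hu.integrableOn
      hu.integrableOn, Ioc_union_Ioc_eq_Ioc hz.1.le hz.2]

/-- Integration by parts for primitives, in the form of Fubini's theorem on a triangle. -/
theorem integral_primitive_mul (m : Measure ℝ) [SFinite (m.restrict (Ioc 0 1))]
    {f D : ℝ → ℝ}
    (hf : Integrable f (volume.restrict (Ioc 0 1))) (hD : Integrable D (m.restrict (Ioc 0 1))) :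
    ∫ x, primitive (volume.restrict (Ioc 0 1)) f x * D x ∂(m.restrict (Ioc 0 1)) =
      ∫ z, f z * ((∫ x, D x ∂(m.restrict (Ioc 0 1))) - primitive (m.restrict (Ioc 0 1)) D z)
        ∂(volume.restrict (Ioc 0 1)) := by
  set ν : Measure ℝ := volume.restrict (Ioc 0 1) with hν
  set μ := m.restrict (Ioc 0 1) with hμ
  -- The triangle is `z < x`, strictly. In `z` the missing end point is invisible to Lebesgue
  -- measure; in `x` the slice is `(z, 1]`, exactly the complement of the interval in the primitive
  -- of `D`, whatever atoms `m` has.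
  have h1 : ∫ x, primitive ν f x * D x ∂μ
      = ∫ x, ∫ z, {p : ℝ × ℝ | p.2 < p.1}.indicator (fun p => D p.1 * f p.2) (x, z) ∂ν ∂μ := by
    refine integral_congr_ae ?_
    filter_upwards [ae_restrict_mem measurableSet_Ioc] with x hx
    have : ∀ z, {p : ℝ × ℝ | p.2 < p.1}.indicator (fun p => D p.1 * f p.2) (x, z)
        = D x * (Iio x).indicator f z := by
      intro z; by_cases h : z < x <;> simp [indicator, h]
    simp_rw [this]
    rw [integral_const_mul, mul_comm, integral_indicator measurableSet_Iio, primitive]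
    congr 1
    rw [hν, Measure.restrict_restrict measurableSet_Ioc, Measure.restrict_restrict measurableSet_Iio,
      inter_eq_left.2 (Ioc_subset_Ioc_right hx.2)]
    have : Iio x ∩ Ioc 0 1 = Ioo 0 x := by
      ext z
      simp only [mem_inter_iff, mem_Iio, mem_Ioc, mem_Ioo]
      exact ⟨fun h => ⟨h.2.1, h.1⟩, fun h => ⟨h.2, h.1, h.2.le.trans hx.2⟩⟩
    rw [this, integral_Ioc_eq_integral_Ioo]
  have h2 : ∫ z, f z * ((∫ x, D x ∂μ) - primitive μ D z) ∂ν
      = ∫ z, ∫ x, {p : ℝ × ℝ | p.2 < p.1}.indicator (fun p => D p.1 * f p.2) (x, z) ∂μ ∂ν := by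
    refine integral_congr_ae ?_
    filter_upwards [ae_restrict_mem measurableSet_Ioc] with z hz
    have : ∀ x, {p : ℝ × ℝ | p.2 < p.1}.indicator (fun p => D p.1 * f p.2) (x, z)
        = f z * (Ioi z).indicator D x := by
      intro x; by_cases h : z < x <;> simp [indicator, h, mul_comm]
    simp_rw [this]
    rw [integral_const_mul, integral_indicator measurableSet_Ioi, hμ, ← setIntegral_Ioc_one_eq hD hz,
      Measure.restrict_restrict measurableSet_Ioc, Measure.restrict_restrict measurableSet_Ioi]
    congr 3
    ext x
    simp only [mem_inter_iff, mem_Ioi, mem_Ioc]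
    have := hz.1
    constructor
    · rintro ⟨a, b⟩; exact ⟨a.1, b⟩
    · rintro ⟨a, b⟩; exact ⟨⟨a, b.2⟩, b⟩
  rw [h1, h2, integral_integral_swap]
  have : Integrable (fun p : ℝ × ℝ => D p.1 * f p.2) (μ.prod ν) := hD.mul_prod hf
  exact this.indicator (measurableSet_lt measurable_snd measurable_fst)

end

/-! ### Hilbert–Schmidt operators, the Volterra operator and centring -/

noncomputable section

/-- The real inner product as a continuous bilinear map. -/
def realInnerL (H : Type*) [NormedAddCommGroup H] [InnerProductSpace ℝ H] : H →L[ℝ] H →L[ℝ] ℝ :=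
  (isBoundedBilinearMap_inner (𝕜 := ℝ) (E := H)).toContinuousLinearMap

/-- The Hilbert–Schmidt operator `g ↦ ⟪g, k(·)⟫` with kernel `k`. -/
def kernelOp {H α : Type*} [NormedAddCommGroup H] [InnerProductSpace ℝ H] [MeasurableSpace α]
    (μ : Measure α) : Lp H 2 μ →L[ℝ] H →L[ℝ] Lp ℝ 2 μ :=
  ((realInnerL H).compLpL₂ (p := 2) (μ := μ)).flip

theorem coeFn_kernelOp {H α : Type*} [NormedAddCommGroup H] [InnerProductSpace ℝ H]
    [MeasurableSpace α] {μ : Measure α} (k : Lp H 2 μ) (g : H) :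
    kernelOp μ k g =ᵐ[μ] fun x => inner ℝ g (k x) :=
  (realInnerL H g).coeFn_compLp k

/-- A kernel `c · 1_s` gives an operator of rank one; compactness survives sums and norm limits, and
the operator depends continuously on its kernel, so density of simple functions finishes. -/
theorem isCompactOperator_kernelOp {H α : Type*} [NormedAddCommGroup H] [InnerProductSpace ℝ H]
    [MeasurableSpace α] {μ : Measure α} (k : Lp H 2 μ) : IsCompactOperator (kernelOp μ k) := by
  refine Lp.induction ENNReal.ofNat_ne_top
    (motive := fun k => IsCompactOperator (kernelOp (H := H) μ k)) ?_ ?_ ?_ k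
  · intro c s hs hμs
    have : (kernelOp μ (Lp.simpleFunc.indicatorConst 2 hs hμs.ne c : Lp H 2 μ) : H → Lp ℝ 2 μ)
        = fun g => (ContinuousLinearMap.toSpanSingleton ℝ (indicatorConstLp 2 hs hμs.ne (1 : ℝ)))
          (realInnerL H c g) := by
      funext g
      refine Lp.ext ?_
      rw [ContinuousLinearMap.toSpanSingleton_apply]
      filter_upwards [coeFn_kernelOp (Lp.simpleFunc.indicatorConst 2 hs hμs.ne c : Lp H 2 μ) g,
        Lp.coeFn_smul (realInnerL H c g) (indicatorConstLp 2 hs hμs.ne (1 : ℝ)),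
        indicatorConstLp_coeFn (p := 2) (hs := hs) (hμs := hμs.ne) (c := (1 : ℝ)),
        indicatorConstLp_coeFn (p := 2) (hs := hs) (hμs := hμs.ne) (c := c)] with x h1 h2 h3 h4
      rw [h1, h2, Pi.smul_apply, h3, Lp.simpleFunc.coe_indicatorConst, h4]
      have : realInnerL H c g = inner ℝ g c := real_inner_comm _ _
      rw [this]
      by_cases hx : x ∈ s <;> simp [hx, indicator]
    rw [this]
    have h1 : IsCompactOperator (ContinuousLinearMap.toSpanSingleton ℝ
        (indicatorConstLp 2 hs hμs.ne (1 : ℝ))) :=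
      (isCompactOperator_id (E := ℝ)).clm_comp _
    exact h1.comp_clm _
  · intro f g hf hg _ ihf ihg
    rw [map_add]
    exact ihf.add ihg
  · exact isClosed_setOfPred_isCompactOperator.preimage (kernelOp (H := H) μ).continuous

/-- Lebesgue measure on `(0,1]`. -/
abbrev unitVol : Measure ℝ := volume.restrict (Ioc 0 1)

/-- The measure `dw` on `(0,1]`. -/
abbrev unitW (w : StieltjesFunction ℝ) : Measure ℝ := w.measure.restrict (Ioc 0 1)

instance (w : StieltjesFunction ℝ) : IsFiniteMeasure (unitW w) :=
  ⟨by rw [Measure.restrict_apply_univ, StieltjesFunction.measure_Ioc]; exact ENNReal.ofReal_lt_top⟩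

/-- The functions `1_{(-∞,x]}` as elements of `L²((0,1])`. -/
def stepL2 (x : ℝ) : Lp ℝ 2 unitVol :=
  indicatorConstLp 2 (measurableSet_Iic (a := x)) (measure_ne_top _ _) (1 : ℝ)

theorem inner_stepL2 (g : Lp ℝ 2 unitVol) (x : ℝ) :
    inner ℝ g (stepL2 x) = primitive unitVol g x := by
  rw [real_inner_comm, stepL2, L2.inner_indicatorConstLp_one, primitive,
    Measure.restrict_restrict measurableSet_Iic, Measure.restrict_restrict measurableSet_Ioc]
  congr 2
  ext y; simp; tauto

/-- This makes `x ↦ 1_{(-∞,x]}` a strongly measurable bounded kernel with values in `L²`, hence a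
legitimate Hilbert–Schmidt kernel against any finite measure. -/
theorem continuous_stepL2 : Continuous stepL2 := by
  refine continuous_indicatorConstLp_set (by norm_num) fun x => ?_
  have h2 : Tendsto (fun y : ℝ => ENNReal.ofReal |y - x|) (𝓝 x) (𝓝 0) := by
    have : Tendsto (fun y : ℝ => ENNReal.ofReal |y - x|) (𝓝 x) (𝓝 (ENNReal.ofReal |x - x|)) :=
      (ENNReal.continuous_ofReal.comp (by fun_prop : Continuous fun y : ℝ => |y - x|)).tendsto x
    simpa using this
  refine tendsto_of_tendsto_of_tendsto_of_le_of_le tendsto_const_nhds h2 (fun _ => zero_le)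
    fun y => ?_
  have h1 : symmDiff (Iic y) (Iic x) ⊆ uIoc x y := by
    intro z hz
    rw [mem_symmDiff] at hz
    simp only [mem_Iic, not_le] at hz
    rw [mem_uIoc]
    tauto
  refine (Measure.restrict_apply_le _ _).trans ((measure_mono h1).trans ?_)
  rw [Real.volume_uIoc]

theorem norm_stepL2_le (x : ℝ) : ‖stepL2 x‖ ≤ 1 := by
  rw [stepL2, norm_indicatorConstLp (by norm_num) (by norm_num)]
  have h : unitVol.real (Iic x) ≤ 1 := by
    refine (measureReal_mono (subset_univ _)).trans ?_
    simp [measureReal_def]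
  simpa using Real.rpow_le_one measureReal_nonneg h (by norm_num)

/-- The Volterra operator `L²(dx) → L²(dw)`, `g ↦ ∫_{(0,x]} g dz`. -/
def volterra (w : StieltjesFunction ℝ) : Lp ℝ 2 unitVol →L[ℝ] Lp ℝ 2 (unitW w) :=
  kernelOp (unitW w) ((MemLp.of_bound continuous_stepL2.aestronglyMeasurable 1
    (Eventually.of_forall norm_stepL2_le)).toLp stepL2)

theorem coeFn_volterra (w : StieltjesFunction ℝ) (g : Lp ℝ 2 unitVol) :
    volterra w g =ᵐ[unitW w] primitive unitVol g := by
  filter_upwards [coeFn_kernelOp (μ := unitW w) ((MemLp.of_bound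
    continuous_stepL2.aestronglyMeasurable 1
    (Eventually.of_forall norm_stepL2_le)).toLp stepL2) g, MemLp.coeFn_toLp (μ := unitW w)
    (MemLp.of_bound (p := 2) continuous_stepL2.aestronglyMeasurable 1
    (Eventually.of_forall norm_stepL2_le))] with x h1 h2
  rw [volterra, h1, h2, inner_stepL2]

/-- The constant function `1` in `L²(μ)`. -/
def oneL2 {α : Type*} [MeasurableSpace α] (μ : Measure α) [IsFiniteMeasure μ] : Lp ℝ 2 μ :=
  indicatorConstLp 2 MeasurableSet.univ (measure_ne_top _ _) (1 : ℝ)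

theorem coeFn_oneL2 {α : Type*} [MeasurableSpace α] (μ : Measure α) [IsFiniteMeasure μ] :
    oneL2 μ =ᵐ[μ] fun _ => 1 := by
  filter_upwards [indicatorConstLp_coeFn (p := 2) (hs := MeasurableSet.univ)
    (hμs := measure_ne_top μ _) (c := (1 : ℝ))] with x hx
  rw [oneL2, hx]; simp

theorem inner_oneL2 {α : Type*} [MeasurableSpace α] (μ : Measure α) [IsFiniteMeasure μ]
    (g : Lp ℝ 2 μ) : inner ℝ (oneL2 μ) g = ∫ x, g x ∂μ := by
  rw [oneL2, L2.inner_indicatorConstLp_one, setIntegral_univ]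

/-- The projection of `L²(μ)` off the constants. -/
def centerL2 {α : Type*} [MeasurableSpace α] (μ : Measure α) [IsFiniteMeasure μ] :
    Lp ℝ 2 μ →L[ℝ] Lp ℝ 2 μ :=
  ContinuousLinearMap.id ℝ _ -
    (ContinuousLinearMap.toSpanSingleton ℝ ((μ.real univ)⁻¹ • oneL2 μ)).comp
      (realInnerL _ (oneL2 μ))

theorem centerL2_apply {α : Type*} [MeasurableSpace α] (μ : Measure α) [IsFiniteMeasure μ]
    (g : Lp ℝ 2 μ) : centerL2 μ g = g - (∫ x, g x ∂μ) • (μ.real univ)⁻¹ • oneL2 μ := by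
  rw [← inner_oneL2]; rfl

theorem coeFn_centerL2 {α : Type*} [MeasurableSpace α] (μ : Measure α) [IsFiniteMeasure μ]
    (g : Lp ℝ 2 μ) : centerL2 μ g =ᵐ[μ] fun x => g x - (μ.real univ)⁻¹ * ∫ x, g x ∂μ := by
  rw [centerL2_apply]
  filter_upwards [Lp.coeFn_sub g ((∫ x, g x ∂μ) • (μ.real univ)⁻¹ • oneL2 μ),
    Lp.coeFn_smul (∫ x, g x ∂μ) ((μ.real univ)⁻¹ • oneL2 μ),
    Lp.coeFn_smul ((μ.real univ)⁻¹) (oneL2 μ), coeFn_oneL2 μ] with x h1 h2 h3 h4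
  rw [h1, Pi.sub_apply, h2, Pi.smul_apply, h3, Pi.smul_apply, h4]
  simp [mul_comm]

theorem integrable_L2 {α : Type*} [MeasurableSpace α] {μ : Measure α} [IsFiniteMeasure μ]
    (g : Lp ℝ 2 μ) : Integrable g μ := (Lp.memLp g).integrable (by norm_num)

theorem integral_centerL2 {α : Type*} [MeasurableSpace α] (μ : Measure α) [IsFiniteMeasure μ]
    (hμ : μ ≠ 0) (g : Lp ℝ 2 μ) : ∫ x, centerL2 μ g x ∂μ = 0 := by
  rw [integral_congr_ae (coeFn_centerL2 μ g), integral_sub (integrable_L2 g) (integrable_const _),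
    integral_const, smul_eq_mul, ← mul_assoc, mul_inv_cancel₀, one_mul, sub_self]
  have := NeZero.mk hμ
  exact measureReal_univ_ne_zero

theorem inner_centerL2_left {α : Type*} [MeasurableSpace α] (μ : Measure α) [IsFiniteMeasure μ]
    (g h : Lp ℝ 2 μ) : inner ℝ (centerL2 μ g) h = inner ℝ g (centerL2 μ h) := by
  simp only [centerL2_apply, inner_sub_left, inner_sub_right, inner_smul_left, inner_smul_right,
    real_inner_comm (oneL2 μ) g, inner_oneL2]
  simp
  ring

end

/-! ### Totality of the eigenfunctions in one variable -/

noncomputable section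

theorem inner_L2_eq {α : Type*} [MeasurableSpace α] {μ : Measure α} (f g : Lp ℝ 2 μ) :
    inner ℝ f g = ∫ x, f x * g x ∂μ := by
  rw [L2.inner_def]
  exact integral_congr_ae (Eventually.of_forall fun x => by simp [mul_comm])

theorem inner_centerL2_right_of_integral_eq_zero {α : Type*} [MeasurableSpace α] (μ : Measure α)
    [IsFiniteMeasure μ] {g : Lp ℝ 2 μ} (hg : ∫ x, g x ∂μ = 0) (h : Lp ℝ 2 μ) :
    inner ℝ g (centerL2 μ h) = inner ℝ g h := by
  rw [← inner_centerL2_left, centerL2_apply, hg, zero_smul, sub_zero]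

theorem unitVol_real_univ : unitVol.real univ = 1 := by
  simp [measureReal_def]

theorem unitVol_ne_zero : unitVol ≠ 0 := by
  intro h
  have := unitVol_real_univ
  simp [h] at this

theorem unitW_ne_zero {w : StieltjesFunction ℝ} (hw : StrictMono w) : unitW w ≠ 0 := by
  intro h
  have h1 : unitW w univ = 0 := by simp [h]
  rw [Measure.restrict_apply_univ, StieltjesFunction.measure_Ioc, ENNReal.ofReal_eq_zero] at h1
  have := hw one_pos
  linarith

/-- A Lebesgue primitive is continuous, and `dw` charges every interval because `w` is strictly
increasing. So constancy almost everywhere for `dw` is constancy everywhere, and the constant is the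
value at `0`. -/
theorem primitive_eq_zero_of_ae_eq_const {w : StieltjesFunction ℝ} (hw : StrictMono w)
    {u : ℝ → ℝ} (hu : Integrable u unitVol) {c : ℝ}
    (h : primitive unitVol u =ᵐ[unitW w] fun _ => c) :
    ∀ x ∈ Icc (0 : ℝ) 1, primitive unitVol u x = 0 := by
  set I : ℝ → ℝ := fun b => ∫ x in (0 : ℝ)..b, u x ∂unitVol with hI
  have hcont : Continuous I :=
    intervalIntegral.continuous_primitive (fun a b => hu.intervalIntegrable) 0
  have hIp : ∀ x, 0 ≤ x → I x = primitive unitVol u x := fun x hx =>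
    intervalIntegral.integral_of_le hx
  have hc : ∀ x ∈ Icc (0 : ℝ) 1, I x = c := by
    intro x hx
    by_contra hne
    have hopen : IsOpen {y | I y ≠ c} := isOpen_ne_fun hcont continuous_const
    rw [← closure_Ioo zero_ne_one, mem_closure_iff] at hx
    obtain ⟨a, b, hab, hsub⟩ := (hopen.inter isOpen_Ioo).exists_Ioo_subset (hx _ hopen hne)
    have hpos : unitW w (Ioc a ((a + b) / 2)) = 0 := by
      refine measure_mono_null ?_ (ae_iff.1 h)
      intro y hy
      have := hsub ⟨hy.1, lt_of_le_of_lt hy.2 (by linarith)⟩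
      simp only [mem_ofPred_eq]
      rw [← hIp y this.2.1.le]
      exact this.1
    have hin : Ioc a ((a + b) / 2) ⊆ Ioc 0 1 := fun y hy => by
      have := hsub ⟨hy.1, lt_of_le_of_lt hy.2 (by linarith)⟩
      exact ⟨this.2.1, this.2.2.le⟩
    rw [Measure.restrict_apply measurableSet_Ioc, inter_eq_left.2 hin,
      StieltjesFunction.measure_Ioc, ENNReal.ofReal_eq_zero] at hpos
    have := hw (show a < (a + b) / 2 by linarith)
    linarith
  have h0 : c = 0 := by
    rw [← hc 0 ⟨le_rfl, zero_le_one⟩]; simp [hI]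
  intro x hx
  rw [← hIp x hx.1, hc x hx, h0]

/-- The constant function `1` as an eigenfunction with eigenvalue `0`. -/
def constEigenfunction (w : StieltjesFunction ℝ) : WEigenfunction w where
  toFun _ := 1
  der _ := 0
  ev := 0
  measurable_toFun := measurable_const
  measurable_der := measurable_const
  bounded_toFun := ⟨1, by simp⟩
  bounded_der := ⟨0, by simp⟩
  eq_toFun := by simp
  eq_der := by simp
  periodic_toFun := rfl
  periodic_der := rfl

/-- The operator `g ↦ h - mean(h)`, `h = ∫_{(0,x]} (g - mean(g)) dz`, which inverts `d/dx`. -/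
def invDerOp (w : StieltjesFunction ℝ) : Lp ℝ 2 unitVol →L[ℝ] Lp ℝ 2 (unitW w) :=
  (centerL2 (unitW w)).comp ((volterra w).comp (centerL2 unitVol))

theorem invDerOp_apply (w : StieltjesFunction ℝ) (g : Lp ℝ 2 unitVol) :
    invDerOp w g = centerL2 (unitW w) (volterra w (centerL2 unitVol g)) := rfl

theorem isCompactOperator_volterra (w : StieltjesFunction ℝ) : IsCompactOperator (volterra w) := by
  rw [volterra]
  exact isCompactOperator_kernelOp _

theorem isCompactOperator_invDerOp (w : StieltjesFunction ℝ) :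
    IsCompactOperator (invDerOp w) := by
  have h1 : IsCompactOperator (volterra w ∘ centerL2 unitVol) :=
    (isCompactOperator_volterra w).comp_clm (centerL2 unitVol)
  have h2 : IsCompactOperator (centerL2 (unitW w) ∘ (volterra w ∘ centerL2 unitVol)) :=
    h1.clm_comp (centerL2 (unitW w))
  exact h2

/-- The hypothesis says `J*J g = m g` weakly. Applying `J` integrates in `dx`, applying `J*`
integrates in `dw` with a sign, so `g` has a bounded representative satisfying both integral
equations with eigenvalue `-1/m`. -/
theorem exists_eigenfunction {w : StieltjesFunction ℝ} (hw : StrictMono w)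
    {g : Lp ℝ 2 unitVol} {m : ℝ} (hm : m ≠ 0)
    (hg : ∀ φ, m * inner ℝ g φ = inner ℝ (invDerOp w g) (invDerOp w φ)) :
    ∃ e : WEigenfunction w, g =ᵐ[unitVol] e.toFun := by
  set h0 := invDerOp w g with hh0
  have hint : ∫ x, h0 x ∂unitW w = 0 := integral_centerL2 _ (unitW_ne_zero hw) _
  set R := primitive (unitW w) h0 with hR
  have hRm : Measurable R := measurable_primitive _ (integrable_L2 h0).aestronglyMeasurable
  have hRb : ∀ x, |R x| ≤ ∫ y, |h0 y| ∂unitW w := abs_primitive_le _ (integrable_L2 h0)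
  have hRL : MemLp R 2 unitVol := MemLp.of_bound hRm.aestronglyMeasurable _
    (Eventually.of_forall hRb)
  -- The right side is `J* h0`. Fubini on the triangle leaves only the primitive of `h0`, because
  -- the total integral of `h0` is zero.
  have hadj : m • g = centerL2 unitVol (-hRL.toLp R) := by
    refine ext_inner_right ℝ fun φ => ?_
    rw [inner_smul_left, inner_centerL2_left]
    simp only [conj_trivial]
    rw [hg φ, invDerOp_apply w φ, inner_centerL2_right_of_integral_eq_zero _ hint, inner_neg_left,
      inner_L2_eq, inner_L2_eq]
    have h1 : ∫ x, h0 x * volterra w (centerL2 unitVol φ) x ∂unitW w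
        = ∫ x, primitive unitVol (centerL2 unitVol φ) x * h0 x ∂unitW w := by
      refine integral_congr_ae ?_
      filter_upwards [coeFn_volterra w (centerL2 unitVol φ)] with x hx
      rw [hx, mul_comm]
    rw [h1, integral_primitive_mul _ (integrable_L2 _) (integrable_L2 _), hint, ← integral_neg]
    refine integral_congr_ae ?_
    filter_upwards [hRL.coeFn_toLp] with x hx
    rw [hx]; ring
  obtain ⟨r, hgr⟩ : ∃ r, g =ᵐ[unitVol] fun x => -(R x - r) / m := by
    refine ⟨-∫ x, (-hRL.toLp R : Lp ℝ 2 unitVol) x ∂unitVol, ?_⟩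
    filter_upwards [Lp.coeFn_smul m g, coeFn_centerL2 unitVol (-hRL.toLp R), hRL.coeFn_toLp,
      Lp.coeFn_neg (hRL.toLp R)] with x h1 h2 h3 h4
    rw [← hadj, h1, Pi.smul_apply, unitVol_real_univ, h4, Pi.neg_apply, h3, smul_eq_mul] at h2
    field_simp
    linarith
  have hgint : ∫ x, g x ∂unitVol = 0 := by
    have h1 : ∫ x, (m • g : Lp ℝ 2 unitVol) x ∂unitVol = 0 := by
      rw [hadj]; exact integral_centerL2 _ unitVol_ne_zero _
    have h2 : ∫ x, (m • g : Lp ℝ 2 unitVol) x ∂unitVol = m * ∫ x, g x ∂unitVol := by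
      rw [← integral_const_mul]
      refine integral_congr_ae ?_
      filter_upwards [Lp.coeFn_smul m g] with x h1
      rw [h1]; rfl
    rw [h2] at h1
    exact (mul_eq_zero.1 h1).resolve_left hm
  -- From here on `g` is replaced by this pointwise representative; the fields of the eigenfunction
  -- are pointwise identities and need it.
  set f : ℝ → ℝ := fun x => -(R x - r) / m with hf
  have hcg : centerL2 unitVol g = g := by
    rw [centerL2_apply, hgint, zero_smul, sub_zero]
  obtain ⟨c, hc⟩ : ∃ c, h0 =ᵐ[unitW w] fun x => c + primitive unitVol f x := by
    refine ⟨-(((unitW w).real univ)⁻¹ * ∫ x, volterra w g x ∂unitW w), ?_⟩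
    rw [hh0, invDerOp_apply, hcg]
    filter_upwards [coeFn_centerL2 (unitW w) (volterra w g), coeFn_volterra w g] with x h1 h2
    rw [h1, h2, primitive_congr_ae hgr]
    ring
  have hfm : Measurable f := (hRm.sub_const r).neg.div_const m
  have hfi : Integrable f unitVol := (integrable_L2 g).congr hgr
  refine ⟨{ toFun := f
            der := fun x => -(c + primitive unitVol f x) / m
            ev := -1 / m
            measurable_toFun := hfm
            measurable_der := ((measurable_primitive _ hfi.aestronglyMeasurable).const_add c).neg.div_const m
            bounded_toFun := ⟨((∫ y, |h0 y| ∂unitW w) + |r|) / |m|, fun x => ?_⟩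
            bounded_der := ⟨(|c| + ∫ y, |f y| ∂unitVol) / |m|, fun x => ?_⟩
            eq_toFun := fun x hx => ?_
            eq_der := fun x hx => ?_
            periodic_toFun := ?_
            periodic_der := ?_ }, hgr⟩
  · rw [hf]
    simp only [abs_div, abs_neg]
    gcongr
    exact (abs_sub _ _).trans (by gcongr; exact hRb x)
  · simp only [abs_div, abs_neg]
    gcongr
    exact (abs_add_le _ _).trans (by gcongr; exact abs_primitive_le _ hfi x)
  · have h1 : ∫ y in Ioc 0 x, -(c + primitive unitVol f y) / m ∂w.measure = -(R x) / m := by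
      rw [← primitive_restrict _ _ hx.2, hR, primitive_congr_ae hc]
      simp only [primitive]
      rw [integral_div, integral_neg]
    rw [h1]
    simp only [hf, hR, primitive_zero]
    ring
  · rw [integral_const_mul, ← primitive_restrict _ _ hx.2, primitive_zero]
    ring
  · simp only [hf, hR, primitive_zero, primitive_restrict_one, hint]
  · simp only [primitive_zero, primitive_restrict_one]
    rw [← integral_congr_ae hgr, hgint]

/-- The eigenfunctions of `(d/dx)(d/dw)` are total in `L²(dx)`. -/
theorem eq_zero_of_forall_eigenfunction {w : StieltjesFunction ℝ} (hw : StrictMono w)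
    {g : Lp ℝ 2 unitVol} (hg : ∀ e : WEigenfunction w, ∫ x, e.toFun x * g x ∂unitVol = 0) :
    g = 0 := by
  set J := invDerOp w
  set T := (ContinuousLinearMap.adjoint J).comp J with hT
  have hTi : ∀ x y, inner ℝ (T x) y = inner ℝ (J x) (J y) := fun x y => by
    rw [hT, ContinuousLinearMap.comp_apply, ContinuousLinearMap.adjoint_inner_left]
  have hcomp : IsCompactOperator T := by
    have h := (isCompactOperator_invDerOp w).clm_comp (ContinuousLinearMap.adjoint J)
    exact h
  have hsymm : T.IsSymmetric := fun x y => by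
    change inner ℝ (T x) y = inner ℝ x (T y)
    rw [hTi, real_inner_comm _ x, hTi, real_inner_comm]
  have key := T.orthogonalComplement_iSup_eigenspaces_eq_bot hcomp hsymm
  have hmem : g ∈ (⨆ μ, Module.End.eigenspace (T : Module.End ℝ (Lp ℝ 2 unitVol)) μ)ᗮ := by
    rw [← Submodule.iInf_orthogonal, Submodule.mem_iInf]
    intro m
    rw [Submodule.mem_orthogonal]
    intro v hv
    rw [Module.End.mem_eigenspace_iff] at hv
    have hv' : T v = m • v := hv
    have hvi : ∀ φ, m * inner ℝ v φ = inner ℝ (J v) (J φ) := fun φ => by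
      rw [← hTi, hv', inner_smul_left]; simp
    suffices ∃ (e : WEigenfunction w) (c : ℝ), v =ᵐ[unitVol] fun x => c * e.toFun x by
      obtain ⟨e, c, he⟩ := this
      rw [inner_L2_eq]
      have : ∫ x, v x * g x ∂unitVol = c * ∫ x, e.toFun x * g x ∂unitVol := by
        rw [← integral_const_mul]
        refine integral_congr_ae ?_
        filter_upwards [he] with x hx
        rw [hx, mul_assoc]
      rw [this, hg e, mul_zero]
    -- For `m = 0` the identity gives `J v = 0`, so the primitive of the centred `v` is constant and
    -- `v` itself is constant almost everywhere.
    rcases eq_or_ne m 0 with rfl | hm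
    · refine ⟨constEigenfunction w, ∫ x, v x ∂unitVol, ?_⟩
      have hJ : J v = 0 := by
        have := hvi v
        rw [zero_mul] at this
        exact inner_self_eq_zero.1 this.symm
      have hconst : ∃ c : ℝ, primitive unitVol (centerL2 unitVol v) =ᵐ[unitW w] fun _ => c := by
        refine ⟨((unitW w).real univ)⁻¹ * ∫ x, volterra w (centerL2 unitVol v) x ∂unitW w, ?_⟩
        have h1 := coeFn_centerL2 (unitW w) (volterra w (centerL2 unitVol v))
        rw [← invDerOp_apply] at h1
        change (J v : ℝ → ℝ) =ᵐ[_] _ at h1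
        rw [hJ] at h1
        filter_upwards [h1, coeFn_volterra w (centerL2 unitVol v),
          Lp.coeFn_zero ℝ 2 (unitW w)] with x h1 h2 h3
        rw [h3, h2, Pi.zero_apply] at h1
        linarith
      obtain ⟨c, hc⟩ := hconst
      have h2 := primitive_eq_zero_of_ae_eq_const hw (integrable_L2 _) hc
      have h3 := ae_eq_zero_of_setIntegral_Ioc (ae_restrict_mem measurableSet_Ioc)
        (integrable_L2 (centerL2 unitVol v)) fun x hx => h2 x ⟨hx.1.le, hx.2⟩
      filter_upwards [h3, coeFn_centerL2 unitVol v] with x h3 h4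
      rw [h3, Pi.zero_apply, unitVol_real_univ] at h4
      simp only [constEigenfunction]
      linarith
    · obtain ⟨e, he⟩ := exists_eigenfunction hw hm hvi
      exact ⟨e, 1, by simpa using he⟩
  rw [key] at hmem
  exact (Submodule.mem_bot ℝ).1 hmem

end

/-! ### Properties of eigenfunctions and totality of their derivatives -/

noncomputable section

namespace WEigenfunction

variable {w : StieltjesFunction ℝ} (e : WEigenfunction w)

theorem integrable_toFun (μ : Measure ℝ) [IsFiniteMeasure μ] : Integrable e.toFun μ := by
  obtain ⟨C, hC⟩ := e.bounded_toFun
  exact Integrable.of_bound e.measurable_toFun.aestronglyMeasurable C (Eventually.of_forall hC)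

theorem integrable_der (μ : Measure ℝ) [IsFiniteMeasure μ] : Integrable e.der μ := by
  obtain ⟨C, hC⟩ := e.bounded_der
  exact Integrable.of_bound e.measurable_der.aestronglyMeasurable C (Eventually.of_forall hC)

theorem toFun_eq_primitive {x : ℝ} (hx : x ∈ Icc (0 : ℝ) 1) :
    e.toFun x = e.toFun 0 + primitive (unitW w) e.der x := by
  rw [e.eq_toFun x hx, primitive_restrict _ _ hx.2]

theorem der_eq_primitive {x : ℝ} (hx : x ∈ Icc (0 : ℝ) 1) :
    e.der x = e.der 0 + primitive unitVol (fun z => e.ev * e.toFun z) x := by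
  rw [e.eq_der x hx, primitive_restrict _ _ hx.2]

theorem integral_der : ∫ x, e.der x ∂unitW w = 0 := by
  have := e.toFun_eq_primitive (x := 1) ⟨zero_le_one, le_rfl⟩
  rw [primitive_restrict_one, e.periodic_toFun] at this
  linarith

theorem integral_ev_mul_toFun : ∫ x, e.ev * e.toFun x ∂unitVol = 0 := by
  have := e.der_eq_primitive (x := 1) ⟨zero_le_one, le_rfl⟩
  rw [primitive_restrict_one, e.periodic_der] at this
  linarith

/-- Integration by parts against an eigenfunction. -/
theorem integral_by_parts {F D : ℝ → ℝ} {c : ℝ} (hD : Integrable D (unitW w))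
    (hD0 : ∫ x, D x ∂unitW w = 0)
    (hF : ∀ x ∈ Ioc (0 : ℝ) 1, F x = c + primitive (unitW w) D x) :
    ∫ x, e.ev * e.toFun x * F x ∂unitVol = -∫ x, e.der x * D x ∂unitW w := by
  have hfi : Integrable (fun x => e.ev * e.toFun x) unitVol := (e.integrable_toFun _).const_mul _
  obtain ⟨C, hC⟩ := e.bounded_der
  have hpD : Integrable (fun x => primitive unitVol (fun z => e.ev * e.toFun z) x * D x)
      (unitW w) :=
    hD.bdd_mul (measurable_primitive _ hfi.aestronglyMeasurable).aestronglyMeasurable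
      (Eventually.of_forall fun x => abs_primitive_le _ hfi x)
  have h1 : ∫ x, e.der x * D x ∂unitW w
      = ∫ x, primitive unitVol (fun z => e.ev * e.toFun z) x * D x ∂unitW w := by
    have : ∫ x, e.der x * D x ∂unitW w = ∫ x, (e.der 0 * D x
        + primitive unitVol (fun z => e.ev * e.toFun z) x * D x) ∂unitW w := by
      refine integral_congr_ae ?_
      filter_upwards [ae_restrict_mem measurableSet_Ioc] with x hx
      rw [e.der_eq_primitive ⟨hx.1.le, hx.2⟩]; ring
    rw [this, integral_add (hD.const_mul _) hpD, integral_const_mul, hD0, mul_zero, zero_add]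
  rw [h1, integral_primitive_mul _ hfi hD, hD0]
  have hpi : Integrable (fun x => e.ev * e.toFun x * primitive (unitW w) D x) unitVol :=
    hfi.mul_bdd (measurable_primitive _ hD.aestronglyMeasurable).aestronglyMeasurable
      (Eventually.of_forall fun x => abs_primitive_le _ hD x)
  have h2 : ∫ x, e.ev * e.toFun x * F x ∂unitVol = ∫ x, (c * (e.ev * e.toFun x)
      + e.ev * e.toFun x * primitive (unitW w) D x) ∂unitVol := by
    refine integral_congr_ae ?_
    filter_upwards [ae_restrict_mem measurableSet_Ioc] with x hx
    rw [hF x hx]; ring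
  rw [h2, integral_add (hfi.const_mul _) hpi, integral_const_mul, e.integral_ev_mul_toFun,
    mul_zero, zero_add, ← integral_neg]
  congr 1; funext x; ring

/-- The energy identity: integrate by parts with the eigenfunction against itself. -/
theorem ev_mul_integral_sq :
    e.ev * ∫ x, e.toFun x ^ 2 ∂unitVol = -∫ x, e.der x ^ 2 ∂unitW w := by
  have := e.integral_by_parts (e.integrable_der _) e.integral_der
    fun x hx => e.toFun_eq_primitive ⟨hx.1.le, hx.2⟩
  rw [← integral_const_mul]
  simpa only [pow_two, mul_assoc] using this

/-- The sign comes from the energy identity. The second alternative is unavoidable, since the zero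
function is admitted with any value of `ev`. -/
theorem ev_nonpos_or : e.ev ≤ 0 ∨ e.toFun =ᵐ[unitVol] 0 := by
  by_contra! h
  have h1 := e.ev_mul_integral_sq
  have h2 : 0 ≤ ∫ x, e.der x ^ 2 ∂unitW w := integral_nonneg fun x => sq_nonneg _
  have h3 : ∫ x, e.toFun x ^ 2 ∂unitVol ≤ 0 := by
    by_contra! h4
    have := mul_pos h.1 h4
    linarith
  obtain ⟨C, hC⟩ := e.bounded_toFun
  have h4 : ∫ x, e.toFun x ^ 2 ∂unitVol = 0 := le_antisymm h3 (integral_nonneg fun x => sq_nonneg _)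
  rw [integral_eq_zero_iff_of_nonneg (fun x => sq_nonneg _)] at h4
  · refine h.2 ?_
    filter_upwards [h4] with x hx
    exact pow_eq_zero_iff two_ne_zero |>.1 hx
  · simp only [pow_two]
    exact (e.integrable_toFun _).bdd_mul e.measurable_toFun.aestronglyMeasurable
      (Eventually.of_forall hC)

/-- With eigenvalue zero the energy identity kills the derivative, so only constants remain. -/
theorem toFun_eq_of_ev_eq_zero (he : e.ev = 0) {x : ℝ} (hx : x ∈ Icc (0 : ℝ) 1) :
    e.toFun x = e.toFun 0 := by
  have h1 := e.ev_mul_integral_sq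
  rw [he, zero_mul] at h1
  obtain ⟨C, hC⟩ := e.bounded_der
  have h2 : ∫ x, e.der x ^ 2 ∂unitW w = 0 := by linarith
  rw [integral_eq_zero_iff_of_nonneg (fun x => sq_nonneg _)] at h2
  · have h3 : e.der =ᵐ[unitW w] 0 := by
      filter_upwards [h2] with x hx
      exact pow_eq_zero_iff two_ne_zero |>.1 hx
    rw [e.toFun_eq_primitive hx, primitive_congr_ae h3]
    simp [primitive]
  · simp only [pow_two]
    exact (e.integrable_der _).bdd_mul e.measurable_der.aestronglyMeasurable
      (Eventually.of_forall hC)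

end WEigenfunction

theorem tendsto_primitive_nhdsGT {μ : Measure ℝ} {u : ℝ → ℝ} (hu : Integrable u μ) (x : ℝ) :
    Tendsto (primitive μ u) (𝓝[>] x) (𝓝 (primitive μ u x)) := by
  have : primitive μ u = fun x => ∫ y, (Ioc 0 x).indicator u y ∂μ := by
    funext x; rw [integral_indicator measurableSet_Ioc]; rfl
  rw [this]
  refine tendsto_integral_filter_of_dominated_convergence (fun y => |u y|)
    (Eventually.of_forall fun y => hu.aestronglyMeasurable.indicator measurableSet_Ioc)
    (Eventually.of_forall fun y => Eventually.of_forall fun z => norm_indicator_le_norm_self _ _)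
    hu.abs (Eventually.of_forall fun z => ?_)
  refine tendsto_const_nhds.congr' ?_
  rcases le_or_gt z x with hz | hz
  · filter_upwards [self_mem_nhdsWithin] with y hy
    have hy' : z ≤ y := hz.trans (le_of_lt hy)
    simp [indicator, hz, hy']
  · filter_upwards [Ioo_mem_nhdsGT hz] with y hy
    simp [indicator, not_le.2 hz, not_le.2 hy.2]

/-- Let `F` be the `dw`-primitive of `H`. Integration by parts makes `F` orthogonal to every
eigenfunction with nonzero eigenvalue, and the others are constant; so `F` minus its mean is
orthogonal to all of them and vanishes. Thus `F` is constant, the constant is `F 0 = 0`, and all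
integrals of `H` over `(0, x]` are zero. -/
theorem eq_zero_of_forall_eigenfunction_der {w : StieltjesFunction ℝ} (hw : StrictMono w)
    {H : Lp ℝ 2 (unitW w)} (hH : ∀ e : WEigenfunction w, ∫ x, e.der x * H x ∂unitW w = 0)
    (hH0 : ∫ x, H x ∂unitW w = 0) : H = 0 := by
  set F := primitive (unitW w) H with hF
  have hFm : Measurable F := measurable_primitive _ (integrable_L2 H).aestronglyMeasurable
  have hFb : ∀ x, |F x| ≤ ∫ y, |H y| ∂unitW w := abs_primitive_le _ (integrable_L2 H)
  have hFL : MemLp F 2 unitVol := MemLp.of_bound hFm.aestronglyMeasurable _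
    (Eventually.of_forall hFb)
  have hbp : ∀ e : WEigenfunction w, e.ev * ∫ x, e.toFun x * F x ∂unitVol = 0 := fun e => by
    have := e.integral_by_parts (c := 0) (integrable_L2 H) hH0 (F := F) fun x _ => by simp [hF]
    rw [hH e, neg_zero] at this
    rw [← integral_const_mul, ← this]
    simp only [mul_assoc]
  have hcenter : centerL2 unitVol (hFL.toLp F) = 0 := by
    refine eq_zero_of_forall_eigenfunction hw fun e => ?_
    have h1 : ∫ x, e.toFun x * centerL2 unitVol (hFL.toLp F) x ∂unitVol =
        ∫ x, e.toFun x * F x ∂unitVol - (∫ x, F x ∂unitVol) * ∫ x, e.toFun x ∂unitVol := by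
      rw [← integral_const_mul, ← integral_sub]
      · refine integral_congr_ae ?_
        filter_upwards [coeFn_centerL2 unitVol (hFL.toLp F), hFL.coeFn_toLp] with x h1 h2
        rw [h1, h2, integral_congr_ae hFL.coeFn_toLp, unitVol_real_univ]; ring
      · exact (e.integrable_toFun _).mul_bdd hFm.aestronglyMeasurable (Eventually.of_forall hFb)
      · exact (e.integrable_toFun _).const_mul _
    rw [h1]
    -- For eigenvalue zero the eigenfunction is constant and the two terms cancel. Otherwise both
    -- vanish, the second because `ev * e` has zero mean.
    rcases eq_or_ne e.ev 0 with h0 | h0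
    · have h2 : e.toFun =ᵐ[unitVol] fun _ => e.toFun 0 := by
        filter_upwards [ae_restrict_mem measurableSet_Ioc] with x hx
        exact e.toFun_eq_of_ev_eq_zero h0 ⟨hx.1.le, hx.2⟩
      have h3 : ∫ x, e.toFun x * F x ∂unitVol = e.toFun 0 * ∫ x, F x ∂unitVol := by
        rw [← integral_const_mul]
        exact integral_congr_ae (h2.mul (ae_eq_refl _))
      rw [h3, integral_congr_ae h2, integral_const, unitVol_real_univ, one_smul]
      ring
    · have h2 := (mul_eq_zero.1 (hbp e)).resolve_left h0
      have h3 := e.integral_ev_mul_toFun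
      rw [integral_const_mul] at h3
      rw [h2, (mul_eq_zero.1 h3).resolve_left h0]
      ring
  obtain ⟨r, hr⟩ : ∃ r, F =ᵐ[unitVol] fun _ => r := by
    refine ⟨∫ x, hFL.toLp F x ∂unitVol, ?_⟩
    have h1 := coeFn_centerL2 unitVol (hFL.toLp F)
    rw [hcenter] at h1
    filter_upwards [h1, hFL.coeFn_toLp, Lp.coeFn_zero ℝ 2 unitVol] with x h1 h2 h3
    rw [h3, h2, Pi.zero_apply, unitVol_real_univ] at h1
    linarith
  -- Almost everywhere is for Lebesgue measure, whereas `H` may live on atoms of `dw`.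
  -- Right-continuity of `F` upgrades the identity to every point of `[0, 1)`; the point `1` is
  -- covered by the zero mean of `H`.
  have hFr : ∀ x ∈ Ico (0 : ℝ) 1, F x = r := by
    intro x hx
    by_contra hne
    have h1 : ∀ᶠ y in 𝓝[>] x, F y ≠ r :=
      (tendsto_primitive_nhdsGT (integrable_L2 H) x).eventually_ne hne
    obtain ⟨b, hb, hsub⟩ := (mem_nhdsGT_iff_exists_Ioo_subset).1
      (inter_mem h1 (Ioo_mem_nhdsGT hx.2))
    have h2 : unitVol (Ioo x b) = 0 := measure_mono_null (fun y hy => (hsub hy).1) (ae_iff.1 hr)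
    rw [Measure.restrict_apply measurableSet_Ioo, inter_eq_left.2, Real.volume_Ioo,
      ENNReal.ofReal_eq_zero] at h2
    · have : x < b := hb
      linarith
    · intro y hy
      have := hsub hy
      exact ⟨hx.1.trans_lt hy.1, this.2.2.le⟩
  have hr0 : r = 0 := by
    rw [← hFr 0 ⟨le_rfl, one_pos⟩, hF, primitive_zero]
  have h := ae_eq_zero_of_setIntegral_Ioc (ae_restrict_mem measurableSet_Ioc)
    (integrable_L2 H) fun x hx => by
      rcases eq_or_lt_of_le hx.2 with rfl | h
      · exact (primitive_restrict_one _ _).trans hH0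
      · exact (hFr x ⟨hx.1.le, h⟩).trans hr0
  exact Lp.ext (h.trans (Lp.coeFn_zero ℝ 2 _).symm)

end

/-! ### Bounded Borel functions and totality of products -/

noncomputable section

/-- Bounded Borel functions. -/
def IsBddMeas {α : Type*} [MeasurableSpace α] (f : α → ℝ) : Prop :=
  Measurable f ∧ ∃ C, ∀ x, |f x| ≤ C

namespace IsBddMeas

variable {α : Type*} [MeasurableSpace α] {f g : α → ℝ}

theorem memLp (hf : IsBddMeas f) (μ : Measure α) [IsFiniteMeasure μ] (p : ENNReal) :
    MemLp f p μ := by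
  obtain ⟨C, hC⟩ := hf.2
  exact MemLp.of_bound hf.1.aestronglyMeasurable C (Eventually.of_forall hC)

theorem integrable (hf : IsBddMeas f) (μ : Measure α) [IsFiniteMeasure μ] : Integrable f μ :=
  (hf.memLp μ 1).integrable le_rfl

theorem mul_integrable (hf : IsBddMeas f) {μ : Measure α} (hg : Integrable g μ) :
    Integrable (fun x => f x * g x) μ := by
  obtain ⟨C, hC⟩ := hf.2
  exact hg.bdd_mul hf.1.aestronglyMeasurable (Eventually.of_forall hC)

theorem mul_memLp (hf : IsBddMeas f) {μ : Measure α} {p : ENNReal} (hg : MemLp g p μ) :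
    MemLp (fun x => f x * g x) p μ := by
  obtain ⟨C, hC⟩ := hf.2
  exact MemLp.of_le_mul (c := C) hg (hf.1.aestronglyMeasurable.mul hg.1) (Eventually.of_forall fun x => by
    rw [norm_mul]; gcongr; exact hC x)

theorem const (c : ℝ) : IsBddMeas fun _ : α => c := ⟨measurable_const, |c|, fun _ => le_rfl⟩

theorem mul (hf : IsBddMeas f) (hg : IsBddMeas g) : IsBddMeas fun x => f x * g x := by
  obtain ⟨C, hC⟩ := hf.2
  obtain ⟨D, hD⟩ := hg.2
  refine ⟨hf.1.mul hg.1, C * D, fun x => ?_⟩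
  rw [abs_mul]
  exact mul_le_mul (hC x) (hD x) (abs_nonneg _) ((abs_nonneg _).trans (hC x))

theorem add (hf : IsBddMeas f) (hg : IsBddMeas g) : IsBddMeas fun x => f x + g x := by
  obtain ⟨C, hC⟩ := hf.2
  obtain ⟨D, hD⟩ := hg.2
  exact ⟨hf.1.add hg.1, C + D, fun x => (abs_add_le _ _).trans (add_le_add (hC x) (hD x))⟩

theorem sum {ι : Type*} {s : Finset ι} {F : ι → α → ℝ} (h : ∀ i ∈ s, IsBddMeas (F i)) :
    IsBddMeas fun x => ∑ i ∈ s, F i x := by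
  classical
  induction s using Finset.induction_on with
  | empty => simpa using IsBddMeas.const 0
  | insert a s ha ih =>
    simp only [Finset.sum_insert ha]
    exact (h a (Finset.mem_insert_self _ _)).add
      (ih fun i hi => h i (Finset.mem_insert_of_mem hi))

theorem prod {ι : Type*} {s : Finset ι} {F : ι → α → ℝ} (h : ∀ i ∈ s, IsBddMeas (F i)) :
    IsBddMeas fun x => ∏ i ∈ s, F i x := by
  classical
  induction s using Finset.induction_on with
  | empty => simpa using IsBddMeas.const 1
  | insert a s ha ih =>
    simp only [Finset.prod_insert ha]
    exact (h a (Finset.mem_insert_self _ _)).mul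
      (ih fun i hi => h i (Finset.mem_insert_of_mem hi))

theorem comp (hf : IsBddMeas f) {β : Type*} [MeasurableSpace β] {φ : β → α} (hφ : Measurable φ) :
    IsBddMeas fun x => f (φ x) :=
  ⟨hf.1.comp hφ, hf.2.imp fun _ h _ => h _⟩

theorem indicator_const {s : Set α} (hs : MeasurableSet s) (c : ℝ) :
    IsBddMeas (s.indicator fun _ => c) :=
  ⟨measurable_const.indicator hs, |c|, fun x => norm_indicator_le_norm_self (fun _ => c) x⟩

end IsBddMeas

theorem IsBddMeas.coord {ι : Type*} {f : ℝ → ℝ} (hf : IsBddMeas f) (i : ι) :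
    IsBddMeas fun x : ι → ℝ => f (x i) :=
  hf.comp (measurable_pi_apply i)

theorem WEigenfunction.isBddMeas_toFun {w : StieltjesFunction ℝ} (e : WEigenfunction w) :
    IsBddMeas e.toFun := ⟨e.measurable_toFun, e.bounded_toFun⟩

theorem WEigenfunction.isBddMeas_der {w : StieltjesFunction ℝ} (e : WEigenfunction w) :
    IsBddMeas e.der := ⟨e.measurable_der, e.bounded_der⟩

/-- The marginal density in direction `i` of a square integrable function. -/
theorem exists_marginal {ι : Type*} [Fintype ι] [DecidableEq ι] (μ : ι → Measure ℝ)
    [∀ i, IsFiniteMeasure (μ i)] (i : ι) {Q : (ι → ℝ) → ℝ} (hQ : MemLp Q 2 (Measure.pi μ)) :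
    ∃ g : ℝ → ℝ, MemLp g 2 (μ i) ∧ ∀ φ, IsBddMeas φ →
      ∫ t, φ t * g t ∂μ i = ∫ x, φ (x i) * Q x ∂Measure.pi μ := by
  -- The mass of the remaining factors: the `i`-th marginal of the product measure is `K • μ i`,
  -- which yields the bound needed for the Riesz representation.
  set K : ENNReal := ∏ j ∈ Finset.univ.erase i, μ j univ with hK
  have hKtop : K ≠ ⊤ := ENNReal.prod_ne_top fun j _ => measure_ne_top _ _
  have hmap : (Measure.pi μ).map (Function.eval i) = K • μ i := Measure.pi_map_eval μ i
  have hmem : ∀ φ : Lp ℝ 2 (μ i), MemLp (fun x : ι → ℝ => φ (x i)) 2 (Measure.pi μ) := fun φ => by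
    have : MemLp φ 2 ((Measure.pi μ).map (Function.eval i)) := by
      rw [hmap]; exact (Lp.memLp φ).smul_measure hKtop
    exact this.comp_of_map (measurable_pi_apply i).aemeasurable
  have hint : ∀ φ : Lp ℝ 2 (μ i), Integrable (fun x => φ (x i) * Q x) (Measure.pi μ) := fun φ =>
    (hmem φ).integrable_mul hQ
  have hae : ∀ {f g : ℝ → ℝ}, f =ᵐ[μ i] g → ∀ᵐ x ∂Measure.pi μ, f (x i) = g (x i) := fun h =>
    (Measure.quasiMeasurePreserving_eval (μ := μ) i).ae h
  let ℓ₀ : Lp ℝ 2 (μ i) →ₗ[ℝ] ℝ :=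
    { toFun := fun φ => ∫ x, φ (x i) * Q x ∂Measure.pi μ
      map_add' := fun φ ψ => by
        rw [← integral_add (hint φ) (hint ψ)]
        refine integral_congr_ae ?_
        filter_upwards [hae (Lp.coeFn_add φ ψ)] with x hx
        rw [hx, Pi.add_apply, add_mul]
      map_smul' := fun r φ => by
        rw [RingHom.id_apply, smul_eq_mul, ← integral_const_mul]
        refine integral_congr_ae ?_
        filter_upwards [hae (Lp.coeFn_smul r φ)] with x hx
        rw [hx, Pi.smul_apply, smul_eq_mul, mul_assoc] }
  let ℓ : Lp ℝ 2 (μ i) →L[ℝ] ℝ := ℓ₀.mkContinuous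
    ((K ^ (1 / (2 : ENNReal).toReal)).toReal * ‖hQ.toLp Q‖) fun φ => by
      have h1 : ℓ₀ φ = inner ℝ ((hmem φ).toLp _) (hQ.toLp Q) := by
        rw [inner_L2_eq]
        refine integral_congr_ae ?_
        filter_upwards [(hmem φ).coeFn_toLp, hQ.coeFn_toLp] with x h1 h2
        rw [h1, h2]
      rw [h1]
      refine (norm_inner_le_norm _ _).trans ?_
      have h2 : ‖(hmem φ).toLp _‖ ≤ (K ^ (1 / (2 : ENNReal).toReal)).toReal * ‖φ‖ := by
        have h3 : eLpNorm (fun x : ι → ℝ => φ (x i)) 2 (Measure.pi μ)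
            = K ^ (1 / (2 : ENNReal).toReal) * eLpNorm φ 2 (μ i) := by
          have h4 : eLpNorm φ 2 ((Measure.pi μ).map (Function.eval i))
              = eLpNorm (φ ∘ Function.eval i) 2 (Measure.pi μ) := by
            refine eLpNorm_map_measure ?_ (measurable_pi_apply i).aemeasurable
            rw [hmap]
            exact (Lp.aestronglyMeasurable φ).smul_measure K
          rw [hmap, eLpNorm_smul_measure_of_ne_top (by norm_num)] at h4
          rw [← smul_eq_mul, ENNReal.toReal_div, ENNReal.toReal_one] at *
          exact h4.symm
        rw [Lp.norm_toLp, h3, ENNReal.toReal_mul, ← Lp.norm_def]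
      calc _ ≤ ((K ^ (1 / (2 : ENNReal).toReal)).toReal * ‖φ‖) * ‖hQ.toLp Q‖ := by gcongr
        _ = _ := by ring
  let g : Lp ℝ 2 (μ i) := (InnerProductSpace.toDual ℝ (Lp ℝ 2 (μ i))).symm ℓ
  refine ⟨g, Lp.memLp g, fun φ hφ => ?_⟩
  have h1 : inner ℝ g ((hφ.memLp (μ i) 2).toLp φ)
      = ℓ ((hφ.memLp (μ i) 2).toLp φ) := InnerProductSpace.toDual_symm_apply
  have h2 : ℓ ((hφ.memLp (μ i) 2).toLp φ) = ∫ x, φ (x i) * Q x ∂Measure.pi μ := by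
    refine integral_congr_ae ?_
    filter_upwards [hae (hφ.memLp (μ i) 2).coeFn_toLp] with x hx
    rw [hx]
  rw [← h2, ← h1, inner_L2_eq]
  refine integral_congr_ae ?_
  filter_upwards [(hφ.memLp (μ i) 2).coeFn_toLp] with x hx
  rw [hx, mul_comm]

/-- Products of functions from total sets are total in `L²` of the product measure. -/
theorem ae_eq_zero_of_forall_prod {ι : Type*} [Fintype ι] [DecidableEq ι] (μ : ι → Measure ℝ)
    [∀ i, IsFiniteMeasure (μ i)] (S : ι → Set (ℝ → ℝ)) (hS : ∀ i, ∀ s ∈ S i, IsBddMeas s)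
    (htot : ∀ i, ∀ g : ℝ → ℝ, MemLp g 2 (μ i) → (∀ s ∈ S i, ∫ t, s t * g t ∂μ i = 0) →
      g =ᵐ[μ i] 0)
    {G : (ι → ℝ) → ℝ} (hG : MemLp G 2 (Measure.pi μ))
    (h : ∀ s : ι → ℝ → ℝ, (∀ i, s i ∈ S i) → ∫ x, (∏ i, s i (x i)) * G x ∂Measure.pi μ = 0) :
    G =ᵐ[Measure.pi μ] 0 := by
  -- The set `T` collects the coordinates in which the factor is already an arbitrary bounded Borel
  -- function. One coordinate is released at a time: the marginal density in that coordinate is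
  -- orthogonal to `S i`, hence zero. For `T` everything, the factors may be indicators, which gives
  -- all boxes.
  have key : ∀ T : Finset ι, ∀ s : ι → ℝ → ℝ, (∀ i ∈ T, IsBddMeas (s i)) →
      (∀ i ∉ T, s i ∈ S i) → ∫ x, (∏ i, s i (x i)) * G x ∂Measure.pi μ = 0 := by
    intro T
    induction T using Finset.induction_on with
    | empty => exact fun s _ hs => h s fun i => hs i (Finset.notMem_empty i)
    | insert i T hi ih =>
      intro s hs1 hs2
      have hbm : ∀ j, IsBddMeas (s j) := fun j => by
        by_cases hj : j ∈ insert i T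
        · exact hs1 j hj
        · exact hS j _ (hs2 j hj)
      have hQ : MemLp (fun x : ι → ℝ => (∏ j ∈ Finset.univ.erase i, s j (x j)) * G x) 2
          (Measure.pi μ) :=
        (IsBddMeas.prod fun j _ => (hbm j).coord j).mul_memLp hG
      obtain ⟨g, hg, hgi⟩ := exists_marginal μ i hQ
      have hsplit : ∀ (φ : ℝ → ℝ) (x : ι → ℝ),
          φ (x i) * ((∏ j ∈ Finset.univ.erase i, s j (x j)) * G x)
            = (∏ j, (Function.update s i φ) j (x j)) * G x := fun φ x => by
        rw [← Finset.mul_prod_erase _ _ (Finset.mem_univ i), Function.update_self, mul_assoc]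
        congr 2
        refine Finset.prod_congr rfl fun j hj => ?_
        rw [Function.update_of_ne (Finset.ne_of_mem_erase hj)]
      have hg0 : g =ᵐ[μ i] 0 := by
        refine htot i g hg fun φ hφ => ?_
        rw [hgi φ (hS i φ hφ)]
        simp only [hsplit]
        refine ih _ (fun j hj => ?_) fun j hj => ?_
        · rw [Function.update_of_ne (show j ≠ i from fun hji => hi (hji ▸ hj))]; exact hbm j
        · by_cases hji : j = i
          · subst hji; rwa [Function.update_self]
          · rw [Function.update_of_ne hji]
            exact hs2 j (by simp [hji, hj])
      have h1 := hgi (s i) (hbm i)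
      simp only [hsplit, Function.update_eq_self] at h1
      rw [← h1]
      have : ∫ t, s i t * g t ∂μ i = ∫ _, (0 : ℝ) ∂μ i := by
        refine integral_congr_ae ?_
        filter_upwards [hg0] with t ht
        rw [ht, Pi.zero_apply, mul_zero]
      rw [this, integral_zero]
  have hGi : Integrable G (Measure.pi μ) := hG.integrable (by norm_num)
  have hrect : ∀ A : ι → Set ℝ, (∀ i, MeasurableSet (A i)) →
      ∫ x in univ.pi A, G x ∂Measure.pi μ = 0 := fun A hA => by
    rw [← key Finset.univ (fun i => (A i).indicator fun _ => 1)
      (fun i _ => IsBddMeas.indicator_const (hA i) 1) (by simp),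
      ← integral_indicator (MeasurableSet.univ_pi hA)]
    congr 1
    funext x
    by_cases hx : x ∈ univ.pi A
    · rw [indicator_of_mem hx, Finset.prod_eq_one, one_mul]
      intro i _
      rw [indicator_of_mem (hx i trivial)]
    · rw [indicator_of_notMem hx]
      simp only [Set.mem_pi, mem_univ, true_imp_iff, not_forall] at hx
      obtain ⟨i, hi⟩ := hx
      rw [Finset.prod_eq_zero (Finset.mem_univ i), zero_mul]
      rw [indicator_of_notMem hi]
  refine ae_eq_zero_of_isPiSystem (C := Set.pi univ '' Set.pi univ fun _ => {s : Set ℝ | MeasurableSet s})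
    generateFrom_pi.symm isPiSystem_pi hGi ?_ ?_
  · rintro _ ⟨A, hA, rfl⟩
    exact hrect A fun i => hA i trivial
  · have := hrect (fun _ => univ) fun _ => MeasurableSet.univ
    simpa using this

end

/-! ### Product test functions and weak derivatives on the torus -/

noncomputable section

variable {d : ℕ} {W : Fin d → StieltjesFunction ℝ}

theorem ae_eq_zero_of_toLp_eq_zero {α : Type*} [MeasurableSpace α] {μ : Measure α} {g : α → ℝ}
    (hg : MemLp g 2 μ) (h : hg.toLp g = 0) : g =ᵐ[μ] 0 := by
  have h1 := hg.coeFn_toLp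
  rw [h] at h1
  exact h1.symm.trans (Lp.coeFn_zero ℝ 2 μ)

theorem integral_mul_congr_ae {α : Type*} [MeasurableSpace α] {μ : Measure α} (b : α → ℝ)
    {g g' : α → ℝ} (h : g =ᵐ[μ] g') : ∫ x, b x * g x ∂μ = ∫ x, b x * g' x ∂μ :=
  integral_congr_ae ((ae_eq_refl b).mul h)

theorem mixedFactor_self (W : Fin d → StieltjesFunction ℝ) (k : Fin d) :
    mixedFactor W k k = unitW (W k) := if_pos rfl

theorem mixedFactor_of_ne (W : Fin d → StieltjesFunction ℝ) {k j : Fin d} (h : j ≠ k) :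
    mixedFactor W k j = unitVol := if_neg h

theorem torusVol_eq (d : ℕ) : torusVol d = Measure.pi fun _ => unitVol := rfl

theorem integral_prod_torusVol (f : Fin d → ℝ → ℝ) :
    ∫ x, ∏ j, f j (x j) ∂torusVol d = ∏ j, ∫ t, f j t ∂unitVol :=
  integral_fintype_prod_eq_prod f

theorem integral_prod_mixedVol (k : Fin d) (f : Fin d → ℝ → ℝ) :
    ∫ x, ∏ j, f j (x j) ∂mixedVol W k
      = (∫ t, f k t ∂unitW (W k)) * ∏ j ∈ Finset.univ.erase k, ∫ t, f j t ∂unitVol := by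
  rw [mixedVol, integral_fintype_prod_eq_prod, ← Finset.mul_prod_erase _ _ (Finset.mem_univ k),
    mixedFactor_self]
  congr 1
  refine Finset.prod_congr rfl fun j hj => ?_
  rw [mixedFactor_of_ne W (Finset.ne_of_mem_erase hj)]

theorem mul_prod_erase_eq (k : Fin d) (φ : ℝ → ℝ) (f : Fin d → ℝ → ℝ) (x : Fin d → ℝ) :
    φ (x k) * ∏ j ∈ Finset.univ.erase k, f j (x j) = ∏ j, (Function.update f k φ) j (x j) := by
  rw [← Finset.mul_prod_erase _ _ (Finset.mem_univ k), Function.update_self]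
  congr 1
  refine Finset.prod_congr rfl fun j hj => ?_
  rw [Function.update_of_ne (Finset.ne_of_mem_erase hj)]

theorem prod_erase_update (k : Fin d) (φ : ℝ → ℝ) (f : Fin d → ℝ → ℝ) (μ : Measure ℝ) :
    ∏ j ∈ Finset.univ.erase k, ∫ t, (Function.update f k φ) j t ∂μ
      = ∏ j ∈ Finset.univ.erase k, ∫ t, f j t ∂μ :=
  Finset.prod_congr rfl fun j hj => by rw [Function.update_of_ne (Finset.ne_of_mem_erase hj)]

/-- Separation of the variable `x_k` from a function of the other variables. -/
theorem integral_mul_coord_eq_zero (μ : Fin d → Measure ℝ) [∀ i, IsFiniteMeasure (μ i)]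
    (k : Fin d) {Q : (Fin d → ℝ) → ℝ} (hQ : ∀ x t, Q (Function.update x k t) = Q x) {D : ℝ → ℝ}
    (hD : ∫ t, D t ∂μ k = 0) : ∫ x, Q x * D (x k) ∂Measure.pi μ = 0 := by
  cases d with
  | zero => exact k.elim0
  | succ n =>
    rw [← (measurePreserving_piFinSuccAbove μ k).symm.integral_comp']
    have : ∀ p : ℝ × (Fin n → ℝ), Q ((MeasurableEquiv.piFinSuccAbove (fun _ => ℝ) k).symm p)
        * D ((MeasurableEquiv.piFinSuccAbove (fun _ => ℝ) k).symm p k)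
        = D p.1 * Q (k.insertNth 0 p.2) := by
      rintro ⟨t, y⟩
      have h1 : (MeasurableEquiv.piFinSuccAbove (fun _ => ℝ) k).symm (t, y)
          = Function.update (k.insertNth (α := fun _ => ℝ) 0 y) k t := by
        rw [Fin.update_insertNth]; rfl
      rw [h1, hQ, Function.update_self, mul_comm]
    simp_rw [this]
    rw [integral_prod_mul (f := D) (g := fun y => Q (k.insertNth 0 y)), hD, zero_mul]

theorem ae_eq_zero_of_forall_prodTest (hW : ∀ k, StrictMono (W k)) {G : (Fin d → ℝ) → ℝ}
    (hG : MemLp G 2 (torusVol d))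
    (h : ∀ e : ∀ j, WEigenfunction (W j), ∫ x, prodTest e x * G x ∂torusVol d = 0) :
    G =ᵐ[torusVol d] 0 := by
  refine ae_eq_zero_of_forall_prod (fun _ : Fin d => unitVol)
    (fun j => range fun e : WEigenfunction (W j) => e.toFun) ?_ ?_ hG ?_
  · rintro j _ ⟨e, rfl⟩
    exact e.isBddMeas_toFun
  · intro j g hg hs
    have : hg.toLp g = 0 := by
      refine eq_zero_of_forall_eigenfunction (hW j) fun e => ?_
      rw [← hs e.toFun ⟨e, rfl⟩]
      refine integral_congr_ae ?_
      filter_upwards [hg.coeFn_toLp] with x hx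
      rw [hx]
    exact ae_eq_zero_of_toLp_eq_zero hg this
  · intro s hs
    choose e he using hs
    have := h e
    simp only [prodTest] at this
    simpa only [← he, ← torusVol_eq] using this

/-- Derivatives of eigenfunctions have zero mean, so they miss exactly the constants in direction
`k`; the condition `hc` supplies those. -/
theorem ae_eq_zero_of_forall_prodTestDer (hW : ∀ k, StrictMono (W k)) (k : Fin d)
    {G : (Fin d → ℝ) → ℝ} (hG : MemLp G 2 (mixedVol W k))
    (h : ∀ e : ∀ j, WEigenfunction (W j), ∫ x, prodTestDer e k x * G x ∂mixedVol W k = 0)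
    (hc : ∀ c : (Fin d → ℝ) → ℝ, Measurable c → (∃ C, ∀ x, |c x| ≤ C) →
      (∀ x t, c (Function.update x k t) = c x) → ∫ x, c x * G x ∂mixedVol W k = 0) :
    G =ᵐ[mixedVol W k] 0 := by
  -- In direction `k` the total set is the derivatives together with the constant `1`; in the other
  -- directions it is the eigenfunctions themselves.
  refine ae_eq_zero_of_forall_prod (mixedFactor W k)
    (fun j => {f | if j = k then (∃ e : WEigenfunction (W j), f = e.der) ∨ f = fun _ => 1
      else ∃ e : WEigenfunction (W j), f = e.toFun}) ?_ ?_ hG ?_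
  · intro j s hs
    by_cases hj : j = k
    · simp only [hj, if_true, mem_ofPred_eq] at hs
      rcases hs with ⟨e, rfl⟩ | rfl
      · exact e.isBddMeas_der
      · exact IsBddMeas.const 1
    · simp only [hj, if_false, mem_ofPred_eq] at hs
      obtain ⟨e, rfl⟩ := hs
      exact e.isBddMeas_toFun
  · intro j g hg hs
    by_cases hj : j = k
    · subst hj
      simp only [if_true, mem_ofPred_eq] at hs
      rw [mixedFactor_self] at *
      have : hg.toLp g = 0 := by
        refine eq_zero_of_forall_eigenfunction_der (hW j) (fun e => ?_) ?_
        · rw [← hs e.der (Or.inl ⟨e, rfl⟩)]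
          refine integral_congr_ae ?_
          filter_upwards [hg.coeFn_toLp] with x hx
          rw [hx]
        · rw [integral_congr_ae hg.coeFn_toLp]
          simpa using hs (fun _ => 1) (Or.inr rfl)
      exact ae_eq_zero_of_toLp_eq_zero hg this
    · simp only [hj, if_false, mem_ofPred_eq] at hs
      rw [mixedFactor_of_ne W hj] at *
      have : hg.toLp g = 0 := by
        refine eq_zero_of_forall_eigenfunction (hW j) fun e => ?_
        rw [← hs e.toFun ⟨e, rfl⟩]
        refine integral_congr_ae ?_
        filter_upwards [hg.coeFn_toLp] with x hx
        rw [hx]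
      exact ae_eq_zero_of_toLp_eq_zero hg this
  · intro s hs
    have hj : ∀ j, j ≠ k → ∃ e : WEigenfunction (W j), s j = e.toFun := fun j hj => by
      have := hs j
      simpa only [hj, if_false, mem_ofPred_eq] using this
    have hk := hs k
    simp only [if_true, mem_ofPred_eq] at hk
    have hex : ∀ ek : WEigenfunction (W k), ∃ e : ∀ j, WEigenfunction (W j),
        (∀ j ∈ Finset.univ.erase k, s j = (e j).toFun) ∧ e k = ek := fun ek => by
      refine ⟨fun j => if h : j = k then h ▸ ek else (hj j h).choose, fun j hjk => ?_, by simp⟩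
      have := Finset.ne_of_mem_erase hjk
      simp only [this, dif_neg, not_false_eq_true]
      exact (hj j this).choose_spec
    have hprod : ∀ e : ∀ j, WEigenfunction (W j), (∀ j ∈ Finset.univ.erase k, s j = (e j).toFun) →
        ∀ x : Fin d → ℝ, ∏ j, s j (x j) = s k (x k) * ∏ j ∈ Finset.univ.erase k, (e j).toFun (x j) := fun e he x => by
      rw [← Finset.mul_prod_erase _ _ (Finset.mem_univ k)]
      congr 1
      exact Finset.prod_congr rfl fun j hj => by rw [he j hj]
    rcases hk with ⟨ek, hk⟩ | hk
    · obtain ⟨e, he, rfl⟩ := hex ek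
      have := h e
      simp only [prodTestDer] at this
      rw [← this]
      refine integral_congr_ae (Eventually.of_forall fun x => ?_)
      simp only [hprod e he, hk]
    · obtain ⟨e, he, -⟩ := hex (constEigenfunction _)
      have hb : IsBddMeas fun x : Fin d → ℝ => ∏ j ∈ Finset.univ.erase k, (e j).toFun (x j) :=
        IsBddMeas.prod fun j _ => (e j).isBddMeas_toFun.coord j
      have := hc _ hb.1 hb.2 fun x t => Finset.prod_congr rfl fun j hj => by
        rw [Function.update_of_ne (Finset.ne_of_mem_erase hj)]
      rw [← this]
      refine integral_congr_ae (Eventually.of_forall fun x => ?_)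
      simp only [hprod e he, hk, one_mul]

/-- `F` is a periodic primitive of the bounded function `D` with respect to `dw` on `(0,1]`. -/
structure IsWPrimitive (w : StieltjesFunction ℝ) (F D : ℝ → ℝ) : Prop where
  bdd : IsBddMeas F
  bdd_der : IsBddMeas D
  integral_der : ∫ t, D t ∂unitW w = 0
  eq_primitive : ∃ c, ∀ x ∈ Ioc (0 : ℝ) 1, F x = c + primitive (unitW w) D x

theorem WEigenfunction.isWPrimitive {w : StieltjesFunction ℝ} (e : WEigenfunction w) :
    IsWPrimitive w e.toFun e.der :=
  ⟨e.isBddMeas_toFun, e.isBddMeas_der, e.integral_der,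
    e.toFun 0, fun _ hx => e.toFun_eq_primitive ⟨hx.1.le, hx.2⟩⟩

/-- The weak derivative of a product of one-variable functions. -/
theorem isWeakWDeriv_prod (k : Fin d) {F : Fin d → ℝ → ℝ} {D : ℝ → ℝ}
    (hk : IsWPrimitive (W k) (F k) D) :
    IsWeakWDeriv W k (fun x => ∏ j, F j (x j))
      fun x => D (x k) * ∏ j ∈ Finset.univ.erase k, F j (x j) := by
  refine ⟨fun e => ?_, fun c hm hb hc => ?_⟩
  · have h1 : ∀ x, prodTestDer2 e k x * ∏ j, F j (x j)
        = ∏ j, (Function.update (fun j t => (e j).toFun t * F j t) k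
          (fun t => (e k).ev * (e k).toFun t * F k t)) j (x j) := fun x => by
      rw [← mul_prod_erase_eq, prodTestDer2, prodTest, Finset.prod_mul_distrib,
        ← Finset.mul_prod_erase _ _ (Finset.mem_univ k),
        ← Finset.mul_prod_erase Finset.univ (fun j => F j (x j)) (Finset.mem_univ k)]
      ring
    have h2 : ∀ x, prodTestDer e k x * (D (x k) * ∏ j ∈ Finset.univ.erase k, F j (x j))
        = ∏ j, (Function.update (fun j t => (e j).toFun t * F j t) k
          (fun t => (e k).der t * D t)) j (x j) := fun x => by
      rw [← mul_prod_erase_eq, prodTestDer, Finset.prod_mul_distrib]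
      ring
    simp only [h1, h2]
    rw [integral_prod_torusVol, integral_prod_mixedVol,
      ← Finset.mul_prod_erase _ _ (Finset.mem_univ k), prod_erase_update, prod_erase_update,
      Function.update_self, Function.update_self]
    obtain ⟨C, hC⟩ := hk.eq_primitive
    rw [(e k).integral_by_parts (hk.bdd_der.integrable _) hk.integral_der hC, neg_mul]
  · have h1 : ∀ x : Fin d → ℝ, c x * (D (x k) * ∏ j ∈ Finset.univ.erase k, F j (x j))
        = (c x * ∏ j ∈ Finset.univ.erase k, F j (x j)) * D (x k) := fun x => by ring
    simp only [h1]
    refine integral_mul_coord_eq_zero (mixedFactor W k) k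
      (Q := fun x => c x * ∏ j ∈ Finset.univ.erase k, F j (x j)) (fun x t => ?_) ?_
    · simp only [hc]
      congr 1
      exact Finset.prod_congr rfl fun j hj => by
        rw [Function.update_of_ne (Finset.ne_of_mem_erase hj)]
    · rw [mixedFactor_self]; exact hk.integral_der

theorem isBddMeas_prodTestDer (e : ∀ j, WEigenfunction (W j)) (k : Fin d) :
    IsBddMeas (prodTestDer e k) := ⟨measurable_prodTestDer e k, bounded_prodTestDer e k⟩

theorem isBddMeas_prodTestDer2 (e : ∀ j, WEigenfunction (W j)) (k : Fin d) :
    IsBddMeas (prodTestDer2 e k) := ⟨measurable_prodTestDer2 e k, bounded_prodTestDer2 e k⟩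

theorem isBddMeas_prodTest (e : ∀ j, WEigenfunction (W j)) : IsBddMeas (prodTest e) :=
  ⟨measurable_prodTest e, bounded_prod_toFun e Finset.univ⟩

theorem IsWeakWDeriv.sum {k : Fin d} {ι : Type*} (s : Finset ι) (c : ι → ℝ)
    {g G : ι → (Fin d → ℝ) → ℝ} (hg : ∀ i ∈ s, Integrable (g i) (torusVol d))
    (hG : ∀ i ∈ s, Integrable (G i) (mixedVol W k)) (h : ∀ i ∈ s, IsWeakWDeriv W k (g i) (G i)) :
    IsWeakWDeriv W k (fun x => ∑ i ∈ s, c i * g i x) fun x => ∑ i ∈ s, c i * G i x := by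
  have key : ∀ (μ : Measure (Fin d → ℝ)) (b : (Fin d → ℝ) → ℝ) (u : ι → (Fin d → ℝ) → ℝ),
      IsBddMeas b → (∀ i ∈ s, Integrable (u i) μ) →
      ∫ x, b x * ∑ i ∈ s, c i * u i x ∂μ = ∑ i ∈ s, c i * ∫ x, b x * u i x ∂μ := by
    intro μ b u hb hu
    have : ∀ x, b x * ∑ i ∈ s, c i * u i x = ∑ i ∈ s, c i * (b x * u i x) := fun x => by
      rw [Finset.mul_sum]; exact Finset.sum_congr rfl fun i _ => by ring
    simp only [this]
    rw [integral_finsetSum _ fun i hi => ((hb.mul_integrable (hu i hi)).const_mul _)]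
    exact Finset.sum_congr rfl fun i _ => integral_const_mul _ _
  refine ⟨fun e => ?_, fun b hm hb hc => ?_⟩
  · rw [key _ _ _ (isBddMeas_prodTestDer2 e k) hg, key _ _ _ (isBddMeas_prodTestDer e k) hG,
      ← Finset.sum_neg_distrib]
    exact Finset.sum_congr rfl fun i hi => by rw [(h i hi).1 e, mul_neg]
  · rw [key _ _ _ ⟨hm, hb⟩ hG]
    exact Finset.sum_eq_zero fun i hi => by rw [(h i hi).2 b hm hb hc, mul_zero]

theorem IsWeakWDeriv.congr_ae {k : Fin d} {g g' G G' : (Fin d → ℝ) → ℝ}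
    (h : IsWeakWDeriv W k g G) (hg : g =ᵐ[torusVol d] g') (hG : G =ᵐ[mixedVol W k] G') :
    IsWeakWDeriv W k g' G' := by
  refine ⟨fun e => ?_, fun c hm hb hc => ?_⟩
  · rw [← integral_mul_congr_ae _ hg, ← integral_mul_congr_ae _ hG]
    exact h.1 e
  · rw [← integral_mul_congr_ae _ hG]
    exact h.2 c hm hb hc

end

/-! ### The Hilbert space `H_{1,W}`: closedness, injectivity and total sets -/

noncomputable section

variable {d : ℕ} {W : Fin d → StieltjesFunction ℝ}

/-- The element of `L²(𝕋^d) × ∏_k L²_{x^k ⊗ W_k}(𝕋^d)` with given components. -/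
def l2Mk {g : (Fin d → ℝ) → ℝ} (hg : MemLp g 2 (torusVol d)) {G : Fin d → (Fin d → ℝ) → ℝ}
    (hG : ∀ k, MemLp (G k) 2 (mixedVol W k)) : L2Prod W :=
  WithLp.toLp 2 (hg.toLp g, WithLp.toLp 2 fun k => (hG k).toLp (G k))

theorem l2Mk_fst {g : (Fin d → ℝ) → ℝ} (hg : MemLp g 2 (torusVol d))
    {G : Fin d → (Fin d → ℝ) → ℝ} (hG : ∀ k, MemLp (G k) 2 (mixedVol W k)) :
    (l2Mk hg hG).fst =ᵐ[torusVol d] g := hg.coeFn_toLp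

theorem l2Mk_snd {g : (Fin d → ℝ) → ℝ} (hg : MemLp g 2 (torusVol d))
    {G : Fin d → (Fin d → ℝ) → ℝ} (hG : ∀ k, MemLp (G k) 2 (mixedVol W k)) (k : Fin d) :
    (l2Mk hg hG).snd k =ᵐ[mixedVol W k] G k := (hG k).coeFn_toLp

theorem inner_L2Prod (p q : L2Prod W) : inner ℝ p q = ∫ x, p.fst x * q.fst x ∂torusVol d
    + ∑ k, ∫ x, p.snd k x * q.snd k x ∂mixedVol W k := by
  rw [WithLp.prod_inner_apply, PiLp.inner_apply]
  congr 1
  · exact inner_L2_eq _ _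
  · exact Finset.sum_congr rfl fun k _ => inner_L2_eq _ _

theorem inner_l2Mk {g : (Fin d → ℝ) → ℝ} (hg : MemLp g 2 (torusVol d))
    {G : Fin d → (Fin d → ℝ) → ℝ} (hG : ∀ k, MemLp (G k) 2 (mixedVol W k)) (q : L2Prod W) :
    inner ℝ (l2Mk hg hG) q = ∫ x, g x * q.fst x ∂torusVol d
      + ∑ k, ∫ x, G k x * q.snd k x ∂mixedVol W k := by
  rw [inner_L2Prod]
  congr 1
  · exact integral_congr_ae ((l2Mk_fst hg hG).mul (ae_eq_refl _))
  · exact Finset.sum_congr rfl fun k _ =>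
      integral_congr_ae ((l2Mk_snd hg hG k).mul (ae_eq_refl _))

theorem l2Mk_mem_H1W {g : (Fin d → ℝ) → ℝ} (hg : MemLp g 2 (torusVol d))
    {G : Fin d → (Fin d → ℝ) → ℝ} (hG : ∀ k, MemLp (G k) 2 (mixedVol W k))
    (h : ∀ k, IsWeakWDeriv W k g (G k)) : l2Mk hg hG ∈ H1W W := fun k =>
  (h k).congr_ae (l2Mk_fst hg hG).symm (l2Mk_snd hg hG k).symm

theorem memLp_prodTest (e : ∀ j, WEigenfunction (W j)) : MemLp (prodTest e) 2 (torusVol d) :=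
  (isBddMeas_prodTest e).memLp _ _

theorem memLp_prodTestDer (e : ∀ j, WEigenfunction (W j)) (k : Fin d) :
    MemLp (prodTestDer e k) 2 (mixedVol W k) :=
  (isBddMeas_prodTestDer e k).memLp _ _

/-- A product of eigenfunctions as an element of `H_{1,W}`. -/
def prodTestH1 (e : ∀ j, WEigenfunction (W j)) : H1W W :=
  ⟨l2Mk (memLp_prodTest e) (memLp_prodTestDer e),
    l2Mk_mem_H1W _ _ fun k => isWeakWDeriv_prod k (F := fun j => (e j).toFun) (e k).isWPrimitive⟩

theorem continuous_integral_bdd_mul {α : Type*} [MeasurableSpace α] {μ : Measure α}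
    [IsFiniteMeasure μ] {c : α → ℝ} (hc : IsBddMeas c) :
    Continuous fun g : Lp ℝ 2 μ => ∫ x, c x * g x ∂μ := by
  have : (fun g : Lp ℝ 2 μ => ∫ x, c x * g x ∂μ) = fun g => inner ℝ ((hc.memLp μ 2).toLp c) g := by
    funext g
    rw [inner_L2_eq]
    exact integral_congr_ae ((hc.memLp μ 2).coeFn_toLp.symm.mul (ae_eq_refl _))
  rw [this]
  fun_prop

theorem L2Prod.continuous_fst : Continuous fun p : L2Prod W => p.fst :=
  WithLp.continuous_fst _ _ _

theorem L2Prod.continuous_snd (k : Fin d) : Continuous fun p : L2Prod W => p.snd k :=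
  (PiLp.continuous_apply 2 _ k).comp (WithLp.continuous_snd _ _ _)

theorem isClosed_H1W : IsClosed (H1W W : Set (L2Prod W)) := by
  have : (H1W W : Set (L2Prod W)) = ⋂ k, ((⋂ e : ∀ j, WEigenfunction (W j),
      {p | ∫ x, prodTestDer2 e k x * p.fst x ∂torusVol d
        = -∫ x, prodTestDer e k x * p.snd k x ∂mixedVol W k}) ∩
      ⋂ (c : (Fin d → ℝ) → ℝ) (_ : Measurable c) (_ : ∃ C, ∀ x, |c x| ≤ C)
        (_ : ∀ x t, c (Function.update x k t) = c x),
        {p | ∫ x, c x * p.snd k x ∂mixedVol W k = 0}) := by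
    ext p
    simp only [mem_iInter, mem_inter_iff, mem_ofPred_eq]
    rfl
  rw [this]
  refine isClosed_iInter fun k => IsClosed.inter (isClosed_iInter fun e => ?_)
    (isClosed_iInter fun c => isClosed_iInter fun hm => isClosed_iInter fun hb =>
      isClosed_iInter fun _ => ?_)
  · exact isClosed_eq
      ((continuous_integral_bdd_mul (isBddMeas_prodTestDer2 e k)).comp L2Prod.continuous_fst)
      ((continuous_integral_bdd_mul (isBddMeas_prodTestDer e k)).comp (L2Prod.continuous_snd k)).neg
  · exact isClosed_eq ((continuous_integral_bdd_mul ⟨hm, hb⟩).comp (L2Prod.continuous_snd k))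
      continuous_const

instance : CompleteSpace (H1W W) := isClosed_H1W.completeSpace_coe

theorem L2Prod_ext {p q : L2Prod W} (h1 : p.fst = q.fst) (h2 : ∀ k, p.snd k = q.snd k) : p = q := by
  have h3 : p.snd = q.snd := PiLp.ext h2
  have : p.ofLp = q.ofLp := Prod.ext h1 h3
  exact (WithLp.ofLp_injective 2) this

/-- The weak derivatives of zero are orthogonal to all derivatives of product test functions and, by
the zero mean condition in the definition, to all bounded functions of the other variables. -/
theorem eq_zero_of_mem_H1W_of_fst_eq_zero (hW : ∀ k, StrictMono (W k)) {p : L2Prod W}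
    (hp : p ∈ H1W W) (h : p.fst = 0) : p = 0 := by
  refine L2Prod_ext h fun k => ?_
  have h1 := ae_eq_zero_of_forall_prodTestDer hW k (Lp.memLp (p.snd k)) (fun e => ?_) (hp k).2
  · exact Lp.ext (h1.trans (Lp.coeFn_zero ℝ 2 _).symm)
  · have := (hp k).1 e
    rw [h, integral_mul_zero_L2] at this
    linarith

/-- Weak limits in `H_{1,W}` can therefore be identified from their `L²` component alone. -/
theorem fst_injOn_H1W (hW : ∀ k, StrictMono (W k)) {p q : L2Prod W}
    (hp : p ∈ H1W W) (hq : q ∈ H1W W) (h : p.fst = q.fst) : p = q := by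
  rw [← sub_eq_zero]
  refine eq_zero_of_mem_H1W_of_fst_eq_zero hW ((H1W W).sub_mem hp hq) ?_
  change p.fst - q.fst = 0
  rw [h, sub_self]

theorem prodTest_ae_eq_zero {e : ∀ j, WEigenfunction (W j)} {j : Fin d}
    (h : (e j).toFun =ᵐ[unitVol] 0) : prodTest e =ᵐ[torusVol d] 0 := by
  have h1 : ∀ᵐ x ∂torusVol d, (e j).toFun (x j) = 0 :=
    (Measure.quasiMeasurePreserving_eval (μ := fun _ : Fin d => unitVol) j).ae h
  filter_upwards [h1] with x hx
  exact Finset.prod_eq_zero (Finset.mem_univ j) hx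

theorem fst_eq_zero_of_prodTest (hW : ∀ k, StrictMono (W k)) {p : L2Prod W}
    (h : ∀ e : ∀ j, WEigenfunction (W j), ∫ x, prodTest e x * p.fst x ∂torusVol d = 0) :
    p.fst = 0 :=
  Lp.ext ((ae_eq_zero_of_forall_prodTest hW (Lp.memLp _) h).trans (Lp.coeFn_zero ℝ 2 _).symm)

theorem ae_mem_Ioc_torusVol : ∀ᵐ x ∂torusVol d, ∀ j, x j ∈ Ioc (0 : ℝ) 1 :=
  ae_all_iff.2 fun j => (Measure.quasiMeasurePreserving_eval (μ := fun _ : Fin d => unitVol) j).ae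
    (ae_restrict_mem measurableSet_Ioc)

/-- A function with vanishing weak derivatives and zero mean vanishes. -/
theorem fst_eq_zero_of_snd_eq_zero (hW : ∀ k, StrictMono (W k)) {p : L2Prod W} (hp : p ∈ H1W W)
    (h : ∀ k, p.snd k = 0) (hmean : ∫ x, p.fst x ∂torusVol d = 0) : p.fst = 0 := by
  refine fst_eq_zero_of_prodTest hW fun e => ?_
  -- If all eigenvalues vanish the product is constant and the zero mean applies; otherwise
  -- integration by parts in a direction with nonzero eigenvalue does.
  by_cases hev : ∀ j, (e j).ev = 0
  · have : ∫ x, prodTest e x * p.fst x ∂torusVol d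
        = ∫ x, (∏ j, (e j).toFun 0) * p.fst x ∂torusVol d := by
      refine integral_congr_ae ?_
      filter_upwards [ae_mem_Ioc_torusVol] with x hx
      rw [prodTest]
      congr 1
      exact Finset.prod_congr rfl fun j _ =>
        (e j).toFun_eq_of_ev_eq_zero (hev j) ⟨(hx j).1.le, (hx j).2⟩
    rw [this, integral_const_mul, hmean, mul_zero]
  · push Not at hev
    obtain ⟨k, hk⟩ := hev
    have := (hp k).1 e
    rw [h k, integral_mul_zero_L2, neg_zero] at this
    simp only [prodTestDer2, mul_assoc] at this
    rw [integral_const_mul] at this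
    exact (mul_eq_zero.1 this).resolve_left hk

/-- The definition of the weak derivative turns each gradient term into an `L²` pairing, since the
product is an eigenvector in every direction. -/
theorem inner_prodTestH1 (e : ∀ j, WEigenfunction (W j)) {p : L2Prod W} (hp : p ∈ H1W W) :
    inner ℝ (prodTestH1 e : L2Prod W) p
      = (1 - ∑ k, (e k).ev) * ∫ x, prodTest e x * p.fst x ∂torusVol d := by
  rw [prodTestH1, inner_l2Mk, sub_mul, one_mul, sub_eq_add_neg, Finset.sum_mul,
    ← Finset.sum_neg_distrib]
  congr 1
  refine Finset.sum_congr rfl fun k _ => ?_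
  have := (hp k).1 e
  simp only [prodTestDer2, mul_assoc] at this
  rw [integral_const_mul] at this
  linarith

/-- Products of eigenfunctions are total in `H_{1,W}`. -/
theorem eq_zero_of_forall_inner_prodTestH1 (hW : ∀ k, StrictMono (W k)) {p : L2Prod W}
    (hp : p ∈ H1W W) (h : ∀ e : ∀ j, WEigenfunction (W j), inner ℝ (prodTestH1 e : L2Prod W) p = 0) : p = 0 := by
  refine eq_zero_of_mem_H1W_of_fst_eq_zero hW hp (fst_eq_zero_of_prodTest hW fun e => ?_)
  -- The factor `1 - ∑ ev` must be nonzero. It is at least `1` when all eigenvalues are nonpositive,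
  -- and a factor with an eigenvalue of the wrong sign vanishes almost everywhere.
  by_cases he : ∃ j, (e j).toFun =ᵐ[unitVol] 0
  · obtain ⟨j, hj⟩ := he
    refine integral_eq_zero_of_ae ?_
    filter_upwards [prodTest_ae_eq_zero hj] with x hx
    rw [hx, Pi.zero_apply, zero_mul]
  · push Not at he
    have h1 := h e
    rw [inner_prodTestH1 e hp] at h1
    refine (mul_eq_zero.1 h1).resolve_left ?_
    have : ∑ k, (e k).ev ≤ 0 :=
      Finset.sum_nonpos fun k _ => (e k).ev_nonpos_or.resolve_right (he k)
    linarith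

/-- The vector `x` need not lie in `H_{1,W}`; its orthogonal projection does, and totality applies
to the projection. This is how an equation tested on products extends to every `v`. -/
theorem inner_eq_zero_of_forall_prodTestH1 (hW : ∀ k, StrictMono (W k)) {x : L2Prod W}
    (h : ∀ e : ∀ j, WEigenfunction (W j), inner ℝ x (prodTestH1 e : L2Prod W) = 0) {v : L2Prod W} (hv : v ∈ H1W W) :
    inner ℝ x v = 0 := by
  obtain ⟨y, hy, z, hz, rfl⟩ := (H1W W).exists_add_mem_mem_orthogonal x
  have hy0 : y = 0 := by
    refine eq_zero_of_forall_inner_prodTestH1 hW hy fun e => ?_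
    have := h e
    rw [inner_add_left, Submodule.inner_left_of_mem_orthogonal (prodTestH1 e).2 hz,
      add_zero] at this
    rw [real_inner_comm, this]
  rw [hy0, zero_add, Submodule.inner_left_of_mem_orthogonal hv hz]

end

/-! ### Mesh cells and hat functions in one variable -/

noncomputable section

/-- The one-dimensional mesh cell `(x/N, (x+1)/N]`. -/
def cell1 (N : ℕ+) (x : ZMod N) : Set ℝ :=
  Ioc ((x.val : ℝ) / (N : ℕ)) (((x.val : ℝ) + 1) / (N : ℕ))

/-- The indicator function of a one-dimensional mesh cell. -/
def cellInd (N : ℕ+) (x : ZMod N) : ℝ → ℝ := (cell1 N x).indicator fun _ => 1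

/-- The `w`-length of a one-dimensional mesh cell. -/
def cellDW (w : StieltjesFunction ℝ) (N : ℕ+) (x : ZMod N) : ℝ :=
  w (((x.val : ℝ) + 1) / (N : ℕ)) - w ((x.val : ℝ) / (N : ℕ))

variable {N : ℕ+}

theorem pnat_pos (N : ℕ+) : (0 : ℝ) < (N : ℕ) := Nat.cast_pos.2 N.pos

theorem cell1_subset (x : ZMod N) : cell1 N x ⊆ Ioc 0 1 := fun y hy => by
  have hx : (x.val : ℝ) + 1 ≤ (N : ℕ) := by exact_mod_cast ZMod.val_lt x
  exact ⟨lt_of_le_of_lt (by positivity) hy.1,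
    hy.2.trans ((div_le_one (pnat_pos N)).2 hx)⟩

theorem exists_mem_cell1 (N : ℕ+) {y : ℝ} (hy : y ∈ Ioc (0 : ℝ) 1) : ∃ x : ZMod N, y ∈ cell1 N x := by
  have hN := pnat_pos N
  set n := ⌈y * (N : ℕ)⌉₊ with hn
  have h1 : 0 < n := Nat.ceil_pos.2 (mul_pos hy.1 hN)
  have h2 : n ≤ N := Nat.ceil_le.2 (by nlinarith [hy.2])
  have h3 : ((n - 1 : ℕ) : ZMod N).val = n - 1 := ZMod.val_cast_of_lt (by omega)
  have h4 : ((n - 1 : ℕ) : ℝ) = (n : ℝ) - 1 := by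
    rw [Nat.cast_sub h1, Nat.cast_one]
  refine ⟨((n - 1 : ℕ) : ZMod N), ?_, ?_⟩
  · rw [h3, h4, div_lt_iff₀ hN]
    have := Nat.ceil_lt_add_one (mul_pos hy.1 hN).le
    linarith
  · rw [h3, h4, le_div_iff₀ hN]
    have := Nat.le_ceil (y * (N : ℕ))
    linarith

theorem val_le_of_mem_cell1 {x x' : ZMod N} {y y' : ℝ} (h : y ∈ cell1 N x) (h' : y' ∈ cell1 N x')
    (hyy : y ≤ y') : x.val ≤ x'.val := by
  have h1 : (x.val : ℝ) / (N : ℕ) < ((x'.val : ℝ) + 1) / (N : ℕ) := h.1.trans_le (hyy.trans h'.2)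
  rw [div_lt_div_iff_of_pos_right (pnat_pos N)] at h1
  have : x.val < x'.val + 1 := by exact_mod_cast h1
  omega

theorem eq_of_mem_cell1 {x x' : ZMod N} {y : ℝ} (h : y ∈ cell1 N x) (h' : y ∈ cell1 N x') :
    x = x' :=
  ZMod.val_injective _ (le_antisymm (val_le_of_mem_cell1 h h' le_rfl)
    (val_le_of_mem_cell1 h' h le_rfl))

theorem measurableSet_cell1 (x : ZMod N) : MeasurableSet (cell1 N x) := measurableSet_Ioc

theorem cellInd_of_mem {x x' : ZMod N} {y : ℝ} (h : y ∈ cell1 N x') :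
    cellInd N x y = if x = x' then 1 else 0 := by
  split_ifs with hx
  · subst hx; exact indicator_of_mem h _
  · exact indicator_of_notMem (fun h1 => hx (eq_of_mem_cell1 h1 h)) _

theorem isBddMeas_cellInd (x : ZMod N) : IsBddMeas (cellInd N x) :=
  IsBddMeas.indicator_const (measurableSet_cell1 x) 1

theorem cellInd_nonneg (x : ZMod N) (y : ℝ) : 0 ≤ cellInd N x y :=
  indicator_nonneg (fun _ _ => zero_le_one) _

theorem sum_cellInd {y : ℝ} (hy : y ∈ Ioc (0 : ℝ) 1) : ∑ x : ZMod N, cellInd N x y = 1 := by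
  obtain ⟨x, hx⟩ := exists_mem_cell1 N hy
  simp [cellInd_of_mem hx]

theorem cellDW_pos {w : StieltjesFunction ℝ} (hw : StrictMono w) (x : ZMod N) :
    0 < cellDW w N x := by
  have : (x.val : ℝ) / (N : ℕ) < ((x.val : ℝ) + 1) / (N : ℕ) := by
    have := pnat_pos N
    gcongr; linarith
  exact sub_pos.2 (hw this)

theorem unitW_real_cell1 (w : StieltjesFunction ℝ) (x : ZMod N) :
    (unitW w).real (cell1 N x) = cellDW w N x := by
  rw [measureReal_def, Measure.restrict_apply (measurableSet_cell1 x),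
    inter_eq_left.2 (cell1_subset x), cell1, StieltjesFunction.measure_Ioc, ENNReal.toReal_ofReal]
  · rfl
  · exact sub_nonneg.2 (w.mono (by have := pnat_pos N; gcongr; linarith))

theorem unitVol_real_cell1 (x : ZMod N) : unitVol.real (cell1 N x) = ((N : ℕ) : ℝ)⁻¹ := by
  rw [measureReal_def, Measure.restrict_apply (measurableSet_cell1 x),
    inter_eq_left.2 (cell1_subset x), cell1, Real.volume_Ioc, ← sub_div, add_sub_cancel_left,
    ENNReal.toReal_ofReal (by positivity), one_div]

theorem integral_cellInd (μ : Measure ℝ) (x : ZMod N) :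
    ∫ y, cellInd N x y ∂μ = μ.real (cell1 N x) := by
  rw [cellInd, integral_indicator (measurableSet_cell1 x)]
  simp

theorem integral_cellInd_unitVol (x : ZMod N) :
    ∫ y, cellInd N x y ∂unitVol = ((N : ℕ) : ℝ)⁻¹ := by
  rw [integral_cellInd, unitVol_real_cell1]

theorem integral_cellInd_unitW (w : StieltjesFunction ℝ) (x : ZMod N) :
    ∫ y, cellInd N x y ∂unitW w = cellDW w N x := by
  rw [integral_cellInd, unitW_real_cell1]

theorem sum_cellDW (w : StieltjesFunction ℝ) : ∑ x : ZMod N, cellDW w N x = w 1 - w 0 := by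
  simp_rw [← integral_cellInd_unitW]
  rw [← integral_finsetSum _ fun x _ => (isBddMeas_cellInd x).integrable _]
  have : ∫ y, ∑ x : ZMod N, cellInd N x y ∂unitW w = ∫ _, 1 ∂unitW w := by
    refine integral_congr_ae ?_
    filter_upwards [ae_restrict_mem measurableSet_Ioc] with y hy
    exact sum_cellInd hy
  rw [this]
  simp [measureReal_def, w.mono zero_le_one]

/-- The position of `y` in its cell, in the scale `w`. -/
def cellPos (w : StieltjesFunction ℝ) (N : ℕ+) (y : ℝ) : ℝ :=
  ∑ x : ZMod N, cellInd N x y * ((w y - w ((x.val : ℝ) / (N : ℕ))) / cellDW w N x)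

theorem cellPos_of_mem (w : StieltjesFunction ℝ) {x : ZMod N} {y : ℝ} (hy : y ∈ cell1 N x) :
    cellPos w N y = (w y - w ((x.val : ℝ) / (N : ℕ))) / cellDW w N x := by
  simp [cellPos, cellInd_of_mem hy]

theorem cellPos_mem_Icc {w : StieltjesFunction ℝ} (hw : StrictMono w) (y : ℝ) :
    cellPos w N y ∈ Icc (0 : ℝ) 1 := by
  by_cases h : ∃ x : ZMod N, y ∈ cell1 N x
  · obtain ⟨x, hx⟩ := h
    rw [cellPos_of_mem w hx]
    have h1 := cellDW_pos (N := N) hw x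
    refine ⟨div_nonneg (sub_nonneg.2 (hw.monotone hx.1.le)) h1.le, (div_le_one h1).2 ?_⟩
    exact sub_le_sub_right (hw.monotone hx.2) _
  · push Not at h
    have : cellPos w N y = 0 :=
      Finset.sum_eq_zero fun x _ => by rw [cellInd, indicator_of_notMem (h x), zero_mul]
    rw [this]
    exact ⟨le_rfl, zero_le_one⟩

theorem isBddMeas_cellPos {w : StieltjesFunction ℝ} (hw : StrictMono w) :
    IsBddMeas (cellPos w N) := by
  refine ⟨?_, 1, fun y => ?_⟩
  · refine Finset.measurable_sum _ fun x _ => (isBddMeas_cellInd x).1.mul ?_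
    exact (hw.monotone.measurable.sub_const _).div_const _
  · have := cellPos_mem_Icc (N := N) hw y
    rw [abs_of_nonneg this.1]
    exact this.2

/-- The one-dimensional `w`-hat function at the mesh point `z`. -/
def cellHat (w : StieltjesFunction ℝ) (N : ℕ+) (z : ZMod N) (y : ℝ) : ℝ :=
  cellInd N (z - 1) y * cellPos w N y + cellInd N z y * (1 - cellPos w N y)

/-- The derivative of the hat function with respect to `dw`. -/
def cellHatDer (w : StieltjesFunction ℝ) (N : ℕ+) (z : ZMod N) (y : ℝ) : ℝ :=
  cellInd N (z - 1) y / cellDW w N (z - 1) - cellInd N z y / cellDW w N z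

theorem cellHat_nonneg {w : StieltjesFunction ℝ} (hw : StrictMono w) (z : ZMod N) (y : ℝ) :
    0 ≤ cellHat w N z y := by
  have := cellPos_mem_Icc (N := N) hw y
  exact add_nonneg (mul_nonneg (cellInd_nonneg _ _) this.1)
    (mul_nonneg (cellInd_nonneg _ _) (sub_nonneg.2 this.2))

theorem sum_cellHat {w : StieltjesFunction ℝ} {y : ℝ} (hy : y ∈ Ioc (0 : ℝ) 1) :
    ∑ z : ZMod N, cellHat w N z y = 1 := by
  simp only [cellHat, Finset.sum_add_distrib, ← Finset.sum_mul]
  have h := (Equiv.subRight (1 : ZMod N)).sum_comp (fun z => cellInd N z y)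
  simp only [Equiv.subRight_apply] at h
  rw [h, sum_cellInd hy]
  ring

theorem isBddMeas_cellHat {w : StieltjesFunction ℝ} (hw : StrictMono w) (z : ZMod N) :
    IsBddMeas (cellHat w N z) := by
  have h := isBddMeas_cellPos (N := N) hw
  have h1 : IsBddMeas fun y => 1 - cellPos w N y := by
    have := (IsBddMeas.const (α := ℝ) 1).add ((IsBddMeas.const (-1)).mul h)
    simpa [sub_eq_add_neg] using this
  exact ((isBddMeas_cellInd _).mul h).add ((isBddMeas_cellInd z).mul h1)

theorem isBddMeas_cellHatDer (w : StieltjesFunction ℝ) (z : ZMod N) :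
    IsBddMeas (cellHatDer w N z) := by
  have := ((isBddMeas_cellInd (z - 1)).mul (IsBddMeas.const (cellDW w N (z - 1))⁻¹)).add
    ((isBddMeas_cellInd z).mul (IsBddMeas.const (-(cellDW w N z)⁻¹)))
  simp only [mul_neg, ← sub_eq_add_neg, ← div_eq_mul_inv] at this
  exact this

theorem cellHat_le {w : StieltjesFunction ℝ} (hw : StrictMono w) (z : ZMod N) (y : ℝ) :
    cellHat w N z y ≤ cellInd N (z - 1) y + cellInd N z y := by
  have := cellPos_mem_Icc (N := N) hw y
  have h1 := cellInd_nonneg (z - 1) y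
  have h2 := cellInd_nonneg z y
  rw [cellHat]
  nlinarith [this.1, this.2]

theorem integral_cellHat_le {w : StieltjesFunction ℝ} (hw : StrictMono w) (z : ZMod N) :
    ∫ y, cellHat w N z y ∂unitVol ≤ 2 * ((N : ℕ) : ℝ)⁻¹ := by
  have h := integral_mono ((isBddMeas_cellHat hw z).integrable unitVol)
    (((isBddMeas_cellInd (z - 1)).integrable unitVol).add ((isBddMeas_cellInd z).integrable _))
    (cellHat_le hw z)
  refine h.trans_eq ?_
  have := integral_add ((isBddMeas_cellInd (z - 1)).integrable unitVol)
    ((isBddMeas_cellInd z).integrable unitVol)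
  rw [integral_cellInd_unitVol, integral_cellInd_unitVol] at this
  rw [two_mul, ← this]
  rfl

/-- A cell to the left of `y` contributes its full `dw`-mass, a cell to the right nothing, and the
cell of `y` the fraction `cellPos`. -/
theorem primitive_cellInd {w : StieltjesFunction ℝ} (hw : StrictMono w) (x : ZMod N) {x' : ZMod N}
    {y : ℝ} (hy : y ∈ cell1 N x') : primitive (unitW w) (cellInd N x) y =
      cellDW w N x * if x.val < x'.val then 1 else if x = x' then cellPos w N y else 0 := by
  have hN := pnat_pos N
  have hy01 := cell1_subset x' hy
  have h1 : primitive (unitW w) (cellInd N x) y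
      = (w.measure (Ioc ((x.val : ℝ) / (N : ℕ)) (min y (((x.val : ℝ) + 1) / (N : ℕ))))).toReal := by
    have hset : Ioc 0 y ∩ cell1 N x
        = Ioc ((x.val : ℝ) / (N : ℕ)) (min y (((x.val : ℝ) + 1) / (N : ℕ))) := by
      rw [cell1, Ioc_inter_Ioc]
      congr 1
      exact max_eq_right (by positivity)
    rw [primitive_restrict _ _ hy01.2, cellInd, setIntegral_indicator (measurableSet_cell1 x), hset]
    simp [measureReal_def]
  rw [h1, StieltjesFunction.measure_Ioc]
  rcases lt_trichotomy x.val x'.val with h | h | h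
  · have h2 : ((x.val : ℝ) + 1) / (N : ℕ) ≤ y := by
      refine le_trans ?_ hy.1.le
      gcongr
      exact_mod_cast h
    rw [min_eq_right h2, if_pos h, mul_one]
    exact ENNReal.toReal_ofReal (cellDW_pos hw x).le
  · have h2 := ZMod.val_injective _ h
    subst h2
    rw [if_neg (lt_irrefl _), if_pos rfl, min_eq_left hy.2, cellPos_of_mem w hy,
      mul_div_cancel₀ _ (cellDW_pos hw x).ne', ENNReal.toReal_ofReal]
    exact sub_nonneg.2 (hw.monotone hy.1.le)
  · have h2 : y ≤ (x.val : ℝ) / (N : ℕ) := by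
      refine hy.2.trans ?_
      gcongr
      exact_mod_cast h
    rw [if_neg h.not_gt, if_neg (fun h3 => by rw [h3] at h; exact lt_irrefl _ h), mul_zero,
      ENNReal.ofReal_of_nonpos, ENNReal.toReal_zero]
    exact sub_nonpos.2 (hw.monotone ((min_le_left _ _).trans h2))

theorem zmod_val_sub_one {z : ZMod N} (hz : z ≠ 0) : (z - 1).val + 1 = z.val := by
  have h1 : 0 < z.val := Nat.pos_of_ne_zero fun h => hz ((ZMod.val_eq_zero z).1 h)
  have h2 : z.val < N := ZMod.val_lt z
  have h3 : z - 1 = ((z.val - 1 : ℕ) : ZMod N) := by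
    rw [Nat.cast_sub h1, ZMod.natCast_zmod_val, Nat.cast_one]
  rw [h3, ZMod.val_cast_of_lt (by omega)]
  omega

theorem zmod_val_zero_sub_one : ((0 : ZMod N) - 1).val + 1 = N := by
  have h3 : (0 : ZMod N) - 1 = ((N - 1 : ℕ) : ZMod N) := by
    rw [Nat.cast_sub N.pos, ZMod.natCast_self, Nat.cast_one]
  have := N.pos
  rw [h3, ZMod.val_cast_of_lt (by omega)]
  omega

/-- The hat functions are periodic primitives. -/
theorem isWPrimitive_cellHat {w : StieltjesFunction ℝ} (hw : StrictMono w) (z : ZMod N) :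
    IsWPrimitive w (cellHat w N z) (cellHatDer w N z) := by
  have hi : ∀ x : ZMod N, Integrable (fun y => cellInd N x y / cellDW w N x) (unitW w) := fun x =>
    ((isBddMeas_cellInd x).integrable _).div_const _
  -- The additive constant is the nodal value at `0`, which is `1` only for the hat centred at the
  -- mesh point `0`.
  refine ⟨isBddMeas_cellHat hw z, isBddMeas_cellHatDer w z, ?_, if z = 0 then 1 else 0,
    fun y hy => ?_⟩
  · simp only [cellHatDer]
    rw [integral_sub (hi _) (hi _), integral_div, integral_div, integral_cellInd_unitW,
      integral_cellInd_unitW, div_self (cellDW_pos hw _).ne', div_self (cellDW_pos hw _).ne',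
      sub_self]
  · obtain ⟨x', hx'⟩ := exists_mem_cell1 N hy
    have hp : primitive (unitW w) (cellHatDer w N z) y
        = primitive (unitW w) (cellInd N (z - 1)) y / cellDW w N (z - 1)
          - primitive (unitW w) (cellInd N z) y / cellDW w N z := by
      simp only [primitive, cellHatDer]
      rw [integral_sub (hi _).integrableOn (hi _).integrableOn, integral_div, integral_div]
    rw [hp, primitive_cellInd hw _ hx', primitive_cellInd hw _ hx',
      mul_div_cancel_left₀ _ (cellDW_pos hw _).ne', mul_div_cancel_left₀ _ (cellDW_pos hw _).ne',
      cellHat, cellInd_of_mem hx', cellInd_of_mem hx']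
    have hlt : x'.val < N := ZMod.val_lt x'
    by_cases hz : z = 0
    · subst hz
      have h1 := zmod_val_zero_sub_one (N := N)
      have h2 : ¬ ((0 : ZMod N) - 1).val < x'.val := by omega
      rw [if_neg h2, if_pos rfl, ZMod.val_zero]
      by_cases h3 : (0 : ZMod N) = x'
      · subst h3
        simp only [ZMod.val_zero, lt_irrefl, if_false, if_true]
        -- The remaining condition `0 - 1 = 0` holds exactly when `N = 1`, where the rising and the
        -- falling cell of the hat coincide.
        split_ifs <;> ring
      · have h4 : 0 < x'.val := Nat.pos_of_ne_zero fun h =>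
          h3 ((ZMod.val_eq_zero x').1 h).symm
        simp only [h4, h3, if_true, if_false]
        split_ifs <;> ring
    · have h1 := zmod_val_sub_one hz
      rw [if_neg hz]
      by_cases h3 : z = x'
      · subst h3
        have h2 : z - 1 ≠ z := fun h => by rw [h] at h1; omega
        have h4 : (z - 1).val < z.val := by omega
        simp only [h2, h4, lt_irrefl, if_true, if_false]
        ring
      · by_cases h4 : z - 1 = x'
        · subst h4
          have h5 : ¬ z.val < (z - 1).val := by omega
          simp only [h3, h5, lt_irrefl, if_true, if_false]
          ring
        · have h5 : (z - 1).val ≠ x'.val := fun h => h4 (ZMod.val_injective _ h)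
          have h6 : z.val ≠ x'.val := fun h => h3 (ZMod.val_injective _ h)
          by_cases h7 : z.val < x'.val
          · have h8 : (z - 1).val < x'.val := by omega
            simp only [h3, h4, h7, h8, if_true, if_false]
            ring
          · have h8 : ¬ (z - 1).val < x'.val := by omega
            simp only [h3, h4, h7, h8, if_false]
            ring

end

/-! ### Mixed interpolations of mesh functions -/

noncomputable section

variable {d : ℕ} {W : Fin d → StieltjesFunction ℝ} {N : ℕ+}

/-- The factors of the mixed interpolation: hat functions in the directions of `T`, indicators of
cells in the others. -/
def interpBasis (W : Fin d → StieltjesFunction ℝ) (N : ℕ+) (T : Finset (Fin d)) (i : Fin d)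
    (z : ZMod N) : ℝ → ℝ :=
  if i ∈ T then cellHat (W i) N z else cellInd N z

/-- The interpolation of a mesh function which is `W`-affine in the directions of `T` and piecewise
constant in the others. -/
def interp (W : Fin d → StieltjesFunction ℝ) (N : ℕ+) (T : Finset (Fin d)) (u : Mesh d N)
    (y : Fin d → ℝ) : ℝ :=
  ∑ z : Fin d → ZMod N, u z * ∏ i, interpBasis W N T i (z i) (y i)

theorem isBddMeas_interpBasis (hW : ∀ k, StrictMono (W k)) (T : Finset (Fin d)) (i : Fin d)
    (z : ZMod N) : IsBddMeas (interpBasis W N T i z) := by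
  unfold interpBasis
  split_ifs
  · exact isBddMeas_cellHat (hW i) z
  · exact isBddMeas_cellInd z

theorem interpBasis_nonneg (hW : ∀ k, StrictMono (W k)) (T : Finset (Fin d)) (i : Fin d)
    (z : ZMod N) (y : ℝ) : 0 ≤ interpBasis W N T i z y := by
  unfold interpBasis
  split_ifs
  · exact cellHat_nonneg (hW i) z y
  · exact cellInd_nonneg z y

theorem sum_interpBasis (T : Finset (Fin d)) (i : Fin d) {y : ℝ} (hy : y ∈ Ioc (0 : ℝ) 1) :
    ∑ z : ZMod N, interpBasis W N T i z y = 1 := by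
  unfold interpBasis
  split_ifs
  · exact sum_cellHat hy
  · exact sum_cellInd hy

theorem isBddMeas_interp (hW : ∀ k, StrictMono (W k)) (T : Finset (Fin d)) (u : Mesh d N) :
    IsBddMeas (interp W N T u) :=
  IsBddMeas.sum fun z _ => (IsBddMeas.const _).mul
    (IsBddMeas.prod fun i _ => (isBddMeas_interpBasis hW T i (z i)).coord i)

theorem meshCell_indicator (x : Fin d → ZMod N) (c : ℝ) (y : Fin d → ℝ) :
    (meshCell N x).indicator (fun _ => c) y = c * ∏ i, cellInd N (x i) (y i) := by
  by_cases hy : y ∈ meshCell N x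
  · rw [indicator_of_mem hy, Finset.prod_eq_one, mul_one]
    exact fun i _ => indicator_of_mem (show y i ∈ cell1 N (x i) from hy i) _
  · rw [indicator_of_notMem hy]
    have : ∃ i, y i ∉ cell1 N (x i) := by
      by_contra! h
      exact hy h
    obtain ⟨i, hi⟩ := this
    rw [Finset.prod_eq_zero (Finset.mem_univ i), mul_zero]
    exact indicator_of_notMem hi _

theorem pcInterp_eq_interp (W : Fin d → StieltjesFunction ℝ) (u : Mesh d N) :
    pcInterp N u = interp W N ∅ u := by
  funext y
  simp [pcInterp, interp, meshCell_indicator, interpBasis]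

theorem pcInterp_of_mem {x : Fin d → ZMod N} {y : Fin d → ℝ} (hy : y ∈ meshCell N x)
    (u : Mesh d N) : pcInterp N u y = u x := by
  rw [pcInterp, Finset.sum_eq_single x, indicator_of_mem hy]
  · intro x' _ hne
    refine indicator_of_notMem (fun h => hne ?_) _
    exact funext fun i => eq_of_mem_cell1 (h i) (hy i)
  · simp

theorem exists_mem_meshCell (N : ℕ+) {y : Fin d → ℝ} (hy : ∀ i, y i ∈ Ioc (0 : ℝ) 1) :
    ∃ x : Fin d → ZMod N, y ∈ meshCell N x := by
  choose x hx using fun i => exists_mem_cell1 N (hy i)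
  exact ⟨x, hx⟩

theorem isBddMeas_pcInterp (u : Mesh d N) : IsBddMeas (pcInterp N u) := by
  have : pcInterp N u = fun y => ∑ x : Fin d → ZMod N, u x * ∏ i, cellInd N (x i) (y i) := by
    funext y; simp [pcInterp, meshCell_indicator]
  rw [this]
  exact IsBddMeas.sum fun z _ => (IsBddMeas.const _).mul
    (IsBddMeas.prod fun i _ => (isBddMeas_cellInd (z i)).coord i)

/-- Expanding the product over directions of a sum of two one-variable terms produces the sum over
vertices `x + e_S` of the cell. -/
theorem wInterp_eq_interp (u : Mesh d N) {y : Fin d → ℝ} (hy : ∀ i, y i ∈ Ioc (0 : ℝ) 1) :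
    wInterp W N u y = interp W N Finset.univ u y := by
  obtain ⟨x, hx⟩ := exists_mem_meshCell N hy
  have h1 : wInterp W N u y = ∑ S : Finset (Fin d), u (fun i => if i ∈ S then x i + 1 else x i) *
      ∏ i, if i ∈ S then cellPos (W i) N (y i) else 1 - cellPos (W i) N (y i) := by
    rw [wInterp, Finset.sum_eq_single x, indicator_of_mem hx]
    · refine Finset.sum_congr rfl fun S _ => ?_
      congr 1
      refine Finset.prod_congr rfl fun i _ => ?_
      rw [cellPos_of_mem (W i) (hx i)]
      rfl
    · intro x' _ hne
      refine indicator_of_notMem (fun h => hne ?_) _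
      exact funext fun i => eq_of_mem_cell1 (h i) (hx i)
    · simp
  -- The two contributions are kept as separate indicators, so the formula stays correct for `N =
  -- 1`, where `x i + 1 = x i`.
  have h2 : ∀ (i : Fin d) (z : ZMod N), interpBasis W N Finset.univ i z (y i)
      = (if z = x i + 1 then cellPos (W i) N (y i) else 0)
        + (if z = x i then 1 - cellPos (W i) N (y i) else 0) := fun i z => by
    rw [interpBasis, if_pos (Finset.mem_univ i), cellHat, cellInd_of_mem (hx i),
      cellInd_of_mem (hx i)]
    simp [sub_eq_iff_eq_add]
  rw [h1, interp]
  simp only [h2, Finset.prod_add, Finset.mul_sum, Finset.powerset_univ]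
  rw [Finset.sum_comm]
  refine Finset.sum_congr rfl fun S _ => ?_
  -- For fixed `S` only the nodal function at the vertex `x + e_S` is nonzero.
  rw [Finset.sum_eq_single fun i => if i ∈ S then x i + 1 else x i]
  · congr 1
    rw [← Finset.prod_mul_prod_compl S, Finset.compl_eq_univ_sdiff]
    congr 1
    · exact Finset.prod_congr rfl fun i hi => by simp [hi]
    · exact Finset.prod_congr rfl fun i hi => by
        have : i ∉ S := (Finset.mem_sdiff.1 hi).2
        simp [this]
  · intro z _ hz
    have : ∃ i, z i ≠ if i ∈ S then x i + 1 else x i := by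
      by_contra! h
      exact hz (funext h)
    obtain ⟨i, hi⟩ := this
    by_cases hiS : i ∈ S
    · rw [if_pos hiS] at hi
      rw [Finset.prod_eq_zero hiS (if_neg hi), zero_mul, mul_zero]
    · rw [if_neg hiS] at hi
      rw [Finset.prod_eq_zero (Finset.mem_sdiff.2 ⟨Finset.mem_univ i, hiS⟩) (if_neg hi), mul_zero,
        mul_zero]
  · simp

/-- Summation by parts on the discrete torus. -/
theorem sum_shift (k : Fin d) (u : Mesh d N) (φ : ZMod N → ℝ) (P : (Fin d → ZMod N) → ℝ)
    (hP : ∀ z, P (z + Pi.single k 1) = P z) :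
    ∑ z : Fin d → ZMod N, u z * (φ (z k - 1) * P z)
      = ∑ z : Fin d → ZMod N, u (z + Pi.single k 1) * (φ (z k) * P z) := by
  rw [← Equiv.sum_comp (Equiv.addRight (Pi.single k (1 : ZMod N) : Fin d → ZMod N))
    fun z => u z * (φ (z k - 1) * P z)]
  refine Finset.sum_congr rfl fun z _ => ?_
  simp [hP]

theorem prod_erase_interpBasis_shift (T : Finset (Fin d)) (k : Fin d) (y : Fin d → ℝ)
    (z : Fin d → ZMod N) :
    ∏ j ∈ Finset.univ.erase k, interpBasis W N T j ((z + Pi.single k 1 : Fin d → ZMod N) j) (y j)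
      = ∏ j ∈ Finset.univ.erase k, interpBasis W N T j (z j) (y j) :=
  Finset.prod_congr rfl fun j hj => by
    rw [Pi.add_apply, Pi.single_eq_of_ne (Finset.ne_of_mem_erase hj), add_zero]

theorem interp_eq_erase (T : Finset (Fin d)) (k : Fin d) (u : Mesh d N) (y : Fin d → ℝ) :
    interp W N T u y = ∑ z : Fin d → ZMod N, u z * (interpBasis W N T k (z k) (y k)
      * ∏ j ∈ Finset.univ.erase k, interpBasis W N T j (z j) (y j)) :=
  Finset.sum_congr rfl fun z _ => by rw [← Finset.mul_prod_erase _ _ (Finset.mem_univ k)]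

theorem prod_erase_interpBasis_congr {T T' : Finset (Fin d)} {k : Fin d}
    (h : ∀ j, j ≠ k → (j ∈ T ↔ j ∈ T')) (y : Fin d → ℝ) (z : Fin d → ZMod N) :
    ∏ j ∈ Finset.univ.erase k, interpBasis W N T j (z j) (y j)
      = ∏ j ∈ Finset.univ.erase k, interpBasis W N T' j (z j) (y j) :=
  Finset.prod_congr rfl fun j hj => by
    simp only [interpBasis, h j (Finset.ne_of_mem_erase hj)]

/-- The weak derivatives of the interpolations in the directions in which they are `W`-affine. -/
theorem isWeakWDeriv_interp (hW : ∀ k, StrictMono (W k)) {T : Finset (Fin d)} {k : Fin d}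
    (hk : k ∈ T) (u : Mesh d N) :
    IsWeakWDeriv W k (interp W N T u) (interp W N (T.erase k) (meshDer W N k u)) := by
  have hb : ∀ z : Fin d → ZMod N, IsBddMeas fun x : Fin d → ℝ =>
      ∏ j ∈ Finset.univ.erase k, interpBasis W N T j (z j) (x j) := fun z =>
    IsBddMeas.prod fun i _ => (isBddMeas_interpBasis hW T i (z i)).coord i
  have h1 := IsWeakWDeriv.sum (W := W) (k := k) Finset.univ u
    (g := fun z x => ∏ j, interpBasis W N T j (z j) (x j))
    (G := fun z x => cellHatDer (W k) N (z k) (x k)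
      * ∏ j ∈ Finset.univ.erase k, interpBasis W N T j (z j) (x j))
    (fun z _ => (IsBddMeas.prod fun i _ =>
      (isBddMeas_interpBasis hW T i (z i)).coord i).integrable _)
    (fun z _ => (((isBddMeas_cellHatDer (W k) (z k)).coord k).mul (hb z)).integrable _)
    (fun z _ => isWeakWDeriv_prod k (F := fun j => interpBasis W N T j (z j)) (by
      simp only [interpBasis, if_pos hk]
      exact isWPrimitive_cellHat (hW k) (z k)))
  suffices h : interp W N (T.erase k) (meshDer W N k u) = fun x => ∑ z, u z *
      (cellHatDer (W k) N (z k) (x k)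
        * ∏ j ∈ Finset.univ.erase k, interpBasis W N T j (z j) (x j)) by
    rw [h]; exact h1
  funext y
  rw [interp_eq_erase _ k]
  symm
  have h2 : ∀ z : Fin d → ZMod N, u z * (cellHatDer (W k) N (z k) (y k)
      * ∏ j ∈ Finset.univ.erase k, interpBasis W N T j (z j) (y j))
      = u z * ((fun s => cellInd N s (y k) / cellDW (W k) N s) (z k - 1)
        * ∏ j ∈ Finset.univ.erase k, interpBasis W N T j (z j) (y j))
      - u z * (cellInd N (z k) (y k) / cellDW (W k) N (z k)
        * ∏ j ∈ Finset.univ.erase k, interpBasis W N T j (z j) (y j)) := fun z => by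
    rw [cellHatDer]; ring
  simp only [h2, Finset.sum_sub_distrib]
  -- Summation by parts moves the difference of neighbouring cell indicators onto `u`, where it
  -- becomes the difference quotient; direction `k` is left with a bare indicator, which explains
  -- `T.erase k`.
  rw [sum_shift k u (fun s => cellInd N s (y k) / cellDW (W k) N s) _
    (prod_erase_interpBasis_shift T k y), ← Finset.sum_sub_distrib]
  refine Finset.sum_congr rfl fun z _ => ?_
  rw [prod_erase_interpBasis_congr (T := T.erase k) (T' := T) (k := k)
    (fun j hj => by simp [hj])]
  simp only [interpBasis, Finset.notMem_erase, if_false, meshDer]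
  rw [show meshDW W N k z = cellDW (W k) N (z k) from rfl]
  ring

/-- Making one more direction `W`-affine adds the increment of `u` in that direction, weighted by
the position in the cell. The weight lies in `[0, 1]`, so the change is controlled by the
increments. -/
theorem interp_insert_sub {T : Finset (Fin d)} {k : Fin d} (hk : k ∉ T) (u : Mesh d N)
    (y : Fin d → ℝ) : interp W N (insert k T) u y - interp W N T u y
      = cellPos (W k) N (y k) * interp W N T (fun z => u (z + Pi.single k 1) - u z) y := by
  rw [interp_eq_erase _ k, interp_eq_erase T k, interp_eq_erase T k, Finset.mul_sum]
  have h2 : ∀ z : Fin d → ZMod N, u z * (interpBasis W N (insert k T) k (z k) (y k)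
      * ∏ j ∈ Finset.univ.erase k, interpBasis W N (insert k T) j (z j) (y j))
      = u z * ((fun s => cellInd N s (y k) * cellPos (W k) N (y k)) (z k - 1)
        * ∏ j ∈ Finset.univ.erase k, interpBasis W N T j (z j) (y j))
      + u z * (cellInd N (z k) (y k) * (1 - cellPos (W k) N (y k))
        * ∏ j ∈ Finset.univ.erase k, interpBasis W N T j (z j) (y j)) := fun z => by
    rw [prod_erase_interpBasis_congr (T := insert k T) (T' := T) (k := k)
      (fun j hj => by simp [hj])]
    simp only [interpBasis, Finset.mem_insert_self, if_true, cellHat]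
    ring
  simp only [h2, Finset.sum_add_distrib]
  rw [sum_shift k u (fun s => cellInd N s (y k) * cellPos (W k) N (y k)) _
    (prod_erase_interpBasis_shift T k y), ← Finset.sum_add_distrib, ← Finset.sum_sub_distrib]
  refine Finset.sum_congr rfl fun z _ => ?_
  simp only [interpBasis, if_neg hk]
  ring

/-- The basis products are nonnegative and sum to one, so this is Jensen's inequality, obtained from
Cauchy–Schwarz. -/
theorem interp_sq_le (hW : ∀ k, StrictMono (W k)) (T : Finset (Fin d)) (u : Mesh d N)
    {y : Fin d → ℝ} (hy : ∀ i, y i ∈ Ioc (0 : ℝ) 1) :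
    interp W N T u y ^ 2 ≤ ∑ z : Fin d → ZMod N, u z ^ 2 * ∏ i, interpBasis W N T i (z i) (y i) := by
  have hp : ∀ z : Fin d → ZMod N, 0 ≤ ∏ i, interpBasis W N T i (z i) (y i) := fun z =>
    Finset.prod_nonneg fun i _ => interpBasis_nonneg hW T i (z i) (y i)
  have h1 : ∑ z : Fin d → ZMod N, ∏ i, interpBasis W N T i (z i) (y i) = 1 := by
    have h := Finset.prod_univ_sum (fun _ : Fin d => (Finset.univ : Finset (ZMod N)))
      fun i z => interpBasis W N T i z (y i)
    rw [Fintype.piFinset_univ] at h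
    rw [← h]
    exact Finset.prod_eq_one fun i _ => sum_interpBasis T i (hy i)
  have h2 := Finset.sum_sq_le_sum_mul_sum_of_sq_le_mul Finset.univ
    (f := fun z : Fin d → ZMod N => ∏ i, interpBasis W N T i (z i) (y i))
    (g := fun z => u z ^ 2 * ∏ i, interpBasis W N T i (z i) (y i))
    (r := fun z => u z * ∏ i, interpBasis W N T i (z i) (y i))
    (fun z _ => hp z) (fun z _ => mul_nonneg (sq_nonneg _) (hp z))
    (fun z _ => le_of_eq (by ring))
  rw [h1, one_mul] at h2
  exact h2

theorem integral_interp_sq_le (hW : ∀ k, StrictMono (W k)) (μ : Fin d → Measure ℝ)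
    [∀ i, IsFiniteMeasure (μ i)] (hμ : ∀ᵐ y ∂Measure.pi μ, ∀ i, y i ∈ Ioc (0 : ℝ) 1)
    (T : Finset (Fin d)) (u : Mesh d N) :
    ∫ y, interp W N T u y ^ 2 ∂Measure.pi μ
      ≤ ∑ z : Fin d → ZMod N, u z ^ 2 * ∏ i, ∫ t, interpBasis W N T i (z i) t ∂μ i := by
  have hb : ∀ z : Fin d → ZMod N, IsBddMeas fun y : Fin d → ℝ =>
      u z ^ 2 * ∏ i, interpBasis W N T i (z i) (y i) := fun z =>
    (IsBddMeas.const _).mul (IsBddMeas.prod fun i _ => (isBddMeas_interpBasis hW T i (z i)).coord i)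
  have h1 : ∫ y, ∑ z : Fin d → ZMod N, u z ^ 2 * ∏ i, interpBasis W N T i (z i) (y i)
      ∂Measure.pi μ = ∑ z : Fin d → ZMod N, u z ^ 2 * ∏ i, ∫ t, interpBasis W N T i (z i) t ∂μ i := by
    rw [integral_finsetSum _ fun z _ => (hb z).integrable _]
    exact Finset.sum_congr rfl fun z _ => by
      rw [integral_const_mul, integral_fintype_prod_eq_prod]
  rw [← h1]
  refine integral_mono_ae ?_ ((IsBddMeas.sum fun z _ => hb z).integrable _) ?_
  · simp only [pow_two]
    exact ((isBddMeas_interp hW T u).mul (isBddMeas_interp hW T u)).integrable _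
  · filter_upwards [hμ] with y hy
    exact interp_sq_le hW T u hy

end

/-! ### `L²` bounds for interpolations and their mutual distance -/

noncomputable section

variable {d : ℕ} {W : Fin d → StieltjesFunction ℝ} {N : ℕ+}

theorem ae_mem_Ioc_mixedVol (W : Fin d → StieltjesFunction ℝ) (k : Fin d) :
    ∀ᵐ x ∂mixedVol W k, ∀ j, x j ∈ Ioc (0 : ℝ) 1 :=
  ae_all_iff.2 fun j => (Measure.quasiMeasurePreserving_eval (μ := mixedFactor W k) j).ae (by
    unfold mixedFactor
    split_ifs <;> exact ae_restrict_mem measurableSet_Ioc)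

theorem integral_interpBasis_nonneg (hW : ∀ k, StrictMono (W k)) (T : Finset (Fin d)) (i : Fin d)
    (z : ZMod N) (μ : Measure ℝ) : 0 ≤ ∫ t, interpBasis W N T i z t ∂μ :=
  integral_nonneg fun t => interpBasis_nonneg hW T i z t

theorem integral_interpBasis_unitVol_le (hW : ∀ k, StrictMono (W k)) (T : Finset (Fin d))
    (i : Fin d) (z : ZMod N) : ∫ t, interpBasis W N T i z t ∂unitVol ≤ 2 * ((N : ℕ) : ℝ)⁻¹ := by
  unfold interpBasis
  split_ifs
  · exact integral_cellHat_le (hW i) z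
  · rw [integral_cellInd_unitVol]
    have : (0 : ℝ) ≤ ((N : ℕ) : ℝ)⁻¹ := by positivity
    linarith

/-- The factor `2 ^ d` appears because a hat function spreads over two cells in each direction. -/
theorem integral_interp_sq_torusVol_le (hW : ∀ k, StrictMono (W k)) (T : Finset (Fin d))
    (u : Mesh d N) : ∫ y, interp W N T u y ^ 2 ∂torusVol d ≤ 2 ^ d * meshInner N u u := by
  refine (integral_interp_sq_le hW (fun _ => unitVol) ae_mem_Ioc_torusVol T u).trans ?_
  rw [meshInner, ← mul_assoc, Finset.mul_sum]
  refine Finset.sum_le_sum fun z _ => ?_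
  have : ∏ i, ∫ t, interpBasis W N T i (z i) t ∂unitVol ≤ 2 ^ d * (((N : ℕ) : ℝ) ^ d)⁻¹ := by
    refine (Finset.prod_le_prod (fun i _ => integral_interpBasis_nonneg hW T i (z i) _)
      fun i _ => integral_interpBasis_unitVol_le hW T i (z i)).trans_eq ?_
    rw [Finset.prod_const, Finset.card_univ, Fintype.card_fin, mul_pow, inv_pow]
  calc u z ^ 2 * ∏ i, ∫ t, interpBasis W N T i (z i) t ∂unitVol
      ≤ u z ^ 2 * (2 ^ d * (((N : ℕ) : ℝ) ^ d)⁻¹) := by gcongr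
    _ = _ := by ring

/-- In direction `k` the factor is a cell indicator, whose `dW_k`-integral is exactly the weight in
`meshInnerW`. A hat would reach into a neighbouring cell of unrelated `W`-length, hence the
condition on `T`. -/
theorem integral_interp_sq_mixedVol_le (hW : ∀ k, StrictMono (W k)) {T : Finset (Fin d)}
    {k : Fin d} (hk : k ∉ T) (u : Mesh d N) :
    ∫ y, interp W N T u y ^ 2 ∂mixedVol W k ≤ 2 ^ d * meshInnerW W N k u u := by
  refine (integral_interp_sq_le hW (mixedFactor W k) (ae_mem_Ioc_mixedVol W k) T u).trans ?_
  rw [meshInnerW, ← mul_assoc, Finset.mul_sum]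
  refine Finset.sum_le_sum fun z _ => ?_
  have h1 : ∏ i, ∫ t, interpBasis W N T i (z i) t ∂mixedFactor W k i
      ≤ meshDW W N k z * (2 ^ d * (((N : ℕ) : ℝ) ^ (d - 1))⁻¹) := by
    rw [← Finset.mul_prod_erase _ _ (Finset.mem_univ k), mixedFactor_self]
    have h2 : ∫ t, interpBasis W N T k (z k) t ∂unitW (W k) = meshDW W N k z := by
      rw [interpBasis, if_neg hk, integral_cellInd_unitW]; rfl
    rw [h2]
    have h3 : 0 ≤ meshDW W N k z := (cellDW_pos (hW k) (z k)).le
    refine mul_le_mul_of_nonneg_left ?_ h3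
    calc ∏ i ∈ Finset.univ.erase k, ∫ t, interpBasis W N T i (z i) t ∂mixedFactor W k i
        ≤ ∏ i ∈ Finset.univ.erase k, 2 * ((N : ℕ) : ℝ)⁻¹ := by
          refine Finset.prod_le_prod (fun i _ => integral_interpBasis_nonneg hW T i (z i) _)
            fun i hi => ?_
          rw [mixedFactor_of_ne W (Finset.ne_of_mem_erase hi)]
          exact integral_interpBasis_unitVol_le hW T i (z i)
      _ = 2 ^ (d - 1) * (((N : ℕ) : ℝ) ^ (d - 1))⁻¹ := by
          rw [Finset.prod_const, Finset.card_erase_of_mem (Finset.mem_univ k), Finset.card_univ,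
            Fintype.card_fin, mul_pow, inv_pow]
      _ ≤ 2 ^ d * (((N : ℕ) : ℝ) ^ (d - 1))⁻¹ := by
          gcongr
          · norm_num
          · omega
  calc u z ^ 2 * ∏ i, ∫ t, interpBasis W N T i (z i) t ∂mixedFactor W k i
      ≤ u z ^ 2 * (meshDW W N k z * (2 ^ d * (((N : ℕ) : ℝ) ^ (d - 1))⁻¹)) := by gcongr
    _ = _ := by ring

theorem pcInterp_mul {y : Fin d → ℝ} (hy : ∀ i, y i ∈ Ioc (0 : ℝ) 1) (u v : Mesh d N) :
    pcInterp N u y * pcInterp N v y = pcInterp N (u * v) y := by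
  obtain ⟨x, hx⟩ := exists_mem_meshCell N hy
  simp only [pcInterp_of_mem hx, Pi.mul_apply]

theorem integral_pcInterp (μ : Fin d → Measure ℝ) [∀ i, IsFiniteMeasure (μ i)] (u : Mesh d N) :
    ∫ y, pcInterp N u y ∂Measure.pi μ
      = ∑ x : Fin d → ZMod N, u x * ∏ i, (μ i).real (cell1 N (x i)) := by
  simp only [pcInterp, meshCell_indicator]
  rw [integral_finsetSum _ fun z _ => ((IsBddMeas.const _).mul
    (IsBddMeas.prod fun i _ => (isBddMeas_cellInd (z i)).coord i)).integrable _]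
  exact Finset.sum_congr rfl fun z _ => by
    rw [integral_const_mul, integral_fintype_prod_eq_prod]
    simp only [integral_cellInd]

theorem prod_real_cell1_torusVol (x : Fin d → ZMod N) :
    ∏ i, unitVol.real (cell1 N (x i)) = (((N : ℕ) : ℝ) ^ d)⁻¹ := by
  simp only [unitVol_real_cell1]
  simp

theorem prod_real_cell1_mixedVol (W : Fin d → StieltjesFunction ℝ) (k : Fin d)
    (x : Fin d → ZMod N) : ∏ i, (mixedFactor W k i).real (cell1 N (x i))
      = (((N : ℕ) : ℝ) ^ (d - 1))⁻¹ * meshDW W N k x := by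
  rw [← Finset.mul_prod_erase _ _ (Finset.mem_univ k), mixedFactor_self, unitW_real_cell1,
    mul_comm]
  congr 1
  rw [Finset.prod_congr rfl fun i hi => by
    rw [mixedFactor_of_ne W (Finset.ne_of_mem_erase hi), unitVol_real_cell1]]
  rw [Finset.prod_const, Finset.card_erase_of_mem (Finset.mem_univ k), Finset.card_univ,
    Fintype.card_fin, inv_pow]

theorem integral_pcInterp_mul_torusVol (u v : Mesh d N) :
    ∫ y, pcInterp N u y * pcInterp N v y ∂torusVol d = meshInner N u v := by
  have : ∫ y, pcInterp N u y * pcInterp N v y ∂torusVol d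
      = ∫ y, pcInterp N (u * v) y ∂torusVol d := by
    refine integral_congr_ae ?_
    filter_upwards [ae_mem_Ioc_torusVol] with y hy
    exact pcInterp_mul hy u v
  rw [this, torusVol_eq, integral_pcInterp, meshInner, Finset.mul_sum]
  refine Finset.sum_congr rfl fun x _ => ?_
  rw [prod_real_cell1_torusVol, Pi.mul_apply]; ring

theorem integral_pcInterp_mul_mixedVol (W : Fin d → StieltjesFunction ℝ) (k : Fin d)
    (u v : Mesh d N) :
    ∫ y, pcInterp N u y * pcInterp N v y ∂mixedVol W k = meshInnerW W N k u v := by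
  have : ∫ y, pcInterp N u y * pcInterp N v y ∂mixedVol W k
      = ∫ y, pcInterp N (u * v) y ∂mixedVol W k := by
    refine integral_congr_ae ?_
    filter_upwards [ae_mem_Ioc_mixedVol W k] with y hy
    exact pcInterp_mul hy u v
  rw [this, mixedVol, integral_pcInterp, meshInnerW, Finset.mul_sum]
  refine Finset.sum_congr rfl fun x _ => ?_
  rw [prod_real_cell1_mixedVol, Pi.mul_apply]; ring

theorem meshInnerW_self_nonneg (W : Fin d → StieltjesFunction ℝ) (k : Fin d) (u : Mesh d N) :
    0 ≤ meshInnerW W N k u u := by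
  rw [← integral_pcInterp_mul_mixedVol]
  exact integral_nonneg fun y => mul_self_nonneg _

theorem cellDW_le (hw : ∀ k, StrictMono (W k)) (k : Fin d) (x : ZMod N) :
    cellDW (W k) N x ≤ W k 1 - W k 0 := by
  rw [← sum_cellDW (N := N)]
  exact Finset.single_le_sum (fun x _ => (cellDW_pos (hw k) x).le) (Finset.mem_univ x)

/-- An increment is the difference quotient times the `W`-length of its cell. One of the two lengths
in its square is the weight of the energy, the other is at most the total length, and the remaining
gain is the ratio of the normalizations `N^{-d}` and `N^{-(d-1)}`. -/
theorem meshInner_shift_sub_le (hW : ∀ k, StrictMono (W k)) (k : Fin d) (u : Mesh d N) :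
    meshInner N (fun z => u (z + Pi.single k 1) - u z) (fun z => u (z + Pi.single k 1) - u z)
      ≤ (W k 1 - W k 0) * ((N : ℕ) : ℝ)⁻¹ *
        meshInnerW W N k (meshDer W N k u) (meshDer W N k u) := by
  have hd : d = d - 1 + 1 := by have := k.pos; omega
  have h1 : (((N : ℕ) : ℝ) ^ d)⁻¹ = ((N : ℕ) : ℝ)⁻¹ * (((N : ℕ) : ℝ) ^ (d - 1))⁻¹ := by
    conv_lhs => rw [hd, pow_succ, mul_inv]
    ring
  rw [meshInner, meshInnerW, h1, Finset.mul_sum, ← mul_assoc, Finset.mul_sum]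
  refine Finset.sum_le_sum fun z _ => ?_
  have h2 : 0 < meshDW W N k z := cellDW_pos (hW k) (z k)
  have h3 : meshDW W N k z ≤ W k 1 - W k 0 := cellDW_le hW k (z k)
  have h4 : u (z + Pi.single k 1) - u z = meshDer W N k u z * meshDW W N k z := by
    rw [meshDer, div_mul_cancel₀ _ h2.ne']
  rw [h4]
  calc ((N : ℕ) : ℝ)⁻¹ * (((N : ℕ) : ℝ) ^ (d - 1))⁻¹ *
      (meshDer W N k u z * meshDW W N k z * (meshDer W N k u z * meshDW W N k z))
      = ((N : ℕ) : ℝ)⁻¹ * (((N : ℕ) : ℝ) ^ (d - 1))⁻¹ *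
        (meshDer W N k u z * meshDer W N k u z * meshDW W N k z) * meshDW W N k z := by ring
    _ ≤ ((N : ℕ) : ℝ)⁻¹ * (((N : ℕ) : ℝ) ^ (d - 1))⁻¹ *
        (meshDer W N k u z * meshDer W N k u z * meshDW W N k z) * (W k 1 - W k 0) := by
        have := mul_self_nonneg (meshDer W N k u z)
        gcongr
    _ = _ := by ring

/-- The interpolations of a mesh function with bounded energy are close to each other. -/
theorem exists_integral_interp_sub_sq_le (hW : ∀ k, StrictMono (W k)) (T : Finset (Fin d)) :
    ∃ C : ℝ, 0 ≤ C ∧ ∀ (N : ℕ+) (u : Mesh d N),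
      ∫ y, (interp W N T u y - pcInterp N u y) ^ 2 ∂torusVol d
        ≤ C * ((N : ℕ) : ℝ)⁻¹ * ∑ k, meshInnerW W N k (meshDer W N k u) (meshDer W N k u) := by
  induction T using Finset.induction_on with
  | empty => exact ⟨0, le_rfl, fun N u => by simp [pcInterp_eq_interp W]⟩
  | insert k T hk ih =>
    obtain ⟨C, hC0, hC⟩ := ih
    have hWk : 0 ≤ W k 1 - W k 0 := sub_nonneg.2 ((hW k).monotone zero_le_one)
    -- From `(p + q)² ≤ 2p² + 2q²`, where `p` is the change caused by direction `k` and `q` is the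
    -- error already bounded by `C`.
    refine ⟨2 * (2 ^ d * (W k 1 - W k 0)) + 2 * C, by positivity, fun N u => ?_⟩
    set E := ∑ k, meshInnerW W N k (meshDer W N k u) (meshDer W N k u) with hE
    set δ : Mesh d N := fun z => u (z + Pi.single k 1) - u z with hδ
    have hb1 := isBddMeas_interp (N := N) hW T δ
    have hb2 : IsBddMeas fun y => interp W N T u y - pcInterp N u y := by
      have := (isBddMeas_interp hW T u).add ((IsBddMeas.const (-1)).mul (isBddMeas_pcInterp u))
      simpa [sub_eq_add_neg] using this
    have hb3 : IsBddMeas fun y => interp W N (insert k T) u y - pcInterp N u y := by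
      have := (isBddMeas_interp hW (insert k T) u).add
        ((IsBddMeas.const (-1)).mul (isBddMeas_pcInterp u))
      simpa [sub_eq_add_neg] using this
    have h1 : ∀ y, (interp W N (insert k T) u y - pcInterp N u y) ^ 2
        ≤ 2 * interp W N T δ y ^ 2 + 2 * (interp W N T u y - pcInterp N u y) ^ 2 := fun y => by
      have h2 := interp_insert_sub (W := W) hk u y
      have h3 := cellPos_mem_Icc (N := N) (hW k) (y k)
      have h4 : interp W N (insert k T) u y - pcInterp N u y
          = cellPos (W k) N (y k) * interp W N T δ y
            + (interp W N T u y - pcInterp N u y) := by rw [hδ, ← h2]; ring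
      have h5 : cellPos (W k) N (y k) ^ 2 ≤ 1 := by nlinarith [h3.1, h3.2]
      have h6 : (cellPos (W k) N (y k) * interp W N T δ y) ^ 2 ≤ interp W N T δ y ^ 2 := by
        rw [mul_pow]
        nlinarith [sq_nonneg (interp W N T δ y)]
      rw [h4]
      nlinarith [sq_nonneg (cellPos (W k) N (y k) * interp W N T δ y
        - (interp W N T u y - pcInterp N u y))]
    have hi1 : Integrable (fun y => 2 * interp W N T δ y ^ 2) (torusVol d) := by
      simp only [pow_two]
      exact (hb1.mul hb1).integrable _ |>.const_mul 2
    have hi2 : Integrable (fun y => 2 * (interp W N T u y - pcInterp N u y) ^ 2) (torusVol d) := by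
      simp only [pow_two]
      exact (hb2.mul hb2).integrable _ |>.const_mul 2
    have hi3 : Integrable (fun y => (interp W N (insert k T) u y - pcInterp N u y) ^ 2)
        (torusVol d) := by
      simp only [pow_two]
      exact (hb3.mul hb3).integrable _
    have h7 := integral_mono hi3 (hi1.add hi2) h1
    have h8 : ∫ y, ((fun y => 2 * interp W N T δ y ^ 2 : (Fin d → ℝ) → ℝ)
        + (fun y => 2 * (interp W N T u y - pcInterp N u y) ^ 2 : (Fin d → ℝ) → ℝ)) y ∂torusVol d
        = 2 * (∫ y, interp W N T δ y ^ 2 ∂torusVol d)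
          + 2 * ∫ y, (interp W N T u y - pcInterp N u y) ^ 2 ∂torusVol d := by
      rw [← integral_const_mul, ← integral_const_mul, ← integral_add hi1 hi2]
      rfl
    rw [h8] at h7
    have h9 := (integral_interp_sq_torusVol_le hW T δ).trans
      (mul_le_mul_of_nonneg_left (meshInner_shift_sub_le hW k u) (by positivity))
    have h10 : meshInnerW W N k (meshDer W N k u) (meshDer W N k u) ≤ E :=
      Finset.single_le_sum (f := fun k => meshInnerW W N k (meshDer W N k u) (meshDer W N k u))
        (fun j _ => meshInnerW_self_nonneg W j _) (Finset.mem_univ k)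
    have hNi : (0 : ℝ) ≤ ((N : ℕ) : ℝ)⁻¹ := by positivity
    have h11 : 2 ^ d * ((W k 1 - W k 0) * ((N : ℕ) : ℝ)⁻¹ *
        meshInnerW W N k (meshDer W N k u) (meshDer W N k u))
        ≤ 2 ^ d * ((W k 1 - W k 0) * ((N : ℕ) : ℝ)⁻¹ * E) := by gcongr
    have h12 := hC N u
    calc _ ≤ _ := h7
      _ ≤ 2 * (2 ^ d * ((W k 1 - W k 0) * ((N : ℕ) : ℝ)⁻¹ * E))
          + 2 * (C * ((N : ℕ) : ℝ)⁻¹ * E) := by gcongr; exact h9.trans h11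
      _ = _ := by ring

end

/-! ### The discrete Poincaré inequality -/

noncomputable section

variable {d : ℕ} {W : Fin d → StieltjesFunction ℝ} {N : ℕ+}

theorem sum_range_natCast_zmod (N : ℕ+) (g : ZMod N → ℝ) :
    ∑ i ∈ Finset.range N, g (i : ZMod N) = ∑ x : ZMod N, g x := by
  refine Finset.sum_nbij' (fun i => (i : ZMod N)) (fun x => x.val) (by simp)
    (fun x _ => Finset.mem_range.2 (ZMod.val_lt x)) (fun i hi => ?_) (fun x _ => ?_) (fun _ _ => rfl)
  · exact ZMod.val_cast_of_lt (Finset.mem_range.1 hi)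
  · exact ZMod.natCast_zmod_val x

theorem abs_sub_le_sum_zmod (φ : ZMod N → ℝ) (a b : ZMod N) :
    |φ a - φ b| ≤ ∑ t, |φ (t + 1) - φ t| := by
  wlog hab : a.val ≤ b.val generalizing a b
  · rw [abs_sub_comm]
    exact this b a (le_of_not_ge hab)
  have h1 := dist_le_Ico_sum_dist (fun n : ℕ => φ (n : ZMod N)) hab
  simp only [ZMod.natCast_zmod_val, Real.dist_eq, Nat.cast_add, Nat.cast_one] at h1
  refine h1.trans ?_
  rw [← sum_range_natCast_zmod N fun t => |φ (t + 1) - φ t|]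
  simp_rw [abs_sub_comm (φ ((_ : ℕ) : ZMod N)) _]
  refine Finset.sum_le_sum_of_subset_of_nonneg (fun i hi => ?_) fun _ _ _ => abs_nonneg _
  have := ZMod.val_lt b
  rw [Finset.mem_Ico] at hi
  exact Finset.mem_range.2 (by omega)

/-- The oscillation is at most the total variation around the circle; Cauchy–Schwarz with the
`w`-lengths as weights, whose sum is `w 1 - w 0`, gives the energy. -/
theorem sub_sq_le_energy1 {w : StieltjesFunction ℝ} (hw : StrictMono w) (φ : ZMod N → ℝ)
    (a b : ZMod N) : (φ a - φ b) ^ 2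
      ≤ (w 1 - w 0) * ∑ t, ((φ (t + 1) - φ t) / cellDW w N t) ^ 2 * cellDW w N t := by
  have h1 : (φ a - φ b) ^ 2 ≤ (∑ t, |φ (t + 1) - φ t|) ^ 2 := by
    rw [← sq_abs]
    gcongr
    exact abs_sub_le_sum_zmod φ a b
  refine h1.trans ?_
  rw [← sum_cellDW (N := N)]
  refine Finset.sum_sq_le_sum_mul_sum_of_sq_le_mul _ (fun t _ => (cellDW_pos hw t).le)
    (fun t _ => mul_nonneg (sq_nonneg _) (cellDW_pos hw t).le) fun t _ => le_of_eq ?_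
  have := (cellDW_pos (N := N) hw t).ne'
  rw [sq_abs]
  field_simp

/-- Exchanging `t` with the `k`-th coordinate of `z` is an involution of the pairs `(z, t)`; after
it `t` is a free parameter. -/
theorem sum_update_eq {ι α : Type*} [Fintype ι] [DecidableEq ι] [Fintype α] (k : ι)
    (F : (ι → α) → ℝ) : ∑ z : ι → α, ∑ t : α, F (Function.update z k t)
      = Fintype.card α * ∑ z, F z := by
  classical
  let σ : (ι → α) × α → (ι → α) × α := fun p => (Function.update p.1 k p.2, p.1 k)
  have hσ : Function.Involutive σ := fun p => by simp [σ]
  rw [← Fintype.sum_prod_type' (f := fun z t => F (Function.update z k t))]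
  have h1 := Equiv.sum_comp (hσ.toPerm σ) fun p : (ι → α) × α => F p.1
  change ∑ p : (ι → α) × α, F (Function.update p.1 k p.2) = _ at h1
  rw [h1, Fintype.sum_prod_type' (f := fun z _ => F z)]
  simp [Finset.mul_sum]

/-- The same exchange for all coordinates in `s` at once. -/
theorem sum_piecewise_eq {ι α : Type*} [Fintype ι] [DecidableEq ι] [Fintype α] (s : Finset ι)
    (F : (ι → α) → ℝ) : ∑ x : ι → α, ∑ y : ι → α, F (s.piecewise y x)
      = Fintype.card (ι → α) * ∑ z, F z := by
  classical
  let σ : (ι → α) × (ι → α) → (ι → α) × (ι → α) := fun p => (s.piecewise p.2 p.1, s.piecewise p.1 p.2)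
  have hσ : Function.Involutive σ := fun p => by
    refine Prod.ext (funext fun i => ?_) (funext fun i => ?_) <;>
      by_cases hi : i ∈ s <;> simp [σ, hi]
  rw [← Fintype.sum_prod_type' (f := fun x y => F (s.piecewise y x))]
  have h1 := Equiv.sum_comp (hσ.toPerm σ) fun p : (ι → α) × (ι → α) => F p.1
  change ∑ p : (ι → α) × (ι → α), F (s.piecewise p.2 p.1) = _ at h1
  rw [h1, Fintype.sum_prod_type' (f := fun z _ => F z)]
  simp only [Finset.sum_const, Finset.card_univ, nsmul_eq_mul, Finset.mul_sum]

theorem sub_update_sq_le (hW : ∀ k, StrictMono (W k)) (u : Mesh d N) (k : Fin d)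
    (z : Fin d → ZMod N) (s : ZMod N) : (u z - u (Function.update z k s)) ^ 2
      ≤ (W k 1 - W k 0) * ∑ t, meshDer W N k u (Function.update z k t) ^ 2
        * meshDW W N k (Function.update z k t) := by
  have h1 := sub_sq_le_energy1 (hW k) (fun t => u (Function.update z k t)) (z k) s
  rw [Function.update_eq_self] at h1
  refine h1.trans_eq ?_
  congr 1
  refine Finset.sum_congr rfl fun t _ => ?_
  have h2 : Function.update z k (t + 1) = Function.update z k t + Pi.single k 1 := by
    funext i
    by_cases hi : i = k
    · subst hi; simp
    · simp [hi]
  have h3 : meshDW W N k (Function.update z k t) = cellDW (W k) N t := by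
    simp [meshDW, cellDW]
  rw [meshDer, h3, h2]

/-- The total energy of a mesh function. -/
def meshEnergy (W : Fin d → StieltjesFunction ℝ) (N : ℕ+) (u : Mesh d N) : ℝ :=
  ∑ k, meshInnerW W N k (meshDer W N k u) (meshDer W N k u)

theorem meshEnergy_nonneg (W : Fin d → StieltjesFunction ℝ) (u : Mesh d N) :
    0 ≤ meshEnergy W N u :=
  Finset.sum_nonneg fun k _ => meshInnerW_self_nonneg W k _

/-- The point `x` is carried to `y` one coordinate at a time; each move is estimated by the
one-dimensional inequality on a line, and averaging over all lines rebuilds the energy in that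
direction. -/
theorem exists_sum_sub_piecewise_sq_le (hW : ∀ k, StrictMono (W k)) (s : Finset (Fin d)) :
    ∃ C : ℝ, 0 ≤ C ∧ ∀ (N : ℕ+) (u : Mesh d N),
      ∑ x : Fin d → ZMod N, ∑ y : Fin d → ZMod N, (u x - u (s.piecewise y x)) ^ 2
        ≤ C * (((N : ℕ) : ℝ) ^ d * (((N : ℕ) : ℝ) ^ d * meshEnergy W N u)) := by
  induction s using Finset.induction_on with
  | empty => exact ⟨0, le_rfl, fun N u => by simp⟩
  | insert k s hk ih =>
    obtain ⟨C, hC0, hC⟩ := ih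
    have hWk : 0 ≤ W k 1 - W k 0 := sub_nonneg.2 ((hW k).monotone zero_le_one)
    refine ⟨2 * C + 2 * (W k 1 - W k 0), by positivity, fun N u => ?_⟩
    set B : (Fin d → ZMod N) → ℝ := fun z => (W k 1 - W k 0) *
      ∑ t, meshDer W N k u (Function.update z k t) ^ 2 * meshDW W N k (Function.update z k t)
    have h1 : ∀ x y : Fin d → ZMod N, (u x - u ((insert k s).piecewise y x)) ^ 2
        ≤ 2 * (u x - u (s.piecewise y x)) ^ 2 + 2 * B (s.piecewise y x) := fun x y => by
      rw [Finset.piecewise_insert]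
      have h2 := sub_update_sq_le hW u k (s.piecewise y x) (y k)
      have h3 := sq_nonneg ((u x - u (s.piecewise y x))
        - (u (s.piecewise y x) - u (Function.update (s.piecewise y x) k (y k))))
      nlinarith
    have hd : d = d - 1 + 1 := by have := k.pos; omega
    have hN := pnat_pos N
    have h2 : ∑ z, B z ≤ (W k 1 - W k 0) * (((N : ℕ) : ℝ) ^ d * meshEnergy W N u) := by
      have h3 : ∑ z, B z = (W k 1 - W k 0) * ((N : ℕ) *
          ∑ z, meshDer W N k u z ^ 2 * meshDW W N k z) := by
        rw [← Finset.mul_sum, sum_update_eq k fun z => meshDer W N k u z ^ 2 * meshDW W N k z,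
          ZMod.card]
      have h4 : ∑ z, meshDer W N k u z ^ 2 * meshDW W N k z = ((N : ℕ) : ℝ) ^ (d - 1)
          * meshInnerW W N k (meshDer W N k u) (meshDer W N k u) := by
        rw [meshInnerW, ← mul_assoc, mul_inv_cancel₀ (pow_ne_zero _ hN.ne'), one_mul]
        exact Finset.sum_congr rfl fun z _ => by ring
      have h5 : meshInnerW W N k (meshDer W N k u) (meshDer W N k u) ≤ meshEnergy W N u :=
        Finset.single_le_sum (f := fun k => meshInnerW W N k (meshDer W N k u) (meshDer W N k u))
          (fun j _ => meshInnerW_self_nonneg W j _) (Finset.mem_univ k)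
      rw [h3, h4]
      have h6 : ((N : ℕ) : ℝ) ^ d = (N : ℕ) * ((N : ℕ) : ℝ) ^ (d - 1) := by
        conv_lhs => rw [hd, pow_succ]
        ring
      rw [h6, mul_assoc ((N : ℕ) : ℝ)]
      gcongr
    calc ∑ x : Fin d → ZMod N, ∑ y : Fin d → ZMod N, (u x - u ((insert k s).piecewise y x)) ^ 2
        ≤ ∑ x : Fin d → ZMod N, ∑ y : Fin d → ZMod N,
          (2 * (u x - u (s.piecewise y x)) ^ 2 + 2 * B (s.piecewise y x)) :=
          Finset.sum_le_sum fun x _ => Finset.sum_le_sum fun y _ => h1 x y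
      _ = 2 * ∑ x : Fin d → ZMod N, ∑ y : Fin d → ZMod N, (u x - u (s.piecewise y x)) ^ 2
          + 2 * ∑ x : Fin d → ZMod N, ∑ y : Fin d → ZMod N, B (s.piecewise y x) := by
          simp only [Finset.sum_add_distrib, Finset.mul_sum]
      _ ≤ 2 * (C * (((N : ℕ) : ℝ) ^ d * (((N : ℕ) : ℝ) ^ d * meshEnergy W N u)))
          + 2 * (((N : ℕ) : ℝ) ^ d *
            ((W k 1 - W k 0) * (((N : ℕ) : ℝ) ^ d * meshEnergy W N u))) := by
          rw [sum_piecewise_eq, Fintype.card_fun, ZMod.card, Fintype.card_fin, Nat.cast_pow]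
          gcongr
          exact hC N u
      _ = _ := by ring

/-- The Poincaré inequality on the discrete torus. -/
theorem exists_poincare (hW : ∀ k, StrictMono (W k)) :
    ∃ C : ℝ, 0 ≤ C ∧ ∀ (N : ℕ+) (u : Mesh d N), ∑ x, u x = 0 →
      meshInner N u u ≤ C * meshEnergy W N u := by
  obtain ⟨C, hC0, hC⟩ := exists_sum_sub_piecewise_sq_le hW Finset.univ
  refine ⟨C, hC0, fun N u hu => ?_⟩
  have h1 := hC N u
  simp only [Finset.piecewise_univ] at h1
  have hM : (0 : ℝ) < ((N : ℕ) : ℝ) ^ d := pow_pos (pnat_pos N) _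
  -- Zero mean removes the cross term, so the double sum of squared differences is a multiple of the
  -- squared norm.
  have h2 : ∑ x : Fin d → ZMod N, ∑ y : Fin d → ZMod N, (u x - u y) ^ 2
      = 2 * (((N : ℕ) : ℝ) ^ d * ∑ x, u x * u x) := by
    have h3 : ∀ x y : Fin d → ZMod N, (u x - u y) ^ 2 = u x * u x - 2 * u x * u y + u y * u y :=
      fun x y => by ring
    simp only [h3, Finset.sum_add_distrib, Finset.sum_sub_distrib, ← Finset.mul_sum, hu,
      Finset.sum_const, Finset.card_univ, Fintype.card_fun, ZMod.card, Fintype.card_fin,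
      nsmul_eq_mul, Nat.cast_pow, mul_zero, smul_zero]
    rw [sub_zero, two_mul]
    congr 1
    rw [Finset.mul_sum]
    exact Finset.sum_congr rfl fun x _ => by ring
  rw [h2] at h1
  have h4 : 0 ≤ ∑ x, u x * u x := Finset.sum_nonneg fun x _ => mul_self_nonneg _
  have h5 : ((N : ℕ) : ℝ) ^ d * ∑ x, u x * u x
      ≤ ((N : ℕ) : ℝ) ^ d * (C * (((N : ℕ) : ℝ) ^ d * meshEnergy W N u)) := by
    have : 0 ≤ ((N : ℕ) : ℝ) ^ d * ∑ x, u x * u x := by positivity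
    linarith
  have h6 := le_of_mul_le_mul_left h5 hM
  rw [meshInner, inv_mul_le_iff₀ hM]
  linarith

/-! ### The discrete elliptic form and its solvability -/

theorem meshDer_add (k : Fin d) (u v : Mesh d N) :
    meshDer W N k (u + v) = meshDer W N k u + meshDer W N k v := by
  funext x; simp only [meshDer, Pi.add_apply]; ring

theorem meshDer_smul (k : Fin d) (c : ℝ) (u : Mesh d N) :
    meshDer W N k (c • u) = c • meshDer W N k u := by
  funext x; simp only [meshDer, Pi.smul_apply, smul_eq_mul]; ring

theorem meshDer_one (k : Fin d) : meshDer W N k (fun _ => 1) = 0 := by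
  funext x; simp [meshDer]

theorem meshInner_comm (u v : Mesh d N) : meshInner N u v = meshInner N v u := by
  simp only [meshInner, mul_comm (u _)]

theorem meshInner_add_right (u v w : Mesh d N) :
    meshInner N u (v + w) = meshInner N u v + meshInner N u w := by
  simp only [meshInner, Pi.add_apply, mul_add, Finset.sum_add_distrib]

theorem meshInner_smul_right (c : ℝ) (u v : Mesh d N) :
    meshInner N u (c • v) = c * meshInner N u v := by
  simp only [meshInner, Pi.smul_apply, smul_eq_mul, Finset.mul_sum]
  exact Finset.sum_congr rfl fun x _ => by ring

theorem meshInnerW_add_right (k : Fin d) (u v w : Mesh d N) :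
    meshInnerW W N k u (v + w) = meshInnerW W N k u v + meshInnerW W N k u w := by
  simp only [meshInnerW, Pi.add_apply, mul_add, add_mul, Finset.sum_add_distrib]

theorem meshInnerW_smul_right (k : Fin d) (c : ℝ) (u v : Mesh d N) :
    meshInnerW W N k u (c • v) = c * meshInnerW W N k u v := by
  simp only [meshInnerW, Pi.smul_apply, smul_eq_mul, Finset.mul_sum]
  exact Finset.sum_congr rfl fun x _ => by ring

theorem meshInnerW_mul_comm (k : Fin d) (a u v : Mesh d N) :
    meshInnerW W N k (a * u) v = meshInnerW W N k (a * v) u := by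
  simp only [meshInnerW, Pi.mul_apply]
  congr 1
  exact Finset.sum_congr rfl fun x _ => by ring

/-- The bilinear form of the discrete elliptic problem. -/
def meshForm (W : Fin d → StieltjesFunction ℝ) (N : ℕ+) (lam : ℝ) (a : Fin d → Mesh d N)
    (u v : Mesh d N) : ℝ :=
  lam * meshInner N u v + ∑ k, meshInnerW W N k (a k * meshDer W N k u) (meshDer W N k v)

theorem meshForm_comm (lam : ℝ) (a : Fin d → Mesh d N) (u v : Mesh d N) :
    meshForm W N lam a u v = meshForm W N lam a v u := by
  rw [meshForm, meshForm, meshInner_comm]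
  congr 1
  exact Finset.sum_congr rfl fun k _ => meshInnerW_mul_comm k _ _ _

theorem meshForm_add_right (lam : ℝ) (a : Fin d → Mesh d N) (u v w : Mesh d N) :
    meshForm W N lam a u (v + w) = meshForm W N lam a u v + meshForm W N lam a u w := by
  simp only [meshForm, meshInner_add_right, meshDer_add, meshInnerW_add_right,
    Finset.sum_add_distrib]
  ring

theorem meshForm_smul_right (lam : ℝ) (a : Fin d → Mesh d N) (c : ℝ) (u v : Mesh d N) :
    meshForm W N lam a u (c • v) = c * meshForm W N lam a u v := by
  simp only [meshForm, meshInner_smul_right, meshDer_smul, meshInnerW_smul_right, mul_add,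
    Finset.mul_sum]
  ring

theorem meshForm_one_right (lam : ℝ) (a : Fin d → Mesh d N) (u : Mesh d N) :
    meshForm W N lam a u (fun _ => 1) = lam * meshInner N u fun _ => 1 := by
  have : ∀ k, meshInnerW W N k (a k * meshDer W N k u) (0 : Mesh d N) = 0 := fun k => by
    simp [meshInnerW]
  simp [meshForm, meshDer_one, this]

theorem meshInner_self_eq_zero {u : Mesh d N} (h : meshInner N u u ≤ 0) : u = 0 := by
  have hM : (0 : ℝ) < ((N : ℕ) : ℝ) ^ d := pow_pos (pnat_pos N) _
  have h1 : ∑ x, u x * u x ≤ 0 := by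
    rw [meshInner, inv_mul_le_iff₀ hM, mul_zero] at h
    exact h
  have h2 := (Finset.sum_eq_zero_iff_of_nonneg fun x _ => mul_self_nonneg (u x)).1
    (le_antisymm h1 (Finset.sum_nonneg fun x _ => mul_self_nonneg (u x)))
  funext x
  exact mul_self_eq_zero.1 (h2 x (Finset.mem_univ x))

theorem meshForm_self_ge (hW : ∀ k, StrictMono (W k)) {lam : ℝ} {a : Fin d → Mesh d N} {c : ℝ}
    (ha : ∀ k x, c ≤ a k x) (u : Mesh d N) :
    lam * meshInner N u u + c * meshEnergy W N u ≤ meshForm W N lam a u u := by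
  rw [meshForm, meshEnergy, Finset.mul_sum]
  gcongr with k _
  simp only [meshInnerW, Pi.mul_apply]
  rw [mul_left_comm, Finset.mul_sum]
  refine mul_le_mul_of_nonneg_left (Finset.sum_le_sum fun x _ => ?_) (by positivity)
  have h1 : 0 < meshDW W N k x := cellDW_pos (hW k) (x k)
  have h2 := mul_nonneg (mul_self_nonneg (meshDer W N k u x)) h1.le
  have h3 := mul_le_mul_of_nonneg_right (ha k x) h2
  linarith

/-- The form defines an injective map from a finite-dimensional space to its dual, hence a bijective
one. For `lam = 0` a rank one term penalizing the mean removes the kernel. -/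
theorem existsUnique_isMeshSolution (hW : ∀ k, StrictMono (W k)) {lam : ℝ} (hlam : 0 ≤ lam)
    {a : Fin d → Mesh d N} {c : ℝ} (hc : 0 < c) (ha : ∀ k x, c ≤ a k x)
    (f : Mesh d N →ₗ[ℝ] ℝ) (hf : lam = 0 → f (fun _ => 1) = 0) :
    ∃! u, IsMeshSolution W N lam a f u := by
  -- Weight of the penalty `(∑ u)(∑ v)`, present only for `lam = 0`.
  set m : ℝ := if lam = 0 then 1 else 0 with hm
  have hm0 : 0 ≤ m := by rw [hm]; split_ifs <;> norm_num
  let L : Mesh d N →ₗ[ℝ] Module.Dual ℝ (Mesh d N) := LinearMap.mk₂ ℝ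
    (fun u v => meshForm W N lam a u v + m * ((∑ x, u x) * ∑ x, v x))
    (fun u v w => by
      simp only [meshForm_comm _ _ _ w, meshForm_add_right, Pi.add_apply, Finset.sum_add_distrib]
      ring)
    (fun r u v => by
      simp only [meshForm_comm _ _ _ v, meshForm_smul_right, Pi.smul_apply, smul_eq_mul,
        ← Finset.mul_sum]
      ring)
    (fun u v w => by
      simp only [meshForm_add_right, Pi.add_apply, Finset.sum_add_distrib]
      ring)
    (fun r u v => by
      simp only [meshForm_smul_right, Pi.smul_apply, smul_eq_mul, ← Finset.mul_sum]
      ring)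
  have hL : ∀ u v, L u v = meshForm W N lam a u v + m * ((∑ x, u x) * ∑ x, v x) :=
    fun _ _ => rfl
  obtain ⟨C, hC0, hC⟩ := exists_poincare hW
  have hinj : Function.Injective L := by
    rw [← LinearMap.ker_eq_bot, LinearMap.ker_eq_bot']
    intro u hu
    have h1 : meshForm W N lam a u u + m * ((∑ x, u x) * ∑ x, u x) = 0 := by
      rw [← hL, hu]; rfl
    have h2 := meshForm_self_ge hW (lam := lam) ha u
    have h3 := mul_nonneg hm0 (mul_self_nonneg (∑ x, u x))
    have h4 := meshEnergy_nonneg W u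
    have h5 : 0 ≤ meshInner N u u := by
      rw [← integral_pcInterp_mul_torusVol]
      exact integral_nonneg fun y => mul_self_nonneg _
    have h6 := mul_nonneg hlam h5
    have h7 := mul_nonneg hc.le h4
    rcases eq_or_lt_of_le hlam with h0 | h0
    · have hm1 : m = 1 := by rw [hm, if_pos h0.symm]
      have h8 : ∑ x, u x = 0 := by
        rw [hm1] at h1 h3
        exact mul_self_eq_zero.1 (by linarith)
      have h9 : meshEnergy W N u = 0 := by
        have : c * meshEnergy W N u = 0 := by linarith
        exact (mul_eq_zero.1 this).resolve_left hc.ne'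
      have h10 := hC N u h8
      rw [h9, mul_zero] at h10
      exact meshInner_self_eq_zero h10
    · have h8 : lam * meshInner N u u = 0 := by linarith
      exact meshInner_self_eq_zero ((mul_eq_zero.1 h8).resolve_left h0.ne').le
  have hsurj : Function.Surjective L :=
    (LinearMap.injective_iff_surjective_of_finrank_eq_finrank
      (Subspace.dual_finrank_eq (K := ℝ) (V := Mesh d N)).symm).1 hinj
  have hM : (0 : ℝ) < ((N : ℕ) : ℝ) ^ d := pow_pos (pnat_pos N) _
  have hiff : ∀ u, IsMeshSolution W N lam a f u ↔ L u = f := fun u => by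
    constructor
    · rintro ⟨h1, h2⟩
      refine LinearMap.ext fun v => ?_
      rw [hL, ← h1 v]
      by_cases h0 : lam = 0
      · rw [h2 h0]; simp [meshForm]
      · rw [hm, if_neg h0]; simp [meshForm]
    · intro h
      -- Testing with the constant `1` isolates the penalty: the form and `f` both vanish there, so
      -- the mean of `u` is zero and the penalized equation is the original one.
      have hsum : lam = 0 → ∑ x, u x = 0 := fun h0 => by
        have h1 : L u (fun _ => 1) = f fun _ => 1 := by rw [h]
        rw [hL, hf h0, meshForm_one_right, h0, hm, if_pos h0] at h1
        have h2 : ∑ _x : Fin d → ZMod N, (1 : ℝ) ≠ 0 := by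
          simp
        rw [zero_mul, zero_add, one_mul] at h1
        exact (mul_eq_zero.1 h1).resolve_right h2
      refine ⟨fun v => ?_, hsum⟩
      rw [← h, hL]
      by_cases h0 : lam = 0
      · rw [hsum h0]; simp [meshForm]
      · rw [hm, if_neg h0]; simp [meshForm]
  obtain ⟨u, hu⟩ := hsurj f
  exact ⟨u, (hiff u).2 hu, fun v hv => hinj (((hiff v).1 hv).trans hu.symm)⟩

end

/-! ### Convergence of cell averages -/

noncomputable section

variable {d : ℕ} {W : Fin d → StieltjesFunction ℝ}

/-- The average of `g` over the mesh cell of `y`. -/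
def cellAvg (μ : Measure ℝ) (g : ℝ → ℝ) (N : ℕ+) (y : ℝ) : ℝ :=
  ∑ x : ZMod N, cellInd N x y * ((μ.real (cell1 N x))⁻¹ * ∫ t in cell1 N x, g t ∂μ)

theorem cellAvg_of_mem (μ : Measure ℝ) (g : ℝ → ℝ) {N : ℕ+} {x : ZMod N} {y : ℝ}
    (hy : y ∈ cell1 N x) : cellAvg μ g N y = (μ.real (cell1 N x))⁻¹ * ∫ t in cell1 N x, g t ∂μ := by
  simp [cellAvg, cellInd_of_mem hy]

theorem abs_sub_le_of_mem_cell1 {N : ℕ+} {x : ZMod N} {y t : ℝ} (hy : y ∈ cell1 N x)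
    (ht : t ∈ cell1 N x) : |t - y| ≤ ((N : ℕ) : ℝ)⁻¹ := by
  have h : ((x.val : ℝ) + 1) / (N : ℕ) = (x.val : ℝ) / (N : ℕ) + ((N : ℕ) : ℝ)⁻¹ := by
    rw [add_div, one_div]
  obtain ⟨h1, h2⟩ := hy
  obtain ⟨h3, h4⟩ := ht
  rw [h] at h2 h4
  rw [abs_le]
  constructor <;> linarith

theorem tendsto_pnat_inv : Tendsto (fun N : ℕ+ => ((N : ℕ) : ℝ)⁻¹) atTop (𝓝 0) :=
  tendsto_comp_val_Ioi_atTop.2 (tendsto_inv_atTop_zero.comp tendsto_natCast_atTop_atTop)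

/-- Cell averages of a function converge at its points of continuity. -/
theorem tendsto_cellAvg_of_continuousWithinAt {μ : Measure ℝ} [IsFiniteMeasure μ]
    (hμ : ∀ (N : ℕ+) (x : ZMod N), 0 < μ.real (cell1 N x)) {g : ℝ → ℝ} (hg : IsBddMeas g) {y : ℝ}
    (hy : y ∈ Ioc (0 : ℝ) 1) (hc : ContinuousWithinAt g (Ioc 0 1) y) :
    Tendsto (fun N => cellAvg μ g N y) atTop (𝓝 (g y)) := by
  rw [Metric.tendsto_nhds]
  intro ε hε
  obtain ⟨δ, hδ, h⟩ := Metric.continuousWithinAt_iff.1 hc (ε / 2) (half_pos hε)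
  filter_upwards [tendsto_pnat_inv.eventually_lt_const hδ] with N hN
  obtain ⟨x, hx⟩ := exists_mem_cell1 N hy
  have hp := hμ N x
  have h1 : ‖∫ t in cell1 N x, (g t - g y) ∂μ‖ ≤ ε / 2 * μ.real (cell1 N x) :=
    norm_setIntegral_le_of_norm_le_const (measure_lt_top _ _) fun t ht =>
      (h (cell1_subset x ht) (lt_of_le_of_lt (abs_sub_le_of_mem_cell1 hx ht) hN)).le
  rw [integral_sub (hg.integrable _) (integrable_const _), setIntegral_const, smul_eq_mul] at h1
  rw [cellAvg_of_mem μ g hx, Real.dist_eq]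
  have h2 : (μ.real (cell1 N x))⁻¹ * ∫ t in cell1 N x, g t ∂μ = (μ.real (cell1 N x))⁻¹ *
      (∫ t in cell1 N x, g t ∂μ - μ.real (cell1 N x) * g y) + g y := by
    field_simp
    ring
  rw [h2, add_sub_cancel_right, abs_mul, abs_of_pos (inv_pos.2 hp), inv_mul_lt_iff₀ hp]
  rw [Real.norm_eq_abs] at h1
  nlinarith

/-- Cell averages converge at atoms. -/
theorem tendsto_cellAvg_of_atom {μ : Measure ℝ} [IsFiniteMeasure μ] {g : ℝ → ℝ}
    (hg : IsBddMeas g) {y : ℝ} (hy : y ∈ Ioc (0 : ℝ) 1) (hp : 0 < μ.real {y}) :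
    Tendsto (fun N => cellAvg μ g N y) atTop (𝓝 (g y)) := by
  choose x hx using fun N => exists_mem_cell1 N hy
  have hg' : IsBddMeas fun t => g t - g y := by
    simpa [sub_eq_add_neg] using hg.add (IsBddMeas.const (-(g y)))
  obtain ⟨C, hC⟩ := hg'.2
  -- The cells shrink to `{y}`, where the integrand is zero, so dominated convergence applies.
  -- Dividing by the mass of the cell is harmless, as that mass is at least the atom at `y`.
  have h1 : Tendsto (fun N => ∫ t in cell1 N (x N), (g t - g y) ∂μ) atTop (𝓝 0) := by
    have : Tendsto (fun N => ∫ t, (cell1 N (x N)).indicator (fun t => g t - g y) t ∂μ) atTop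
        (𝓝 (∫ _, (0 : ℝ) ∂μ)) := by
      refine tendsto_integral_filter_of_dominated_convergence (fun _ => C)
        (Eventually.of_forall fun N =>
          (hg'.1.indicator (measurableSet_cell1 _)).aestronglyMeasurable)
        (Eventually.of_forall fun N => Eventually.of_forall fun t =>
          (norm_indicator_le_norm_self _ t).trans (hC t)) (integrable_const C)
        (Eventually.of_forall fun t => ?_)
      by_cases hty : t = y
      · subst hty
        refine tendsto_const_nhds.congr fun N => ?_
        rw [indicator_of_mem (hx N), sub_self]
      · refine tendsto_const_nhds.congr' ?_
        filter_upwards [tendsto_pnat_inv.eventually_lt_const (abs_pos.2 (sub_ne_zero.2 hty))] with N hN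
        exact (indicator_of_notMem
          (fun ht => (abs_sub_le_of_mem_cell1 (hx N) ht).not_gt hN) _).symm
    simpa [integral_indicator (measurableSet_cell1 _)] using this
  rw [← tendsto_sub_nhds_zero_iff]
  refine squeeze_zero_norm (fun N => ?_) (by simpa using (h1.norm.const_mul (μ.real {y})⁻¹))
  have h2 : μ.real {y} ≤ μ.real (cell1 N (x N)) :=
    measureReal_mono (singleton_subset_iff.2 (hx N))
  have h3 : 0 < μ.real (cell1 N (x N)) := hp.trans_le h2
  have h4 : cellAvg μ g N y - g y = (μ.real (cell1 N (x N)))⁻¹ *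
      ∫ t in cell1 N (x N), (g t - g y) ∂μ := by
    rw [cellAvg_of_mem μ g (hx N), integral_sub (hg.integrable _) (integrable_const _),
      setIntegral_const, smul_eq_mul]
    field_simp
  rw [h4, norm_mul, Real.norm_of_nonneg (inv_nonneg.2 h3.le), Real.norm_eq_abs]
  gcongr

theorem unitW_singleton_pos {w : StieltjesFunction ℝ} {y : ℝ} (hy : y ∈ Ioc (0 : ℝ) 1)
    (hc : ¬ ContinuousAt w y) : 0 < (unitW w).real {y} := by
  rw [measureReal_def, Measure.restrict_apply (measurableSet_singleton y),
    inter_eq_left.2 (singleton_subset_iff.2 hy), w.measure_singleton]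
  have h1 : Function.leftLim w y ≠ w y := fun h => hc <| by
    rw [w.mono.continuousAt_iff_leftLim_eq_rightLim, w.rightLim_eq, h]
  have h2 := lt_of_le_of_ne (w.mono.leftLim_le le_rfl) h1
  rw [ENNReal.toReal_ofReal] <;> linarith

theorem ae_continuousAt_unitVol (w : StieltjesFunction ℝ) : ∀ᵐ y ∂unitVol, ContinuousAt w y :=
  ae_restrict_of_ae (by
    simpa using w.mono.countable_not_continuousAt.ae_notMem volume)

/-- The monotone function `w` has countably many discontinuities, which gives measurability.
One-sided limits give local boundedness, then compactness of `[0, 1]` and periodicity give a global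
bound. -/
theorem isBddMeas_of_mem_CW1 {w : StieltjesFunction ℝ} {f : ℝ → ℝ} (hf : f ∈ CW1 w) :
    IsBddMeas f := by
  obtain ⟨hper, hr, hl, hc⟩ := hf
  refine ⟨(StronglyMeasurable.of_countable_not_continuousAt
    (w.mono.countable_not_continuousAt.mono fun x hx h => hx (hc x h))).measurable, ?_⟩
  have h1 : ∃ C, ∀ x ∈ Icc (0 : ℝ) 1, |f x| ≤ C := by
    refine isCompact_Icc.induction_on (p := fun s => ∃ C, ∀ x ∈ s, |f x| ≤ C) ⟨0, by simp⟩
      (fun s t hst ⟨C, hC⟩ => ⟨C, fun x hx => hC x (hst hx)⟩)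
      (fun s t ⟨C, hC⟩ ⟨D, hD⟩ => ⟨max C D, fun x hx => ?_⟩) fun x _ => ?_
    · rcases hx with hx | hx
      · exact (hC x hx).trans (le_max_left _ _)
      · exact (hD x hx).trans (le_max_right _ _)
    · obtain ⟨l, hl⟩ := hl x
      have e1 := hl.abs.eventually_lt_const (lt_add_one |l|)
      have e2 := (hr x).tendsto.abs.eventually_lt_const (lt_add_one |f x|)
      have e3 : ∀ᶠ y in 𝓝 x, |f y| ≤ max (|l| + 1) (|f x| + 1) := by
        rw [← nhdsLT_sup_nhdsGE, eventually_sup]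
        exact ⟨e1.mono fun y hy => hy.le.trans (le_max_left _ _),
          e2.mono fun y hy => hy.le.trans (le_max_right _ _)⟩
      exact ⟨_, mem_nhdsWithin_of_mem_nhds e3, _, fun y hy => hy⟩
  obtain ⟨C, hC⟩ := h1
  refine ⟨C, fun x => ?_⟩
  have h2 : f x = f (Int.fract x) := by
    have := hper.sub_zsmul_eq (x := x) ⌊x⌋
    rw [← this, zsmul_eq_mul, mul_one]; rfl
  rw [h2]
  exact hC _ ⟨Int.fract_nonneg x, (Int.fract_lt_one x).le⟩

/-- Every point of `(0, 1]` is either a continuity point of `w`, hence of `f`, or an atom of `dw`.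
-/
theorem tendsto_cellAvg_unitW {w : StieltjesFunction ℝ} (hw : StrictMono w) {f : ℝ → ℝ}
    (hf : f ∈ CW1 w) : ∀ᵐ y ∂unitW w, Tendsto (fun N => cellAvg (unitW w) f N y) atTop (𝓝 (f y)) := by
  filter_upwards [ae_restrict_mem measurableSet_Ioc] with y hy
  by_cases hc : ContinuousAt w y
  · exact tendsto_cellAvg_of_continuousWithinAt (fun N x => by
      rw [unitW_real_cell1]; exact cellDW_pos hw x) (isBddMeas_of_mem_CW1 hf) hy
      (hf.2.2.2 y hc).continuousWithinAt
  · exact tendsto_cellAvg_of_atom (isBddMeas_of_mem_CW1 hf) hy (unitW_singleton_pos hy hc)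

/-- Discontinuities of `f` are among those of `w`, a countable set and so Lebesgue-null. -/
theorem tendsto_cellAvg_unitVol {w : StieltjesFunction ℝ} {f : ℝ → ℝ} (hf : f ∈ CW1 w) :
    ∀ᵐ y ∂unitVol, Tendsto (fun N => cellAvg unitVol f N y) atTop (𝓝 (f y)) := by
  filter_upwards [ae_restrict_mem measurableSet_Ioc, ae_continuousAt_unitVol w] with y hy hc
  exact tendsto_cellAvg_of_continuousWithinAt (fun N x => by
    rw [unitVol_real_cell1]; exact inv_pos.2 (pnat_pos N)) (isBddMeas_of_mem_CW1 hf) hy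
    (hf.2.2.2 y hc).continuousWithinAt

theorem meshCell_eq_pi {N : ℕ+} (x : Fin d → ZMod N) :
    meshCell N x = Set.pi univ fun i => cell1 N (x i) := by
  ext y; simp [meshCell, cell1]

theorem measurableSet_meshCell {N : ℕ+} (x : Fin d → ZMod N) : MeasurableSet (meshCell N x) := by
  rw [meshCell_eq_pi]
  exact MeasurableSet.univ_pi fun i => measurableSet_cell1 _

theorem mixedVol_real_meshCell (k : Fin d) {N : ℕ+} (x : Fin d → ZMod N) :
    (mixedVol W k).real (meshCell N x) = (((N : ℕ) : ℝ) ^ (d - 1))⁻¹ * meshDW W N k x := by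
  rw [← prod_real_cell1_mixedVol, meshCell_eq_pi, measureReal_def, mixedVol, Measure.pi_pi,
    ENNReal.toReal_prod]
  rfl

theorem cellAverage_eq (a : Fin d → (Fin d → ℝ) → ℝ) (N : ℕ+) (k : Fin d) (x : Fin d → ZMod N) :
    cellAverage W a N k x
      = ((mixedVol W k).real (meshCell N x))⁻¹ * ∫ y in meshCell N x, a k y ∂mixedVol W k := by
  rw [mixedVol_real_meshCell, mul_inv, inv_inv, cellAverage, div_eq_mul_inv]

theorem mixedVol_real_meshCell_pos (hW : ∀ k, StrictMono (W k)) (k : Fin d) {N : ℕ+}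
    (x : Fin d → ZMod N) : 0 < (mixedVol W k).real (meshCell N x) := by
  rw [mixedVol_real_meshCell]
  exact mul_pos (inv_pos.2 (pow_pos (pnat_pos N) _)) (cellDW_pos (hW k) (x k))

theorem le_cellAverage (hW : ∀ k, StrictMono (W k)) {a : Fin d → (Fin d → ℝ) → ℝ} {k : Fin d}
    (ha : IsBddMeas (a k)) {c : ℝ} (hc : ∀ y, c ≤ a k y) (N : ℕ+) (x : Fin d → ZMod N) :
    c ≤ cellAverage W a N k x := by
  have hp := mixedVol_real_meshCell_pos hW k x
  rw [cellAverage_eq, inv_mul_eq_div, le_div_iff₀ hp]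
  exact setIntegral_ge_of_const_le_real (measurableSet_meshCell x) (measure_ne_top _ _)
    (fun y _ => hc y) (ha.integrable _).integrableOn

theorem abs_cellAverage_le (hW : ∀ k, StrictMono (W k)) {a : Fin d → (Fin d → ℝ) → ℝ} {k : Fin d}
    {C : ℝ} (hC : ∀ y, |a k y| ≤ C) (N : ℕ+) (x : Fin d → ZMod N) :
    |cellAverage W a N k x| ≤ C := by
  have hp := mixedVol_real_meshCell_pos hW k x
  rw [cellAverage_eq, abs_mul, abs_of_pos (inv_pos.2 hp), inv_mul_le_iff₀ hp, mul_comm]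
  exact norm_setIntegral_le_of_norm_le_const (f := a k) (measure_lt_top _ _) fun y _ => hC y

/-- Cells are boxes and the measure is a product, so averages factor; convergence then reduces to
one variable at a time. -/
theorem cellAverage_prod (g : Fin d → ℝ → ℝ) (N : ℕ+) (k : Fin d) (x : Fin d → ZMod N) :
    cellAverage W (fun _ y => ∏ j, g j (y j)) N k x = ∏ j, ((mixedFactor W k j).real (cell1 N (x j)))⁻¹ *
      ∫ t in cell1 N (x j), g j t ∂mixedFactor W k j := by
  rw [cellAverage_eq, mixedVol_real_meshCell, ← prod_real_cell1_mixedVol, Finset.prod_mul_distrib,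
    Finset.prod_inv_distrib]
  congr 1
  simp only [← integral_indicator (measurableSet_meshCell x),
    ← integral_indicator (measurableSet_cell1 _)]
  rw [← integral_fintype_prod_eq_prod, mixedVol]
  congr 1
  funext y
  by_cases hy : y ∈ meshCell N x
  · rw [indicator_of_mem hy]
    exact Finset.prod_congr rfl fun j _ => (indicator_of_mem (show y j ∈ cell1 N (x j) from hy j) _).symm
  · rw [indicator_of_notMem hy]
    have : ∃ j, y j ∉ cell1 N (x j) := by
      by_contra! h
      exact hy h
    obtain ⟨j, hj⟩ := this
    exact (Finset.prod_eq_zero (Finset.mem_univ j) (indicator_of_notMem hj _)).symm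

/-- The functions in `C_W(𝕋^d)` are limits of their cell averages. -/
theorem tendsto_pcInterp_cellAverage (hW : ∀ k, StrictMono (W k)) (k : Fin d)
    {b : (Fin d → ℝ) → ℝ} (hb : b ∈ CW W) : IsBddMeas b ∧ ∀ᵐ y ∂mixedVol W k,
      Tendsto (fun N => pcInterp N (cellAverage W (fun _ => b) N k) y) atTop (𝓝 (b y)) := by
  have key : ∀ {f g : (Fin d → ℝ) → ℝ} (c : ℝ), IsBddMeas f → IsBddMeas g → ∀ N x,
      cellAverage W (fun _ y => f y + c * g y) N k x
        = cellAverage W (fun _ => f) N k x + c * cellAverage W (fun _ => g) N k x :=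
    fun {f g} c hf hg N x => by
      simp only [cellAverage]
      rw [integral_add (hf.integrable _) ((hg.integrable _).const_mul c), integral_const_mul]
      ring
  have key2 : ∀ {f g : (Fin d → ℝ) → ℝ} (c : ℝ), IsBddMeas f → IsBddMeas g →
      (∀ᵐ y ∂mixedVol W k,
        Tendsto (fun N => pcInterp N (cellAverage W (fun _ => f) N k) y) atTop (𝓝 (f y))) →
      (∀ᵐ y ∂mixedVol W k,
        Tendsto (fun N => pcInterp N (cellAverage W (fun _ => g) N k) y) atTop (𝓝 (g y))) →
      ∀ᵐ y ∂mixedVol W k, Tendsto (fun N => pcInterp N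
        (cellAverage W (fun _ y => f y + c * g y) N k) y) atTop (𝓝 (f y + c * g y)) := by
    intro f g c hf hg h1 h2
    filter_upwards [h1, h2, ae_mem_Ioc_mixedVol W k] with y h1 h2 hy
    refine (h1.add (h2.const_mul c)).congr fun N => ?_
    obtain ⟨x, hx⟩ := exists_mem_meshCell N hy
    simp only [pcInterp_of_mem hx]
    exact (key c hf hg N x).symm
  have hzero : ∀ᵐ y ∂mixedVol W k, Tendsto (fun N => pcInterp N
      (cellAverage W (fun _ _ => (0 : ℝ)) N k) y) atTop (𝓝 0) :=
    Eventually.of_forall fun y => by simp [cellAverage, pcInterp]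
  induction hb using Submodule.span_induction with
  | mem b hb =>
    obtain ⟨g, hg, rfl⟩ := hb
    refine ⟨IsBddMeas.prod fun j _ => (isBddMeas_of_mem_CW1 (hg j)).coord j, ?_⟩
    have h1 : ∀ j, ∀ᵐ y ∂mixedVol W k,
        Tendsto (fun N => cellAvg (mixedFactor W k j) (g j) N (y j)) atTop (𝓝 (g j (y j))) :=
      fun j => by
        refine (Measure.quasiMeasurePreserving_eval (μ := mixedFactor W k) j).ae
          (p := fun t => Tendsto (fun N => cellAvg (mixedFactor W k j) (g j) N t) atTop
            (𝓝 (g j t))) ?_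
        by_cases hj : j = k
        · subst hj
          rw [mixedFactor_self]
          exact tendsto_cellAvg_unitW (hW j) (hg j)
        · rw [mixedFactor_of_ne W hj]
          exact tendsto_cellAvg_unitVol (hg j)
    filter_upwards [ae_all_iff.2 h1, ae_mem_Ioc_mixedVol W k] with y h2 hy
    refine (tendsto_finsetProd _ fun j _ => h2 j).congr fun N => ?_
    obtain ⟨x, hx⟩ := exists_mem_meshCell N hy
    rw [pcInterp_of_mem hx, cellAverage_prod]
    exact Finset.prod_congr rfl fun j _ => cellAvg_of_mem _ _ (hx j)
  | zero => exact ⟨IsBddMeas.const 0, hzero⟩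
  | add f g _ _ hf hg =>
    have := key2 1 hf.1 hg.1 hf.2 hg.2
    simp only [one_mul] at this
    exact ⟨hf.1.add hg.1, this⟩
  | smul c f _ hf =>
    have := key2 c (IsBddMeas.const 0) hf.1 hzero hf.2
    simp only [zero_add] at this
    exact ⟨(IsBddMeas.const c).mul hf.1, this⟩

theorem eLpNorm_two_eq {α : Type*} [MeasurableSpace α] {μ : Measure α} {f : α → ℝ}
    (hf : MemLp f 2 μ) : eLpNorm f 2 μ = ENNReal.ofReal √(∫ x, f x ^ 2 ∂μ) := by
  rw [hf.eLpNorm_eq_integral_rpow_norm (by norm_num) (by norm_num), Real.sqrt_eq_rpow]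
  simp

/-- Bounded almost everywhere convergence implies convergence in `L²`. -/
theorem strongConvL2_of_bdd {μ : Measure (Fin d → ℝ)} [IsFiniteMeasure μ]
    {v : ℕ+ → (Fin d → ℝ) → ℝ} {u : (Fin d → ℝ) → ℝ} (hv : ∀ N, AEStronglyMeasurable (v N) μ)
    {C : ℝ} (hC : ∀ N, ∀ᵐ y ∂μ, |v N y| ≤ C)
    (hlim : ∀ᵐ y ∂μ, Tendsto (fun N => v N y) atTop (𝓝 (u y))) : StrongConvL2 μ v u := by
  have hu : AEStronglyMeasurable u μ := aestronglyMeasurable_of_tendsto_ae atTop hv hlim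
  have huC : ∀ᵐ y ∂μ, |u y| ≤ C := by
    filter_upwards [ae_all_iff.2 hC, hlim] with y h1 h2
    exact le_of_tendsto h2.abs (Eventually.of_forall h1)
  have hvL : ∀ N, MemLp (v N) 2 μ := fun N => MemLp.of_bound (hv N) C (hC N)
  have huL : MemLp u 2 μ := MemLp.of_bound hu C huC
  refine ⟨hvL, huL, ?_⟩
  have h1 : Tendsto (fun N => ∫ y, (v N y - u y) ^ 2 ∂μ) atTop (𝓝 (∫ _, (0 : ℝ) ∂μ)) := by
    refine tendsto_integral_filter_of_dominated_convergence (fun _ => (2 * C) ^ 2)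
      (Eventually.of_forall fun N => ((hv N).sub hu).pow 2) (Eventually.of_forall fun N => ?_)
      (integrable_const _) ?_
    · filter_upwards [hC N, huC] with y h1 h2
      rw [norm_pow, Real.norm_eq_abs]
      have := abs_sub (v N y) (u y)
      gcongr
      linarith
    · filter_upwards [hlim] with y hy
      simpa using (hy.sub_const (u y)).pow 2
  have h2 : ∀ N, eLpNorm (fun y => v N y - u y) 2 μ
      = ENNReal.ofReal √(∫ y, (v N y - u y) ^ 2 ∂μ) := fun N =>
    eLpNorm_two_eq ((hvL N).sub huL)
  simp only [h2]
  have h3 := ENNReal.tendsto_ofReal (h1.sqrt)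
  simpa using h3

theorem StrongConvL2.tendsto_toLp {μ : Measure (Fin d → ℝ)} {v : ℕ+ → (Fin d → ℝ) → ℝ}
    {u : (Fin d → ℝ) → ℝ} (h : StrongConvL2 μ v u) :
    Tendsto (fun N => (h.1 N).toLp (v N)) atTop (𝓝 (h.2.1.toLp u)) :=
  (Lp.tendsto_Lp_iff_tendsto_eLpNorm'' v h.1 u h.2.1).2 h.2.2

end

/-! ### Restriction of test functions to the mesh -/

noncomputable section

variable {d : ℕ} {W : Fin d → StieltjesFunction ℝ}

theorem setIntegral_Ioc_sub {μ : Measure ℝ} {h : ℝ → ℝ} {s t : ℝ} (hs : 0 ≤ s) (hst : s ≤ t)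
    (hh : IntegrableOn h (Ioc 0 t) μ) :
    ∫ y in Ioc 0 t, h y ∂μ - ∫ y in Ioc 0 s, h y ∂μ = ∫ y in Ioc s t, h y ∂μ := by
  have h1 : Ioc 0 t = Ioc 0 s ∪ Ioc s t := (Ioc_union_Ioc_eq_Ioc hs hst).symm
  have h2 : Disjoint (Ioc 0 s) (Ioc s t) := Ioc_disjoint_Ioc_of_le le_rfl
  rw [h1] at hh ⊢
  rw [setIntegral_union h2 measurableSet_Ioc (hh.mono_set subset_union_left)
    (hh.mono_set subset_union_right), add_sub_cancel_left]

theorem IsBddMeas.integrableOn_Ioc {h : ℝ → ℝ} (hh : IsBddMeas h) (w : StieltjesFunction ℝ)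
    (s t : ℝ) : IntegrableOn h (Ioc s t) w.measure := by
  have : IsFiniteMeasure (w.measure.restrict (Ioc s t)) := ⟨by
    rw [Measure.restrict_apply_univ, StieltjesFunction.measure_Ioc]; exact ENNReal.ofReal_lt_top⟩
  exact hh.integrable _

theorem WEigenfunction.toFun_sub {w : StieltjesFunction ℝ} (e : WEigenfunction w) {s t : ℝ}
    (hs : 0 ≤ s) (hst : s ≤ t) (ht : t ≤ 1) :
    e.toFun t - e.toFun s = ∫ y in Ioc s t, e.der y ∂w.measure := by
  rw [e.eq_toFun t ⟨hs.trans hst, ht⟩, e.eq_toFun s ⟨hs, hst.trans ht⟩, add_sub_add_left_eq_sub,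
    setIntegral_Ioc_sub hs hst (e.isBddMeas_der.integrableOn_Ioc w 0 t)]

theorem WEigenfunction.continuousOn_der {w : StieltjesFunction ℝ} (e : WEigenfunction w) :
    ContinuousOn e.der (Icc 0 1) := by
  have hi : IntegrableOn (fun z => e.ev * e.toFun z) (Icc 0 1) :=
    ((IsBddMeas.const _).mul e.isBddMeas_toFun).integrable _
  have h := (intervalIntegral.continuousOn_primitive hi).const_add (e.der 0)
  exact h.congr fun x hx => e.eq_der x hx

/-- The value of `f` at the left end point of the mesh cell of `y`. -/
def cellLeft (f : ℝ → ℝ) (N : ℕ+) (y : ℝ) : ℝ :=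
  ∑ x : ZMod N, cellInd N x y * f ((x.val : ℝ) / (N : ℕ))

theorem cellLeft_of_mem (f : ℝ → ℝ) {N : ℕ+} {x : ZMod N} {y : ℝ} (hy : y ∈ cell1 N x) :
    cellLeft f N y = f ((x.val : ℝ) / (N : ℕ)) := by
  simp [cellLeft, cellInd_of_mem hy]

/-- An eigenfunction varies on `(s, y]` by at most `D (w y - w s)` with `D` a bound for its
derivative, so it is continuous wherever `w` is. -/
theorem WEigenfunction.tendsto_cellLeft {w : StieltjesFunction ℝ} (e : WEigenfunction w) {y : ℝ}
    (hy : y ∈ Ioc (0 : ℝ) 1) (hc : ContinuousAt w y) :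
    Tendsto (fun N => cellLeft e.toFun N y) atTop (𝓝 (e.toFun y)) := by
  choose x hx using fun N => exists_mem_cell1 N hy
  obtain ⟨D, hD⟩ := e.bounded_der
  have h1 : Tendsto (fun N : ℕ+ => ((x N).val : ℝ) / (N : ℕ)) atTop (𝓝 y) := by
    rw [← tendsto_sub_nhds_zero_iff]
    refine squeeze_zero_norm (fun N => ?_) tendsto_pnat_inv
    have h2 := (hx N).1
    have h3 := (hx N).2
    rw [add_div, one_div] at h3
    rw [Real.norm_eq_abs, abs_le]
    constructor <;> linarith [inv_pos.2 (pnat_pos N)]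
  have h2 : Tendsto (fun N : ℕ+ => D * (w y - w (((x N).val : ℝ) / (N : ℕ)))) atTop (𝓝 0) := by
    have := ((hc.tendsto.comp h1).const_sub (w y)).const_mul D
    simpa using this
  rw [← tendsto_sub_nhds_zero_iff]
  refine squeeze_zero_norm (fun N => ?_) h2
  have h3 : 0 ≤ ((x N).val : ℝ) / (N : ℕ) := by positivity
  rw [cellLeft_of_mem _ (hx N), norm_sub_rev, e.toFun_sub h3 (hx N).1.le hy.2]
  have h4 := norm_setIntegral_le_of_norm_le_const (μ := w.measure) (f := e.der) (C := D)
    (s := Ioc (((x N).val : ℝ) / (N : ℕ)) y) (by simp) fun t _ => hD t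
  rwa [measureReal_def, StieltjesFunction.measure_Ioc, ENNReal.toReal_ofReal
    (sub_nonneg.2 (w.mono (hx N).1.le))] at h4

/-- Only the last cell matters: there `x + 1` wraps around to `0` and periodicity of the
eigenfunction is used. -/
theorem toFun_val_add_one {w : StieltjesFunction ℝ} (e : WEigenfunction w) {N : ℕ+} (x : ZMod N) :
    e.toFun (((x + 1).val : ℝ) / (N : ℕ)) = e.toFun (((x.val : ℝ) + 1) / (N : ℕ)) := by
  have h1 : (x + 1).val = (x.val + 1) % N := by
    rw [ZMod.val_add, ZMod.val_one_eq_one_mod, Nat.add_mod_mod]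
  have h2 : x.val + 1 ≤ N := ZMod.val_lt x
  rcases h2.lt_or_eq with h2 | h2
  · rw [h1, Nat.mod_eq_of_lt h2, Nat.cast_add, Nat.cast_one]
  · rw [h1, h2, Nat.mod_self, Nat.cast_zero, zero_div]
    have h3 : (x.val : ℝ) + 1 = (N : ℕ) := by exact_mod_cast h2
    rw [h3, div_self (pnat_pos N).ne', e.periodic_toFun]

/-- The difference quotient is without error the cell average of `df/dw`, because the denominator is
the `dw`-mass of the cell. Discrete derivatives of test functions thus fall under the convergence of
cell averages. -/
theorem WEigenfunction.cell_difference {w : StieltjesFunction ℝ} (e : WEigenfunction w) {N : ℕ+}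
    (x : ZMod N) :
    (e.toFun (((x + 1).val : ℝ) / (N : ℕ)) - e.toFun ((x.val : ℝ) / (N : ℕ))) / cellDW w N x
      = ((unitW w).real (cell1 N x))⁻¹ * ∫ t in cell1 N x, e.der t ∂unitW w := by
  have hN := pnat_pos N
  have h2 : (x.val : ℝ) + 1 ≤ (N : ℕ) := by exact_mod_cast ZMod.val_lt x
  rw [toFun_val_add_one, e.toFun_sub (by positivity) (by gcongr; linarith)
    ((div_le_one hN).2 h2), unitW_real_cell1, Measure.restrict_restrict (measurableSet_cell1 x),
    inter_eq_left.2 (cell1_subset x), div_eq_inv_mul]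
  rfl

/-- The restriction of a product of eigenfunctions to the mesh. -/
def meshTest (e : ∀ j, WEigenfunction (W j)) (N : ℕ+) : Mesh d N :=
  fun x => ∏ j, (e j).toFun (((x j).val : ℝ) / (N : ℕ))

theorem meshDer_meshTest (e : ∀ j, WEigenfunction (W j)) (N : ℕ+) (k : Fin d)
    (x : Fin d → ZMod N) : meshDer W N k (meshTest e N) x =
      (((unitW (W k)).real (cell1 N (x k)))⁻¹ * ∫ t in cell1 N (x k), (e k).der t ∂unitW (W k)) *
        ∏ j ∈ Finset.univ.erase k, (e j).toFun (((x j).val : ℝ) / (N : ℕ)) := by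
  rw [← (e k).cell_difference, meshDer, meshTest, meshTest,
    ← Finset.mul_prod_erase _ _ (Finset.mem_univ k), ← Finset.mul_prod_erase _ _ (Finset.mem_univ k)]
  have h1 : ∏ j ∈ Finset.univ.erase k,
      (e j).toFun ((((x + Pi.single k 1 : Fin d → ZMod N) j).val : ℝ) / (N : ℕ))
        = ∏ j ∈ Finset.univ.erase k, (e j).toFun (((x j).val : ℝ) / (N : ℕ)) :=
    Finset.prod_congr rfl fun j hj => by
      rw [Pi.add_apply, Pi.single_eq_of_ne (Finset.ne_of_mem_erase hj), add_zero]
  rw [h1, Pi.add_apply, Pi.single_eq_same, ← sub_mul, div_mul_eq_mul_div]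
  rfl

theorem abs_inv_mul_setIntegral_le {α : Type*} [MeasurableSpace α] (μ : Measure α)
    [IsFiniteMeasure μ] (s : Set α) {f : α → ℝ} {C : ℝ} (hC : ∀ x, |f x| ≤ C) (hC0 : 0 ≤ C) :
    |(μ.real s)⁻¹ * ∫ x in s, f x ∂μ| ≤ C := by
  have h1 := norm_setIntegral_le_of_norm_le_const (μ := μ) (s := s) (f := f) (C := C)
    (measure_lt_top _ _) fun x _ => hC x
  rw [abs_mul, abs_of_nonneg (inv_nonneg.2 measureReal_nonneg)]
  rcases measureReal_nonneg.eq_or_lt (a := (0 : ℝ)) (b := μ.real s) with h | h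
  · rw [← h, inv_zero, zero_mul]; exact hC0
  · rw [inv_mul_le_iff₀ h, mul_comm]; exact h1

theorem abs_pcInterp_le {N : ℕ+} {u : Mesh d N} {C : ℝ} (hC : ∀ x, |u x| ≤ C) {y : Fin d → ℝ}
    (hy : ∀ i, y i ∈ Ioc (0 : ℝ) 1) : |pcInterp N u y| ≤ C := by
  obtain ⟨x, hx⟩ := exists_mem_meshCell N hy
  rw [pcInterp_of_mem hx]
  exact hC x

theorem strongConvL2_meshTest (e : ∀ j, WEigenfunction (W j)) :
    StrongConvL2 (torusVol d) (fun N => pcInterp N (meshTest e N)) (prodTest e) := by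
  choose C hC using fun j => (e j).bounded_toFun
  refine strongConvL2_of_bdd (C := ∏ j, C j)
    (fun N => (isBddMeas_pcInterp _).1.aestronglyMeasurable) (fun N => ?_) ?_
  · filter_upwards [ae_mem_Ioc_torusVol] with y hy
    refine abs_pcInterp_le (fun x => ?_) hy
    rw [meshTest, Finset.abs_prod]
    exact Finset.prod_le_prod (fun _ _ => abs_nonneg _) fun j _ => hC j _
  · have h1 : ∀ j : Fin d, ∀ᵐ y ∂torusVol d, ContinuousAt (W j) (y j) := fun j =>
      (Measure.quasiMeasurePreserving_eval (μ := fun _ : Fin d => unitVol) j).ae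
        (ae_continuousAt_unitVol (W j))
    filter_upwards [ae_mem_Ioc_torusVol, ae_all_iff.2 h1] with y hy hc
    refine (tendsto_finsetProd _ fun j _ => (e j).tendsto_cellLeft (hy j) (hc j)).congr fun N => ?_
    obtain ⟨x, hx⟩ := exists_mem_meshCell N hy
    rw [pcInterp_of_mem hx]
    exact Finset.prod_congr rfl fun j _ => cellLeft_of_mem _ (hx j)

theorem strongConvL2_meshDer_meshTest (hW : ∀ k, StrictMono (W k)) (e : ∀ j, WEigenfunction (W j))
    (k : Fin d) : StrongConvL2 (mixedVol W k)
      (fun N => pcInterp N (meshDer W N k (meshTest e N))) (prodTestDer e k) := by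
  choose C hC using fun j => (e j).bounded_toFun
  obtain ⟨D, hD⟩ := (e k).bounded_der
  have hD0 : 0 ≤ D := (abs_nonneg _).trans (hD 0)
  refine strongConvL2_of_bdd (C := D * ∏ j ∈ Finset.univ.erase k, C j)
    (fun N => (isBddMeas_pcInterp _).1.aestronglyMeasurable) (fun N => ?_) ?_
  · filter_upwards [ae_mem_Ioc_mixedVol W k] with y hy
    refine abs_pcInterp_le (fun x => ?_) hy
    rw [meshDer_meshTest, abs_mul, Finset.abs_prod]
    exact mul_le_mul (abs_inv_mul_setIntegral_le _ _ hD hD0)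
      (Finset.prod_le_prod (fun _ _ => abs_nonneg _) fun j _ => hC j _)
      (Finset.prod_nonneg fun _ _ => abs_nonneg _) hD0
  · have h1 : ∀ j : Fin d, ∀ᵐ y ∂mixedVol W k, j ≠ k → ContinuousAt (W j) (y j) := fun j => by
      refine (Measure.quasiMeasurePreserving_eval (μ := mixedFactor W k) j).ae
        (p := fun t => j ≠ k → ContinuousAt (W j) t) ?_
      by_cases hj : j = k
      · exact Eventually.of_forall fun _ h => absurd hj h
      · rw [mixedFactor_of_ne W hj]
        exact (ae_continuousAt_unitVol (W j)).mono fun _ h _ => h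
    filter_upwards [ae_mem_Ioc_mixedVol W k, ae_all_iff.2 h1] with y hy hc
    have h2 : Tendsto (fun N => cellAvg (unitW (W k)) (e k).der N (y k)) atTop
        (𝓝 ((e k).der (y k))) :=
      tendsto_cellAvg_of_continuousWithinAt (fun N x => by
        rw [unitW_real_cell1]; exact cellDW_pos (hW k) x) (e k).isBddMeas_der (hy k)
        (((e k).continuousOn_der _ ⟨(hy k).1.le, (hy k).2⟩).mono Ioc_subset_Icc_self)
    refine (h2.mul (tendsto_finsetProd (Finset.univ.erase k) fun j hj =>
      (e j).tendsto_cellLeft (hy j) (hc j (Finset.ne_of_mem_erase hj)))).congr fun N => ?_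
    obtain ⟨x, hx⟩ := exists_mem_meshCell N hy
    rw [pcInterp_of_mem hx, meshDer_meshTest, cellAvg_of_mem _ _ (hx k)]
    congr 1
    exact Finset.prod_congr rfl fun j _ => cellLeft_of_mem _ (hx j)

end

/-! ### Weak convergence along filters and the discrete gradient -/

noncomputable section

/-- Weak convergence along a filter in a real inner product space. -/
def WeakTendsto {ι H : Type*} [NormedAddCommGroup H] [InnerProductSpace ℝ H] (p : ι → H)
    (l : Filter ι) (q : H) : Prop :=
  ∀ φ : H, Tendsto (fun i => inner ℝ (p i) φ) l (𝓝 (inner ℝ q φ))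

section WeakTendsto

variable {ι H : Type*} [NormedAddCommGroup H] [InnerProductSpace ℝ H]

/-- An eventually bounded family has a weak limit along every ultrafilter. -/
theorem exists_weakTendsto [CompleteSpace H] (U : Ultrafilter ι) {p : ι → H} {K : ℝ}
    (hp : ∀ᶠ i in (U : Filter ι), ‖p i‖ ≤ K) : ∃ q, WeakTendsto p U q := by
  have h1 : ∀ φ : H, ∃ c : ℝ, Tendsto (fun i => inner ℝ (p i) φ) U (𝓝 c) ∧ ‖c‖ ≤ K * ‖φ‖ := by
    intro φ
    have h2 : ∀ᶠ i in (U : Filter ι), inner ℝ (p i) φ ∈ Metric.closedBall (0 : ℝ) (K * ‖φ‖) :=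
      hp.mono fun i hi => by
        rw [mem_closedBall_zero_iff]
        exact (norm_inner_le_norm _ _).trans (by gcongr)
    -- An ultrafilter on a compact ball converges, so no subsequence or separability is needed.
    obtain ⟨c, hc, hcU⟩ := (isCompact_closedBall (0 : ℝ) (K * ‖φ‖)).ultrafilter_le_nhds
      (U.map fun i => inner ℝ (p i) φ) (by rwa [Ultrafilter.coe_map, le_principal_iff, mem_map])
    exact ⟨c, hcU, mem_closedBall_zero_iff.1 hc⟩
  choose c hc hcK using h1
  let L : H →ₗ[ℝ] ℝ :=
    { toFun := c
      map_add' := fun φ ψ => tendsto_nhds_unique (hc (φ + ψ)) (by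
        simpa only [inner_add_right] using (hc φ).add (hc ψ))
      map_smul' := fun r φ => tendsto_nhds_unique (hc (r • φ)) (by
        simpa only [inner_smul_right, RingHom.id_apply, smul_eq_mul] using (hc φ).const_mul r) }
  let L' : StrongDual ℝ H := L.mkContinuous K hcK
  refine ⟨(InnerProductSpace.toDual ℝ H).symm L', fun φ => ?_⟩
  rw [InnerProductSpace.toDual_symm_apply]
  exact hc φ

/-- Weak times strong: the bound on `p` absorbs the strong error of `φ`. -/
theorem WeakTendsto.inner_tendsto {l : Filter ι} {p : ι → H} {q : H} (h : WeakTendsto p l q) {K : ℝ}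
    (hp : ∀ᶠ i in l, ‖p i‖ ≤ K) {φ : ι → H} {ψ : H} (hφ : Tendsto φ l (𝓝 ψ)) :
    Tendsto (fun i => inner ℝ (p i) (φ i)) l (𝓝 (inner ℝ q ψ)) := by
  have h1 : Tendsto (fun i => inner ℝ (p i) (φ i - ψ)) l (𝓝 0) := by
    have h2 : Tendsto (fun i => K * ‖φ i - ψ‖) l (𝓝 0) := by
      simpa using (tendsto_iff_norm_sub_tendsto_zero.1 hφ).const_mul K
    refine squeeze_zero_norm' (hp.mono fun i hi => ?_) h2
    exact (norm_inner_le_norm _ _).trans (by gcongr)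
  have h3 := h1.add (h ψ)
  simpa only [← inner_add_right, sub_add_cancel, zero_add] using h3

/-- A closed subspace is the orthogonal complement of its orthogonal complement, that is, cut out by
conditions stable under weak limits. -/
theorem WeakTendsto.mem_of_isClosed [CompleteSpace H] {l : Filter ι} [l.NeBot] {p : ι → H} {q : H}
    (h : WeakTendsto p l q) (K : Submodule ℝ H) (hK : IsClosed (K : Set H)) (hp : ∀ i, p i ∈ K) :
    q ∈ K := by
  have := hK.completeSpace_coe
  rw [← K.orthogonal_orthogonal, Submodule.mem_orthogonal']
  intro z hz
  refine tendsto_nhds_unique (h z) (tendsto_const_nhds.congr fun i => ?_)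
  exact ((Submodule.mem_orthogonal K z).1 hz _ (hp i)).symm

theorem WeakTendsto.of_tendsto_sub {l : Filter ι} {p p' : ι → H} {q : H} (h : WeakTendsto p l q)
    (hd : Tendsto (fun i => p' i - p i) l (𝓝 0)) : WeakTendsto p' l q := fun φ => by
  have h1 : Tendsto (fun i => inner ℝ (p' i - p i) φ) l (𝓝 (inner ℝ (0 : H) φ)) :=
    hd.inner tendsto_const_nhds
  simpa only [← inner_add_left, sub_add_cancel, zero_add] using h1.add (h φ)

theorem WeakTendsto.unique {l : Filter ι} [l.NeBot] {p : ι → H} {q q' : H}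
    (h : WeakTendsto p l q) (h' : WeakTendsto p l q') : q = q' :=
  ext_inner_right ℝ fun φ => tendsto_nhds_unique (h φ) (h' φ)

theorem WeakTendsto.integral_mul {l : Filter ι} {α : Type*} [MeasurableSpace α] {μ : Measure α}
    {p : ι → Lp ℝ 2 μ} {q : Lp ℝ 2 μ} (h : WeakTendsto p l q) {φ : α → ℝ} (hφ : MemLp φ 2 μ) :
    Tendsto (fun i => ∫ x, φ x * p i x ∂μ) l (𝓝 (∫ x, φ x * q x ∂μ)) := by
  have h1 : ∀ g : Lp ℝ 2 μ, inner ℝ g (hφ.toLp φ) = ∫ x, φ x * g x ∂μ := fun g => by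
    rw [real_inner_comm, inner_L2_eq]
    exact integral_congr_ae (hφ.coeFn_toLp.mul (ae_eq_refl g))
  simpa only [h1] using h (hφ.toLp φ)

end WeakTendsto

variable {d : ℕ} {W : Fin d → StieltjesFunction ℝ}

theorem norm_sq_L2Prod (p : L2Prod W) : ‖p‖ ^ 2 = ‖p.fst‖ ^ 2 + ∑ k, ‖p.snd k‖ ^ 2 := by
  rw [WithLp.prod_norm_sq_eq_of_L2, PiLp.norm_sq_eq_of_L2]

theorem L2Prod.norm_snd_le (p : L2Prod W) (k : Fin d) : ‖p.snd k‖ ≤ ‖p‖ := by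
  refine le_of_sq_le_sq ?_ (norm_nonneg _)
  rw [norm_sq_L2Prod]
  have := Finset.single_le_sum (f := fun k => ‖p.snd k‖ ^ 2) (fun k _ => sq_nonneg _)
    (Finset.mem_univ k)
  have h2 := sq_nonneg ‖p.fst‖
  simp only at this
  linarith

theorem WeakTendsto.fst {ι : Type*} {l : Filter ι} {p : ι → L2Prod W} {q : L2Prod W}
    (h : WeakTendsto p l q) : WeakTendsto (fun i => (p i).fst) l q.fst := fun φ => by
  have h1 : ∀ p : L2Prod W, inner ℝ p (WithLp.toLp 2 (φ, 0) : L2Prod W) = inner ℝ p.fst φ :=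
    fun p => by rw [WithLp.prod_inner_apply]; simp
  simpa only [h1] using h (WithLp.toLp 2 (φ, 0))

theorem WeakTendsto.snd {ι : Type*} {l : Filter ι} {p : ι → L2Prod W} {q : L2Prod W}
    (h : WeakTendsto p l q) (k : Fin d) :
    WeakTendsto (fun i => (p i).snd k) l (q.snd k) := fun φ => by
  have h1 : ∀ p : L2Prod W, inner ℝ p (WithLp.toLp 2 (0, WithLp.toLp 2 (Pi.single k φ)) : L2Prod W)
      = inner ℝ (p.snd k) φ := fun p => by
    rw [WithLp.prod_inner_apply, PiLp.inner_apply, Finset.sum_eq_single k]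
    · simp
    · intro j _ hj
      simp [Pi.single_eq_of_ne hj]
    · simp
  simpa only [h1] using h (WithLp.toLp 2 (0, WithLp.toLp 2 (Pi.single k φ)))

theorem tendsto_l2Mk {v : ℕ+ → (Fin d → ℝ) → ℝ} {g : (Fin d → ℝ) → ℝ}
    {V : ℕ+ → Fin d → (Fin d → ℝ) → ℝ} {G : Fin d → (Fin d → ℝ) → ℝ}
    (h : StrongConvL2 (torusVol d) v g)
    (hV : ∀ k, StrongConvL2 (mixedVol W k) (fun N => V N k) (G k)) :
    Tendsto (fun N => l2Mk (h.1 N) fun k => (hV k).1 N) atTop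
      (𝓝 (l2Mk h.2.1 fun k => (hV k).2.1)) := by
  have h1 : Tendsto (fun N => (WithLp.toLp 2 fun k => ((hV k).1 N).toLp (V N k) :
      PiLp 2 fun k : Fin d => Lp ℝ 2 (mixedVol W k))) atTop
      (𝓝 (WithLp.toLp 2 fun k => (hV k).2.1.toLp (G k))) :=
    ((PiLp.continuous_toLp 2 _).tendsto _).comp (tendsto_pi_nhds.2 fun k => (hV k).tendsto_toLp)
  exact ((WithLp.prod_continuous_toLp 2 _ _).tendsto _).comp (h.tendsto_toLp.prodMk_nhds h1)

/-- Products of boundedly a.e. convergent with strongly convergent sequences. -/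
theorem StrongConvL2.bdd_mul {μ : Measure (Fin d → ℝ)} [IsFiniteMeasure μ]
    {b φ : ℕ+ → (Fin d → ℝ) → ℝ} {β ψ : (Fin d → ℝ) → ℝ} (hφ : StrongConvL2 μ φ ψ)
    (hb : ∀ N, IsBddMeas (b N)) {C : ℝ} (hC : ∀ N, ∀ᵐ y ∂μ, |b N y| ≤ C)
    (hβ : IsBddMeas β) (hlim : ∀ᵐ y ∂μ, Tendsto (fun N => b N y) atTop (𝓝 (β y))) :
    StrongConvL2 μ (fun N y => b N y * φ N y) fun y => β y * ψ y := by
  refine ⟨fun N => (hb N).mul_memLp (hφ.1 N), hβ.mul_memLp hφ.2.1, ?_⟩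
  have hd : ∀ N, MemLp (fun y => (b N y - β y) * ψ y) 2 μ := fun N => by
    simp only [sub_mul]
    exact ((hb N).mul_memLp hφ.2.1).sub (hβ.mul_memLp hφ.2.1)
  have h1 : Tendsto (fun N => eLpNorm (fun y => (b N y - β y) * ψ y) 2 μ) atTop (𝓝 0) := by
    obtain ⟨D, hD⟩ := hβ.2
    have h2 : Tendsto (fun N => ∫ y, ((b N y - β y) * ψ y) ^ 2 ∂μ) atTop
        (𝓝 (∫ _, (0 : ℝ) ∂μ)) := by
      refine tendsto_integral_filter_of_dominated_convergence (fun y => (C + D) ^ 2 * ψ y ^ 2)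
        (Eventually.of_forall fun N => (hd N).1.pow 2) (Eventually.of_forall fun N => ?_)
        (hφ.2.1.integrable_sq.const_mul _) ?_
      · filter_upwards [hC N] with y h1
        rw [norm_pow, norm_mul, mul_pow, ← sq_abs (ψ y)]
        have := (abs_sub (b N y) (β y)).trans (add_le_add h1 (hD y))
        simp only [Real.norm_eq_abs]
        gcongr
      · filter_upwards [hlim] with y hy
        simpa using ((hy.sub_const (β y)).mul_const (ψ y)).pow 2
    simp only [eLpNorm_two_eq (hd _)]
    simpa using ENNReal.tendsto_ofReal h2.sqrt
  have h3 : Tendsto (fun N => ENNReal.ofReal C * eLpNorm (fun y => φ N y - ψ y) 2 μ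
      + eLpNorm (fun y => (b N y - β y) * ψ y) 2 μ) atTop (𝓝 0) := by
    simpa using (ENNReal.Tendsto.const_mul hφ.2.2 (Or.inr ENNReal.ofReal_ne_top)).add h1
  refine tendsto_of_tendsto_of_tendsto_of_le_of_le tendsto_const_nhds h3 (fun N => zero_le)
    fun N => ?_
  have h4 : (fun y => b N y * φ N y - β y * ψ y)
      = (fun y => b N y * (φ N y - ψ y)) + fun y => (b N y - β y) * ψ y := by
    funext y; simp only [Pi.add_apply]; ring
  have h5 : MemLp (fun y => b N y * (φ N y - ψ y)) 2 μ :=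
    (hb N).mul_memLp ((hφ.1 N).sub hφ.2.1)
  simp only [h4]
  refine (eLpNorm_add_le h5.1 (hd N).1 (by norm_num)).trans ?_
  gcongr
  refine eLpNorm_le_mul_eLpNorm_of_ae_le_mul ?_ 2
  filter_upwards [hC N] with y hy
  rw [norm_mul]
  gcongr
  exact hy

/-- The piecewise constant interpolation of a mesh function and a mesh vector field. -/
def pcL2 (W : Fin d → StieltjesFunction ℝ) (N : ℕ+) (g : Mesh d N) (G : Fin d → Mesh d N) :
    L2Prod W :=
  l2Mk ((isBddMeas_pcInterp g).memLp _ _) fun k => (isBddMeas_pcInterp (G k)).memLp _ _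

/-- The piecewise constant interpolation of a mesh function and of its differences. -/
def pcGrad (W : Fin d → StieltjesFunction ℝ) (N : ℕ+) (u : Mesh d N) : L2Prod W :=
  pcL2 W N u fun k => meshDer W N k u

variable {N : ℕ+}

theorem inner_pcL2 (g g' : Mesh d N) (G G' : Fin d → Mesh d N) :
    inner ℝ (pcL2 W N g G) (pcL2 W N g' G')
      = meshInner N g g' + ∑ k, meshInnerW W N k (G k) (G' k) := by
  rw [inner_L2Prod]
  congr 1
  · rw [← integral_pcInterp_mul_torusVol]
    exact integral_congr_ae ((l2Mk_fst _ _).mul (l2Mk_fst _ _))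
  · refine Finset.sum_congr rfl fun k _ => ?_
    rw [← integral_pcInterp_mul_mixedVol]
    exact integral_congr_ae ((l2Mk_snd _ _ k).mul (l2Mk_snd _ _ k))

theorem norm_sq_pcGrad (u : Mesh d N) :
    ‖pcGrad W N u‖ ^ 2 = meshInner N u u + meshEnergy W N u := by
  rw [← real_inner_self_eq_norm_sq, pcGrad, inner_pcL2, meshEnergy]

/-- By symmetry the coefficient sits on the test function `v`, which converges strongly, and not on
the solution `u`, which converges only weakly. -/
theorem meshForm_eq_inner (lam : ℝ) (a : Fin d → Mesh d N) (u v : Mesh d N) :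
    meshForm W N lam a u v
      = inner ℝ (pcGrad W N u) (pcL2 W N (lam • v) fun k => a k * meshDer W N k v) := by
  rw [pcGrad, inner_pcL2, meshForm, meshInner_smul_right]
  congr 1
  refine Finset.sum_congr rfl fun k _ => ?_
  simp only [meshInnerW, Pi.mul_apply]
  congr 1
  exact Finset.sum_congr rfl fun x _ => by ring

theorem meshInner_self_nonneg (u : Mesh d N) : 0 ≤ meshInner N u u := by
  rw [← integral_pcInterp_mul_torusVol]
  exact integral_nonneg fun y => mul_self_nonneg _

/-- The constant does not depend on `N`. For `lam = 0` the zero order part of the norm is recovered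
from the Poincaré inequality. -/
theorem exists_coercive (hW : ∀ k, StrictMono (W k)) {lam : ℝ} (hlam : 0 ≤ lam) {c : ℝ}
    (hc : 0 < c) : ∃ m : ℝ, 0 < m ∧ ∀ (N : ℕ+) (a : Fin d → Mesh d N), (∀ k x, c ≤ a k x) →
      ∀ u : Mesh d N, (lam = 0 → ∑ x, u x = 0) →
        m * ‖pcGrad W N u‖ ^ 2 ≤ meshForm W N lam a u u := by
  rcases hlam.eq_or_lt with rfl | hlam
  · obtain ⟨C, hC0, hC⟩ := exists_poincare hW
    refine ⟨c / (C + 1), by positivity, fun N a ha u hu => ?_⟩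
    have h1 := hC N u (hu rfl)
    have h2 := meshForm_self_ge hW (lam := 0) ha u
    rw [norm_sq_pcGrad, div_mul_eq_mul_div, div_le_iff₀ (by positivity)]
    nlinarith
  · refine ⟨min lam c, lt_min hlam hc, fun N a ha u _ => ?_⟩
    refine le_trans ?_ (meshForm_self_ge hW ha u)
    rw [norm_sq_pcGrad, mul_add]
    exact add_le_add (mul_le_mul_of_nonneg_right (min_le_left _ _) (meshInner_self_nonneg u))
      (mul_le_mul_of_nonneg_right (min_le_right _ _) (meshEnergy_nonneg W u))

end

/-! ### Weak limits lie in `H_{1,W}`; uniqueness for the limit equation -/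

noncomputable section

variable {d : ℕ} {W : Fin d → StieltjesFunction ℝ} {N : ℕ+}

theorem pcGrad_fst (u : Mesh d N) : (pcGrad W N u).fst =ᵐ[torusVol d] pcInterp N u := l2Mk_fst _ _

theorem pcGrad_snd (u : Mesh d N) (k : Fin d) :
    (pcGrad W N u).snd k =ᵐ[mixedVol W k] pcInterp N (meshDer W N k u) := l2Mk_snd _ _ k

/-- The interpolation `interp W N T u` as an element of `L²`. -/
def interpL2 (hW : ∀ k, StrictMono (W k)) (N : ℕ+) (T : Finset (Fin d)) (u : Mesh d N) :
    Lp ℝ 2 (torusVol d) :=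
  ((isBddMeas_interp hW T u).memLp _ _).toLp _

theorem coeFn_interpL2 (hW : ∀ k, StrictMono (W k)) (T : Finset (Fin d)) (u : Mesh d N) :
    interpL2 hW N T u =ᵐ[torusVol d] interp W N T u := MemLp.coeFn_toLp _

theorem norm_sq_L2_eq {α : Type*} [MeasurableSpace α] {μ : Measure α} (g : Lp ℝ 2 μ) :
    ‖g‖ ^ 2 = ∫ x, g x ^ 2 ∂μ := by
  rw [← real_inner_self_eq_norm_sq, inner_L2_eq]
  simp only [sq]

/-- The squared gap is `C N⁻¹` times the energy, and the energy is at most `K²`; so all mixed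
interpolations share the weak limit of the piecewise constant one. -/
theorem tendsto_interpL2_sub (hW : ∀ k, StrictMono (W k)) (T : Finset (Fin d))
    {l : Filter ℕ+} (hl : l ≤ atTop) {u : ∀ N : ℕ+, Mesh d N} {K : ℝ}
    (hK : ∀ᶠ N in l, ‖pcGrad W N (u N)‖ ≤ K) :
    Tendsto (fun N => interpL2 hW N T (u N) - (pcGrad W N (u N)).fst) l (𝓝 0) := by
  obtain ⟨C, hC0, hC⟩ := exists_integral_interp_sub_sq_le hW T
  have h1 : Tendsto (fun N : ℕ+ => C * ((N : ℕ) : ℝ)⁻¹ * K ^ 2) l (𝓝 0) := by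
    simpa using ((tendsto_pnat_inv.mono_left hl).const_mul C).mul_const (K ^ 2)
  have h2 : Tendsto (fun N => ‖interpL2 hW N T (u N) - (pcGrad W N (u N)).fst‖ ^ 2) l (𝓝 0) := by
    refine squeeze_zero' (Eventually.of_forall fun N => sq_nonneg _) (hK.mono fun N hN => ?_) h1
    rw [norm_sq_L2_eq]
    have h3 : ∫ x, (interpL2 hW N T (u N) - (pcGrad W N (u N)).fst : Lp ℝ 2 (torusVol d)) x ^ 2
        ∂torusVol d = ∫ y, (interp W N T (u N) y - pcInterp N (u N) y) ^ 2 ∂torusVol d := by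
      refine integral_congr_ae ?_
      filter_upwards [Lp.coeFn_sub (interpL2 hW N T (u N)) (pcGrad W N (u N)).fst,
        coeFn_interpL2 hW T (u N), pcGrad_fst (W := W) (u N)] with y h1 h2 h3
      rw [h1, Pi.sub_apply, h2, h3]
    rw [h3]
    refine (hC N (u N)).trans ?_
    have h4 : meshEnergy W N (u N) ≤ K ^ 2 := by
      have h5 := pow_le_pow_left₀ (norm_nonneg _) hN 2
      rw [norm_sq_pcGrad] at h5
      linarith [meshInner_self_nonneg (u N)]
    exact mul_le_mul_of_nonneg_left h4 (mul_nonneg hC0 (inv_nonneg.2 (pnat_pos N).le))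
  rw [tendsto_zero_iff_norm_tendsto_zero]
  have h3 := h2.sqrt
  simpa only [Real.sqrt_sq (norm_nonneg _), Real.sqrt_zero] using h3

/-- For `T = {k}` the derivative is `W`-affine in no direction at all, so it is the piecewise
constant interpolation of the difference quotient itself. -/
theorem isWeakWDeriv_interpL2_singleton (hW : ∀ k, StrictMono (W k)) (k : Fin d) (u : Mesh d N) :
    IsWeakWDeriv W k (interpL2 hW N {k} u) ((pcGrad W N u).snd k) := by
  have h := isWeakWDeriv_interp hW (Finset.mem_singleton_self k) u
  rw [Finset.erase_singleton, ← pcInterp_eq_interp] at h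
  exact h.congr_ae (coeFn_interpL2 hW _ u).symm (pcGrad_snd u k).symm

/-- Weak limits of bounded sequences of mesh functions lie in `H_{1,W}`. -/
theorem mem_H1W_of_weakTendsto (hW : ∀ k, StrictMono (W k)) {l : Filter ℕ+} [l.NeBot]
    (hl : l ≤ atTop) {u : ∀ N : ℕ+, Mesh d N} {K : ℝ}
    (hK : ∀ᶠ N in l, ‖pcGrad W N (u N)‖ ≤ K) {p : L2Prod W}
    (hp : WeakTendsto (fun N => pcGrad W N (u N)) l p) : p ∈ H1W W := by
  intro k
  -- For each direction `k` another interpolation stands in for `u N`; both sides of the integration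
  -- by parts identity then converge.
  have h1 : WeakTendsto (fun N => interpL2 hW N {k} (u N)) l p.fst :=
    hp.fst.of_tendsto_sub (tendsto_interpL2_sub hW {k} hl hK)
  refine ⟨fun e => ?_, fun c hm hb hc => ?_⟩
  · have h2 := h1.integral_mul ((isBddMeas_prodTestDer2 e k).memLp _ 2)
    have h3 := ((hp.snd k).integral_mul (memLp_prodTestDer e k)).neg
    refine tendsto_nhds_unique h2 (h3.congr fun N => ?_)
    exact ((isWeakWDeriv_interpL2_singleton hW k (u N)).1 e).symm
  · have h2 := (hp.snd k).integral_mul (IsBddMeas.memLp ⟨hm, hb⟩ _ 2)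
    refine tendsto_nhds_unique h2 (tendsto_const_nhds.congr fun N => ?_)
    exact ((isWeakWDeriv_interpL2_singleton hW k (u N)).2 c hm hb hc).symm

/-- The pair `(lam g, (a_k G_k)_k)`. -/
def fluxL2 (lam : ℝ) {a : Fin d → (Fin d → ℝ) → ℝ} (ha : ∀ k, IsBddMeas (a k)) (p : L2Prod W) :
    L2Prod W :=
  l2Mk ((Lp.memLp p.fst).const_mul lam) fun k => (ha k).mul_memLp (Lp.memLp (p.snd k))

section flux

variable {lam : ℝ} {a : Fin d → (Fin d → ℝ) → ℝ}

theorem inner_fluxL2 (ha : ∀ k, IsBddMeas (a k)) (p q : L2Prod W) : inner ℝ (fluxL2 lam ha p) q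
    = lam * (∫ y, p.fst y * q.fst y ∂torusVol d)
      + ∑ k, ∫ y, a k y * p.snd k y * q.snd k y ∂mixedVol W k := by
  rw [fluxL2, inner_l2Mk, ← integral_const_mul]
  simp only [mul_assoc]

theorem inner_fluxL2_comm (ha : ∀ k, IsBddMeas (a k)) (p q : L2Prod W) :
    inner ℝ (fluxL2 lam ha p) q = inner ℝ (fluxL2 lam ha q) p := by
  simp only [inner_fluxL2, mul_assoc, mul_comm (p.fst _), mul_comm (p.snd _ _)]

theorem isWeakSolution_iff (ha : ∀ k, IsBddMeas (a k)) (f : StrongDual ℝ (H1W W)) (u : H1W W) :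
    IsWeakSolution W lam a f u ↔ (∀ v : H1W W, inner ℝ (fluxL2 lam ha (u : L2Prod W)) (v : L2Prod W) = f v) ∧
      (lam = 0 → ∫ y, h1Fn u y ∂torusVol d = 0) := by
  simp only [inner_fluxL2]
  rfl

theorem fluxL2_self_ge (ha : ∀ k, IsBddMeas (a k)) {c : ℝ} (hac : ∀ k y, c ≤ a k y) (p : L2Prod W) :
    lam * ‖p.fst‖ ^ 2 + c * ∑ k, ‖p.snd k‖ ^ 2 ≤ inner ℝ (fluxL2 lam ha p) p := by
  rw [inner_fluxL2, norm_sq_L2_eq, Finset.mul_sum]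
  simp only [← sq]
  refine add_le_add_right (Finset.sum_le_sum fun k _ => ?_) _
  rw [norm_sq_L2_eq, ← integral_const_mul]
  have h2 := (Lp.memLp (p.snd k)).integrable_sq
  simp only [mul_assoc, ← sq]
  exact integral_mono (h2.const_mul c) ((ha k).mul_integrable h2) fun y =>
    mul_le_mul_of_nonneg_right (hac k y) (sq_nonneg _)

/-- Testing the difference with itself kills its gradient by ellipticity. The function then vanishes
directly when `lam > 0`, and by the zero mean normalization when `lam = 0`. -/
theorem IsWeakSolution.unique (hW : ∀ k, StrictMono (W k)) (ha : ∀ k, IsBddMeas (a k)) (hlam : 0 ≤ lam) {c : ℝ} (hc : 0 < c)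
    (hac : ∀ k y, c ≤ a k y) {f : StrongDual ℝ (H1W W)} {u u' : H1W W}
    (hu : IsWeakSolution W lam a f u) (hu' : IsWeakSolution W lam a f u') : u = u' := by
  rw [isWeakSolution_iff ha] at hu hu'
  set w : L2Prod W := (u : L2Prod W) - u' with hw
  have hwm : w ∈ H1W W := (H1W W).sub_mem u.2 u'.2
  have h0 : inner ℝ (fluxL2 lam ha w) w = 0 := by
    conv_lhs => rw [hw, inner_sub_right, ← hw]
    rw [inner_fluxL2_comm ha w u, inner_fluxL2_comm ha w u']
    have h1 := hu.1 ⟨w, hwm⟩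
    have h2 := hu'.1 ⟨w, hwm⟩
    simp only at h1 h2
    rw [h1, h2, sub_self]
  have h1 := fluxL2_self_ge (lam := lam) ha hac w
  rw [h0] at h1
  have h2 : 0 ≤ ∑ k, ‖w.snd k‖ ^ 2 := Finset.sum_nonneg fun k _ => sq_nonneg _
  have h3 := mul_nonneg hlam (sq_nonneg ‖w.fst‖)
  have h4 := mul_nonneg hc.le h2
  have h5 : ∑ k, ‖w.snd k‖ ^ 2 = 0 :=
    (mul_eq_zero.1 (by linarith : c * ∑ k, ‖w.snd k‖ ^ 2 = 0)).resolve_left hc.ne'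
  have h6 : ∀ k, w.snd k = 0 := fun k => norm_eq_zero.1 <| pow_eq_zero_iff two_ne_zero |>.1 <|
    (Finset.sum_eq_zero_iff_of_nonneg fun k _ => sq_nonneg _).1 h5 k (Finset.mem_univ k)
  have h7 : w.fst = 0 := by
    rcases hlam.eq_or_lt with h | h
    · refine fst_eq_zero_of_snd_eq_zero hW hwm h6 ?_
      have e1 := hu.2 h.symm
      have e2 := hu'.2 h.symm
      simp only [h1Fn] at e1 e2
      have e3 : ∫ x, w.fst x ∂torusVol d = ∫ x, ((u : L2Prod W).fst x - (u' : L2Prod W).fst x) ∂torusVol d :=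
        integral_congr_ae (Lp.coeFn_sub _ _)
      rw [e3, integral_sub (integrable_L2 _) (integrable_L2 _), e1, e2, sub_zero]
    · have e1 : lam * ‖w.fst‖ ^ 2 = 0 := by linarith
      exact norm_eq_zero.1 <| pow_eq_zero_iff two_ne_zero |>.1 <|
        (mul_eq_zero.1 e1).resolve_left h.ne'
  have h8 : w = 0 := L2Prod_ext h7 h6
  exact Subtype.ext (sub_eq_zero.1 h8)

end flux

end

/-! ### Passage to the limit and homogenization -/

noncomputable section

variable {d : ℕ} {W : Fin d → StieltjesFunction ℝ}

/-- A strongly convergent sequence of right-hand sides is given by a convergent sequence in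
`L²(𝕋^d) × ∏_k L²_{x^k ⊗ W_k}(𝕋^d)`. -/
theorem StrongConvDual.exists_tendsto {fN : ∀ N : ℕ+, Mesh d N →ₗ[ℝ] ℝ} {f : StrongDual ℝ (H1W W)}
    (h : StrongConvDual W fN f) : ∃ (FN : ℕ+ → L2Prod W) (F : L2Prod W),
      (∀ N v, fN N v = inner ℝ (FN N) (pcGrad W N v)) ∧
      (∀ v : H1W W, f v = inner ℝ F (v : L2Prod W)) ∧ Tendsto FN atTop (𝓝 F) := by
  obtain ⟨gN, GN, g, G, h1, h2, h3, h4⟩ := h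
  refine ⟨fun N => pcL2 W N (gN N) (GN N), l2Mk h3.2.1 fun k => (h4 k).2.1, fun N v => ?_,
    fun v => ?_, tendsto_l2Mk (V := fun N k => pcInterp N (GN N k)) h3 h4⟩
  · rw [h1, pcGrad, inner_pcL2]
  · rw [h2, inner_l2Mk]; rfl

theorem tendsto_pcGrad_meshTest (hW : ∀ k, StrictMono (W k)) (e : ∀ j, WEigenfunction (W j)) :
    Tendsto (fun N => pcGrad W N (meshTest e N)) atTop (𝓝 (prodTestH1 e : L2Prod W)) :=
  tendsto_l2Mk (V := fun N k => pcInterp N (meshDer W N k (meshTest e N)))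
    (strongConvL2_meshTest e) fun k => strongConvL2_meshDer_meshTest hW e k

variable {aN : ∀ N : ℕ+, Fin d → Mesh d N} {a : Fin d → (Fin d → ℝ) → ℝ}

/-- Boundedly almost everywhere convergent coefficients multiply strongly convergent differences, so
the discrete flux of a test function converges strongly. This is the only place where convergence of
the coefficients enters the limit equation. -/
theorem tendsto_pcL2_meshTest (hW : ∀ k, StrictMono (W k)) {C : ℝ}
    (haC : ∀ N k x, |aN N k x| ≤ C) (ha : ∀ k, IsBddMeas (a k))
    (hlim : ∀ k, ∀ᵐ y ∂mixedVol W k, Tendsto (fun N => pcInterp N (aN N k) y) atTop (𝓝 (a k y)))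
    (lam : ℝ) (e : ∀ j, WEigenfunction (W j)) :
    Tendsto (fun N => pcL2 W N (lam • meshTest e N) fun k => aN N k * meshDer W N k (meshTest e N))
      atTop (𝓝 (fluxL2 lam ha (prodTestH1 e : L2Prod W))) := by
  have h1 : StrongConvL2 (torusVol d) (fun N y => lam * pcInterp N (meshTest e N) y)
      fun y => lam * prodTest e y :=
    (strongConvL2_meshTest e).bdd_mul (fun _ => IsBddMeas.const lam)
      (fun _ => Eventually.of_forall fun _ => le_rfl) (IsBddMeas.const lam)
      (Eventually.of_forall fun _ => tendsto_const_nhds)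
  have h2 : ∀ k, StrongConvL2 (mixedVol W k)
      (fun N y => pcInterp N (aN N k) y * pcInterp N (meshDer W N k (meshTest e N)) y)
      fun y => a k y * prodTestDer e k y := fun k =>
    (strongConvL2_meshDer_meshTest hW e k).bdd_mul (fun _ => isBddMeas_pcInterp _)
      (fun N => (ae_mem_Ioc_mixedVol W k).mono fun y hy => abs_pcInterp_le (haC N k) hy) (ha k)
      (hlim k)
  have h3 := tendsto_l2Mk (V := fun N k y => pcInterp N (aN N k) y *
    pcInterp N (meshDer W N k (meshTest e N)) y) h1 h2
  have h4 : l2Mk h1.2.1 (fun k => (h2 k).2.1) = fluxL2 lam ha (prodTestH1 e : L2Prod W) := by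
    refine L2Prod_ext (Lp.ext ?_) fun k => Lp.ext ?_
    · refine (l2Mk_fst _ _).trans (.trans ?_ (l2Mk_fst _ _).symm)
      exact (ae_eq_refl (fun _ => lam)).mul (l2Mk_fst (memLp_prodTest e) (memLp_prodTestDer e)).symm
    · refine (l2Mk_snd _ _ k).trans (.trans ?_ (l2Mk_snd _ _ k).symm)
      exact (ae_eq_refl (a k)).mul (l2Mk_snd (memLp_prodTest e) (memLp_prodTestDer e) k).symm
  rw [← h4]
  refine h3.congr fun N => ?_
  refine L2Prod_ext (Lp.ext ?_) fun k => Lp.ext ?_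
  · refine (l2Mk_fst _ _).trans (.trans ?_ (l2Mk_fst _ _).symm)
    filter_upwards [ae_mem_Ioc_torusVol] with y hy
    obtain ⟨x, hx⟩ := exists_mem_meshCell N hy
    simp only [pcInterp_of_mem hx, Pi.smul_apply, smul_eq_mul]
  · refine (l2Mk_snd _ _ k).trans (.trans ?_ (l2Mk_snd _ _ k).symm)
    filter_upwards [ae_mem_Ioc_mixedVol W k] with y hy
    exact pcInterp_mul hy _ _

/-- Weak limits of discrete solutions solve the limit equation. -/
theorem isWeakSolution_of_weakTendsto (hW : ∀ k, StrictMono (W k)) {C : ℝ}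
    (haC : ∀ N k x, |aN N k x| ≤ C) (ha : ∀ k, IsBddMeas (a k))
    (hlim : ∀ k, ∀ᵐ y ∂mixedVol W k, Tendsto (fun N => pcInterp N (aN N k) y) atTop (𝓝 (a k y)))
    {lam : ℝ} {fN : ∀ N : ℕ+, Mesh d N →ₗ[ℝ] ℝ} {f : StrongDual ℝ (H1W W)}
    (hf : StrongConvDual W fN f) {uN : ∀ N : ℕ+, Mesh d N}
    (huN : ∀ N, IsMeshSolution W N lam (aN N) (fN N) (uN N)) {l : Filter ℕ+} [l.NeBot]
    (hl : l ≤ atTop) {K : ℝ} (hK : ∀ᶠ N in l, ‖pcGrad W N (uN N)‖ ≤ K) {p : H1W W}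
    (hp : WeakTendsto (fun N => pcGrad W N (uN N)) l (p : L2Prod W)) : IsWeakSolution W lam a f p := by
  obtain ⟨FN, F, h1, h2, h3⟩ := hf.exists_tendsto
  rw [isWeakSolution_iff ha]
  refine ⟨fun v => ?_, fun h0 => ?_⟩
  · have h4 : inner ℝ (fluxL2 lam ha (p : L2Prod W) - F) (v : L2Prod W) = 0 := by
      refine inner_eq_zero_of_forall_prodTestH1 hW (fun e => ?_) v.2
      -- Symmetry of the limit form puts the coefficient on the test function, matching the discrete
      -- side.
      rw [inner_sub_left, sub_eq_zero, inner_fluxL2_comm, real_inner_comm]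
      have h5 := hp.inner_tendsto hK
        ((tendsto_pcL2_meshTest hW haC ha hlim lam e).mono_left hl)
      have h6 : Tendsto (fun N => inner ℝ (FN N) (pcGrad W N (meshTest e N))) l
          (𝓝 (inner ℝ F (prodTestH1 e : L2Prod W))) :=
        (h3.mono_left hl).inner ((tendsto_pcGrad_meshTest hW e).mono_left hl)
      refine tendsto_nhds_unique h5 (h6.congr fun N => ?_)
      rw [← meshForm_eq_inner, ← h1, ← (huN N).1]
      rfl
    rw [inner_sub_left, sub_eq_zero] at h4
    rw [h4, h2]
  · have h4 := hp.fst.integral_mul ((IsBddMeas.const (1 : ℝ)).memLp _ 2)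
    simp only [one_mul] at h4
    refine tendsto_nhds_unique h4 (tendsto_const_nhds.congr fun N => ?_)
    rw [integral_congr_ae (pcGrad_fst (uN N)), torusVol_eq, integral_pcInterp]
    simp only [prod_real_cell1_torusVol]
    rw [← Finset.sum_mul, (huN N).2 h0, zero_mul]

/-- The a priori estimate: test the discrete equation with its solution and use coercivity; the
right-hand sides are eventually bounded since they converge. -/
theorem eventually_norm_pcGrad_le (hW : ∀ k, StrictMono (W k)) {c : ℝ} (hc : 0 < c)
    (hac : ∀ N k x, c ≤ aN N k x) {lam : ℝ} (hlam : 0 ≤ lam)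
    {fN : ∀ N : ℕ+, Mesh d N →ₗ[ℝ] ℝ} {f : StrongDual ℝ (H1W W)} (hf : StrongConvDual W fN f)
    {uN : ∀ N : ℕ+, Mesh d N} (huN : ∀ N, IsMeshSolution W N lam (aN N) (fN N) (uN N)) :
    ∃ K, ∀ᶠ N in atTop, ‖pcGrad W N (uN N)‖ ≤ K := by
  obtain ⟨FN, F, h1, -, h3⟩ := hf.exists_tendsto
  obtain ⟨m, hm, hcoer⟩ := exists_coercive hW hlam hc
  refine ⟨(‖F‖ + 1) / m, ?_⟩
  filter_upwards [h3.norm.eventually_lt_const (lt_add_one ‖F‖)] with N hN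
  have h4 := hcoer N (aN N) (hac N) (uN N) (huN N).2
  have h5 : meshForm W N lam (aN N) (uN N) (uN N) = inner ℝ (FN N) (pcGrad W N (uN N)) := by
    rw [← h1, ← (huN N).1]; rfl
  rw [h5] at h4
  have h6 := h4.trans (real_inner_le_norm _ _)
  rw [le_div_iff₀ hm]
  rcases (norm_nonneg (pcGrad W N (uN N))).eq_or_lt with h | h
  · rw [← h, zero_mul]; positivity
  · have : m * ‖pcGrad W N (uN N)‖ ≤ ‖FN N‖ := by
      refine le_of_mul_le_mul_right ?_ h
      linarith [h6, sq (‖pcGrad W N (uN N)‖)]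
    linarith

/-- The `W`-interpolation of a mesh function as an element of `H_{1,W}`. -/
def wInterpH1 (hW : ∀ k, StrictMono (W k)) (N : ℕ+) (u : Mesh d N) : H1W W :=
  ⟨l2Mk ((isBddMeas_interp hW Finset.univ u).memLp _ _) fun k =>
      (isBddMeas_interp hW (Finset.univ.erase k) (meshDer W N k u)).memLp _ _,
    l2Mk_mem_H1W _ _ fun k => isWeakWDeriv_interp hW (Finset.mem_univ k) u⟩

theorem wInterpH1_fst (hW : ∀ k, StrictMono (W k)) (N : ℕ+) (u : Mesh d N) :
    (wInterpH1 hW N u : L2Prod W).fst = interpL2 hW N Finset.univ u := rfl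

theorem h1Fn_wInterpH1 (hW : ∀ k, StrictMono (W k)) (N : ℕ+) (u : Mesh d N) :
    h1Fn (wInterpH1 hW N u) =ᵐ[torusVol d] wInterp W N u := by
  filter_upwards [coeFn_interpL2 hW Finset.univ u, ae_mem_Ioc_torusVol] with y h1 hy
  rw [h1Fn, wInterpH1_fst, h1, wInterp_eq_interp u hy]

theorem norm_sq_wInterpH1_le (hW : ∀ k, StrictMono (W k)) (N : ℕ+) (u : Mesh d N) :
    ‖(wInterpH1 hW N u : L2Prod W)‖ ^ 2 ≤ 2 ^ d * ‖pcGrad W N u‖ ^ 2 := by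
  rw [norm_sq_L2Prod, norm_sq_pcGrad, mul_add, meshEnergy, Finset.mul_sum]
  refine add_le_add ?_ (Finset.sum_le_sum fun k _ => ?_)
  · rw [norm_sq_L2_eq]
    refine le_trans (le_of_eq (integral_congr_ae ?_)) (integral_interp_sq_torusVol_le hW Finset.univ u)
    filter_upwards [coeFn_interpL2 hW Finset.univ u] with y h
    rw [wInterpH1_fst, h]
  · rw [norm_sq_L2_eq]
    refine le_trans (le_of_eq (integral_congr_ae ?_))
      (integral_interp_sq_mixedVol_le hW (Finset.notMem_erase k Finset.univ) (meshDer W N k u))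
    have h1 : (wInterpH1 hW N u : L2Prod W).snd k =ᵐ[mixedVol W k]
      interp W N (Finset.univ.erase k) (meshDer W N k u) := l2Mk_snd _ _ k
    filter_upwards [h1] with y h
    rw [h]

/-- Every ultrafilter limit of the discrete solutions solves the limit equation, whose solution is
unique, so the whole sequence converges. Nothing is used about the coefficients except uniform
ellipticity, boundedness and almost everywhere convergence. -/
theorem isHomogenization_of_ae_tendsto (hW : ∀ k, StrictMono (W k)) {c C : ℝ} (hc : 0 < c)
    (hac : ∀ N k x, c ≤ aN N k x) (haC : ∀ N k x, |aN N k x| ≤ C) (ha : ∀ k, IsBddMeas (a k))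
    (hca : ∀ k y, c ≤ a k y) (haC' : ∀ k y, |a k y| ≤ C)
    (hlim : ∀ k, ∀ᵐ y ∂mixedVol W k, Tendsto (fun N => pcInterp N (aN N k) y) atTop (𝓝 (a k y))) :
    IsHomogenization W aN a := by
  -- One constant has to serve for both bounds: its inverse is at most `c` and it is at least `C`.
  refine ⟨⟨max c⁻¹ C, lt_max_of_lt_left (inv_pos.2 hc), fun N k x => ⟨?_, ?_⟩, fun k =>
    ⟨(ha k).1.aestronglyMeasurable, Eventually.of_forall fun y => ⟨?_, ?_⟩⟩⟩, ?_⟩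
  · exact (inv_le_of_inv_le₀ hc (le_max_left _ _)).trans (hac N k x)
  · exact (le_abs_self _).trans ((haC N k x).trans (le_max_right _ _))
  · exact (inv_le_of_inv_le₀ hc (le_max_left _ _)).trans (hca k y)
  · exact (le_abs_self _).trans ((haC' k y).trans (le_max_right _ _))
  intro lam hlam fN f hf h0
  have hmesh : ∀ N, ∃! u, IsMeshSolution W N lam (aN N) (fN N) u := fun N =>
    existsUnique_isMeshSolution hW hlam hc (hac N) (fN N) fun h => (h0 h).1 N
  have hweak : ∀ uN : ∀ N : ℕ+, Mesh d N,
      (∀ N, IsMeshSolution W N lam (aN N) (fN N) (uN N)) → ∀ U : Ultrafilter ℕ+, (U : Filter ℕ+) ≤ atTop →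
      ∃ p : H1W W, WeakTendsto (fun N => pcGrad W N (uN N)) U (p : L2Prod W) ∧
        IsWeakSolution W lam a f p := by
    intro uN huN U hU
    obtain ⟨K, hK⟩ := eventually_norm_pcGrad_le hW hc hac hlam hf huN
    obtain ⟨p, hp⟩ := exists_weakTendsto U (hK.filter_mono hU)
    have hpm := mem_H1W_of_weakTendsto hW hU (hK.filter_mono hU) hp
    exact ⟨⟨p, hpm⟩, hp, isWeakSolution_of_weakTendsto hW haC ha hlim hf huN hU
      (hK.filter_mono hU) hp⟩
  have huniq : ∀ u u', IsWeakSolution W lam a f u → IsWeakSolution W lam a f u' → u = u' :=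
    fun u u' hu hu' => hu.unique hW ha hlam hc hca hu'
  refine ⟨hmesh, ?_, fun uN u huN hu => ?_⟩
  -- Existence in `H_{1,W}` comes from a limit of discrete solutions along some ultrafilter below
  -- `atTop`.
  · choose uN huN _ using hmesh
    obtain ⟨p, -, hp⟩ := hweak uN huN (Ultrafilter.of atTop) (Ultrafilter.of_le _)
    exact ⟨p, hp, fun q hq => huniq q p hq hp⟩
  obtain ⟨K, hK⟩ := eventually_norm_pcGrad_le hW hc hac hlam hf huN
  have hconv : ∀ U : Ultrafilter ℕ+, (U : Filter ℕ+) ≤ atTop →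
      WeakTendsto (fun N => pcGrad W N (uN N)) U (u : L2Prod W) := fun U hU => by
    obtain ⟨p, hp, hps⟩ := hweak uN huN U hU
    rwa [← huniq p u hps hu]
  refine ⟨⟨fun N => wInterpH1 hW N (uN N), fun N => h1Fn_wInterpH1 hW N (uN N), fun φ => ?_⟩,
    fun k => ⟨fun N => (isBddMeas_pcInterp _).memLp _ _, (ha k).mul_memLp (Lp.memLp _),
      fun φ hφ => ?_⟩⟩
  · rw [tendsto_iff_ultrafilter]
    intro U hU
    have hb : ∀ᶠ N in (U : Filter ℕ+), ‖(wInterpH1 hW N (uN N) : L2Prod W)‖ ≤ √(2 ^ d * K ^ 2) := by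
      filter_upwards [hK.filter_mono hU] with N hN
      refine Real.le_sqrt_of_sq_le ((norm_sq_wInterpH1_le hW N (uN N)).trans ?_)
      gcongr
    obtain ⟨q, hq⟩ := exists_weakTendsto U hb
    have hqm : q ∈ H1W W := hq.mem_of_isClosed (H1W W) isClosed_H1W fun N => (wInterpH1 hW N (uN N)).2
    -- Only the functions are compared: the gradients of the `W`-interpolation are not piecewise
    -- constant, but injectivity of the first component identifies their weak limits as well.
    have h1 : q.fst = (u : L2Prod W).fst :=
      hq.fst.unique ((hconv U hU).fst.of_tendsto_sub
        (tendsto_interpL2_sub hW Finset.univ hU (hK.filter_mono hU)))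
    rw [fst_injOn_H1W hW hqm u.2 h1] at hq
    exact hq φ
  · rw [tendsto_iff_ultrafilter]
    intro U hU
    -- The flux is tested by moving the coefficient onto the fixed function `φ`, which makes the
    -- test functions strongly convergent.
    have h1 : StrongConvL2 (mixedVol W k) (fun N y => pcInterp N (aN N k) y * φ y)
        fun y => a k y * φ y :=
      StrongConvL2.bdd_mul (φ := fun _ => φ) ⟨fun _ => hφ, hφ, by simp⟩
        (fun _ => isBddMeas_pcInterp _)
        (fun N => (ae_mem_Ioc_mixedVol W k).mono fun y hy => abs_pcInterp_le (haC N k) hy) (ha k)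
        (hlim k)
    have h2 := ((hconv U hU).snd k).inner_tendsto (K := K)
      ((hK.filter_mono hU).mono fun N hN => (L2Prod.norm_snd_le _ k).trans hN)
      (h1.tendsto_toLp.mono_left hU)
    have h3 : inner ℝ ((u : L2Prod W).snd k) (h1.2.1.toLp fun y => a k y * φ y)
        = ∫ y, a k y * h1Deriv u k y * φ y ∂mixedVol W k := by
      rw [inner_L2_eq]
      refine integral_congr_ae ?_
      filter_upwards [h1.2.1.coeFn_toLp] with y hy
      rw [hy, h1Deriv]; ring
    rw [h3] at h2
    refine h2.congr fun N => ?_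
    rw [inner_L2_eq]
    refine integral_congr_ae ?_
    filter_upwards [(h1.1 N).coeFn_toLp, pcGrad_snd (W := W) (uN N) k, ae_mem_Ioc_mixedVol W k]
      with y hy h4 hy2
    rw [hy, h4, ← pcInterp_mul hy2]; ring

theorem pcInterp_inv {N : ℕ+} (u : Mesh d N) {y : Fin d → ℝ} (hy : ∀ i, y i ∈ Ioc (0 : ℝ) 1) :
    pcInterp N u⁻¹ y = (pcInterp N u y)⁻¹ := by
  obtain ⟨x, hx⟩ := exists_mem_meshCell N hy
  simp only [pcInterp_of_mem hx, Pi.inv_apply]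

end

/-! ### Cell averages satisfy the criterion -/

theorem proposition5p9 {d : ℕ} (W : Fin d → StieltjesFunction ℝ)
    (hmono : ∀ k, StrictMono (W k))
    (hper : ∀ k u, W k (u + 1) - W k u = W k 1 - W k 0)
    (a : Fin d → (Fin d → ℝ) → ℝ) (ha : a ∈ MW W)
    (θ : ℝ) (hθ : 0 < θ) (hell : ∀ k x, θ⁻¹ ≤ a k x) :
    (∀ k, StrongConvL2 (mixedVol W k) (fun N => pcInterp N (cellAverage W a N k)) (a k)) ∧
    (∀ k, StrongConvL2 (mixedVol W k) (fun N => pcInterp N (cellAverage W a N k)⁻¹)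
      (fun y => (a k y)⁻¹)) ∧
    IsHomogenization W (cellAverage W a) a := by
  have hc : 0 < θ⁻¹ := inv_pos.2 hθ
  have hb : ∀ k, IsBddMeas (a k) := fun k => (tendsto_pcInterp_cellAverage hmono k (ha k).1).1
  have hlim : ∀ k, ∀ᵐ y ∂mixedVol W k,
      Tendsto (fun N => pcInterp N (cellAverage W a N k) y) atTop (𝓝 (a k y)) := fun k =>
    (tendsto_pcInterp_cellAverage hmono k (ha k).1).2
  choose D hD using fun k => (hb k).2
  -- The sum of the individual bounds serves for all directions `k` at once.
  have hDC : ∀ k y, |a k y| ≤ ∑ j, |D j| := fun k y => (hD k y).trans ((le_abs_self _).trans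
    (Finset.single_le_sum (f := fun j => |D j|) (fun j _ => abs_nonneg _) (Finset.mem_univ k)))
  have hC : ∀ N k x, |cellAverage W a N k x| ≤ ∑ j, |D j| := fun N k x =>
    abs_cellAverage_le hmono (hDC k) N x
  have hge : ∀ N k x, θ⁻¹ ≤ cellAverage W a N k x := fun N k x =>
    le_cellAverage hmono (hb k) (hell k) N x
  refine ⟨fun k => ?_, fun k => ?_, isHomogenization_of_ae_tendsto hmono hc hge hC hb hell hDC hlim⟩
  · exact strongConvL2_of_bdd (fun N => (isBddMeas_pcInterp _).1.aestronglyMeasurable)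
      (fun N => (ae_mem_Ioc_mixedVol W k).mono fun y hy => abs_pcInterp_le (hC N k) hy) (hlim k)
  -- Averages inherit the lower bound `θ⁻¹`, so the reciprocals are bounded by `θ` and inversion is
  -- continuous at the limit value.
  · refine strongConvL2_of_bdd (C := θ) (fun N => (isBddMeas_pcInterp _).1.aestronglyMeasurable)
      (fun N => (ae_mem_Ioc_mixedVol W k).mono fun y hy => abs_pcInterp_le (fun x => ?_) hy) ?_
    · have h1 := hge N k x
      rw [Pi.inv_apply, abs_of_nonneg (inv_nonneg.2 (hc.le.trans h1))]
      exact inv_le_of_inv_le₀ hθ h1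
    · filter_upwards [hlim k, ae_mem_Ioc_mixedVol W k] with y h1 hy
      refine (h1.inv₀ (hc.trans_le (hell k y)).ne').congr fun N => ?_
      rw [pcInterp_inv _ hy]
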